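/- Let $q$ be an odd prime power, $\varepsilon\in\mathbb F_q$ a non-square, $\psi$ a non-trivial additive character of $\mathbb F_q$, and $G=SL_2(\mathbb F_q)$. Let $U=\mathbb F_q^2$ carry the symmetric bilinear form $\beta$ with $\beta(u,u)=x^2-\varepsilon y^2$ for $u=(x,y)$ (the anisotropic plane), with isometry group $O_{2-}$ and $SO_{2-}=\ker(\det)$; let $V=\mathbb F_q^2$ carry its standard symplectic form, and give $W=U\otimes V$ the symplectic form $\beta\otimes\langle\,,\rangle_V$. The Heisenberg group is $H=W\times\mathbb F_q$ with $(w,z)(w',z')=(w+w',z+z'+\tfrac12\langle w,w'\rangle)$. An oscillator representation $\omega=\omega_{U\otimes V}$ is a representation of $Sp(W)$ on the space of an irreducible representation $\pi$ of $H$ with central character $\psi$ such that $\omega(g)\pi(h)\omega(g)^{-1}=\pi(g(h))$, where $g(w,z)=(gw,z)$. Let $R$ be the representation $R(a,g)=\left(\frac{\det a}{q}\right)\omega(a\otimes g)$ of $O_{2-}\times G$, where $\left(\frac{\cdot}{q}\right)$ is the Legendre symbol of $\mathbb F_q$; that is, $\omega$ is restricted to $O_{2-}\times G$ with the normalisation for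 which, in the Schrödinger model on functions on $U$, $O_{2-}$ acts by its permutation representation (the factor is $1$ if $q\equiv1\bmod4$). Write $R=\sum_{\tau}\tau\otimes\Theta(\tau)$ over the irreducible representations $\tau$ of $O_{2-}$, where $\Theta(\tau)=\mathrm{Hom}_{O_{2-}}(\tau,R)$ is a representation of $G$. A representation of $G$ belongs to $F^k$ if it embeds in a finite direct sum of $\ell$-fold tensor products, $\ell\le k$, of the four irreducible representations of $G$ of dimensions $\frac{q\pm1}2$ (for $q=3$, where six irreducible representations have these dimensions, the four of them that are not invariant under conjugation by $GL_2(\mathbb F_3)$); it has tensor rank $k$ if it belongs to $F^k$ but not to $F^{k-1}$. An oscillator representation exists, and for every oscillator representation the following holds. Every irreducible representation $\tau\neq sgn=\det$ of $O_{2-}$ appears in $R|_{O_{2-}}$, and for these $\tau$ the representations $\Theta(\tau)$ of $G$ are irreducible and pairwise non-isomorphic. On the sum of the isotypic components in $R|_G$ of the irreducible representations of $G$ of tensor rank $2$, the algebras of operators generated by $O_{2-}$ and by $G$ are each other's commutant. Moreover: (1) $\Theta(1)$ has tensor rank $2$ and dimension $q$, and it is the Steinberg representation, i.e. it is isomorphic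 to the representation of $G$ on the functions of sum zero on the set of lines in $V$. (2) For each character $\mu\ne\mu^{-1}$ of $SO_{2-}$, the representation $\tau_\mu=\mathrm{Ind}_{SO_{2-}}^{O_{2-}}(\mu)$ is irreducible, and $\Theta(\tau_\mu)$ has tensor rank $2$ and dimension $q-1$. (3) Let $\mu_2$ be the non-trivial character of $SO_{2-}$ with $\mu_2^2=1$ and let $r\in O_{2-}\smallsetminus SO_{2-}$. Then $\mathrm{Ind}_{SO_{2-}}^{O_{2-}}(\mu_2)$ is the direct sum of two irreducible subrepresentations $\tau_{\mu_2}^{\pm}$, the $\pm1$-eigenspaces of $r$, and $\Theta(\tau_{\mu_2}^{+})$, $\Theta(\tau_{\mu_2}^{-})$ are the two irreducible representations of $G$ of tensor rank $1$ and dimension $\frac{q-1}2$: they have this rank and dimension, they are not isomorphic, and every irreducible representation of $G$ of tensor rank $1$ and dimension $\frac{q-1}2$ is isomorphic to one of them. -/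

import Mathlib

open scoped TensorProduct
open Representation

noncomputable section

namespace EtaCorr

universe u v w

/-! ### Isometry groups and the Heisenberg group -/

section Forms

variable {F : Type*} [Field F] {W : Type*} [AddCommGroup W] [Module F W]

/-- The group of linear automorphisms preserving a bilinear form: the symplectic group `Sp(W)` for
a symplectic form, the orthogonal group `O_β` for an inner product `β`. -/
def isometryGroup (B : LinearMap.BilinForm F W) : Subgroup (W ≃ₗ[F] W) where
  carrier := {g | ∀ x y, B (g x) (g y) = B x y}
  one_mem' := fun _ _ => rfl
  mul_mem' := fun {a b} ha hb x y => by
    change B (a (b x)) (a (b y)) = B x y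
    rw [ha, hb]
  inv_mem' := fun {a} ha x y => by
    change B (a.symm x) (a.symm y) = B x y
    have := ha (a.symm x) (a.symm y)
    simpa using this.symm

/-- The Heisenberg group `H = W × F` attached to a form `⟨ , ⟩` on `W`. -/
@[ext] structure Heis (_B : LinearMap.BilinForm F W) where
  w : W
  z : F

namespace Heis

variable {B : LinearMap.BilinForm F W}

instance : Mul (Heis B) := ⟨fun h h' => ⟨h.w + h'.w, h.z + h'.z + 1 / 2 * B h.w h'.w⟩⟩

instance : One (Heis B) := ⟨⟨0, 0⟩⟩

-- The last summand vanishes for an alternating form.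
instance : Inv (Heis B) := ⟨fun h => ⟨-h.w, -h.z + 1 / 2 * B h.w h.w⟩⟩

@[simp] lemma mul_w (h h' : Heis B) : (h * h').w = h.w + h'.w := rfl

@[simp] lemma mul_z (h h' : Heis B) :
    (h * h').z = h.z + h'.z + 1 / 2 * B h.w h'.w := rfl

@[simp] lemma one_w : (1 : Heis B).w = 0 := rfl

@[simp] lemma one_z : (1 : Heis B).z = 0 := rfl

@[simp] lemma inv_w (h : Heis B) : (h⁻¹).w = -h.w := rfl

@[simp] lemma inv_z (h : Heis B) : (h⁻¹).z = -h.z + 1 / 2 * B h.w h.w := rfl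

instance : Group (Heis B) where
  mul_assoc a b c := by
    ext
    · simp [add_assoc]
    · simp only [mul_z, mul_w, map_add, LinearMap.add_apply]; ring
  one_mul a := by ext <;> simp
  mul_one a := by ext <;> simp
  inv_mul_cancel a := by ext <;> simp

end Heis

/-- `π` is a Heisenberg representation with central character `ψ` (an irreducible representation of
the Heisenberg group on which the center acts through `ψ`), and `ω` is an oscillator representation
attached to it: a representation of `Sp(W)` on the space of `π` satisfying
`ω(g) π(h) ω(g)⁻¹ = π(g(h))`, where `g(w, z) = (g w, z)`. -/
structure IsOscillator (B : LinearMap.BilinForm F W) (ψ : AddChar F ℂ)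
    {E : Type*} [AddCommGroup E] [Module ℂ E]
    (π : Representation ℂ (Heis B) E) (ω : Representation ℂ (isometryGroup B) E) : Prop where
  irreducible : π.IsIrreducible
  central : ∀ z : F, π ⟨0, z⟩ = ψ z • LinearMap.id
  egorov : ∀ (g : isometryGroup B) (x : W) (z : F),
    ω g ∘ₗ π ⟨x, z⟩ ∘ₗ ω g⁻¹ = π ⟨(g : W ≃ₗ[F] W) x, z⟩

end Forms

/-! ### The dual pair of the anisotropic plane -/

section DualPair

variable {F : Type u} [Field F]

/-- The inner product on `U = F²` with `β(u, u) = x² - ε y²` for `u = (x, y)`. -/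
def betaForm (ε : F) : LinearMap.BilinForm F (Fin 2 → F) :=
  Matrix.toBilin' !![1, 0; 0, -ε]

/-- The symplectic form on `V = F²`. -/
def sympForm (F : Type u) [Field F] : LinearMap.BilinForm F (Fin 2 → F) :=
  Matrix.toBilin' !![0, 1; -1, 0]

/-- The orthogonal group of `(U, β)`. -/
abbrev Ortho (ε : F) : Type u := isometryGroup (betaForm ε)

/-- The group `G = SL₂(F)`. -/
abbrev SL2 (F : Type u) [Field F] : Type u := Matrix.SpecialLinearGroup (Fin 2) F

/-- The symplectic form `β ⊗ ⟨ , ⟩` on `U ⊗ V`. -/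
def tensorForm (ε : F) : LinearMap.BilinForm F ((Fin 2 → F) ⊗[F] (Fin 2 → F)) :=
  (betaForm ε).tmul (sympForm F)

lemma sympForm_toLin' (g : SL2 F) (x y : Fin 2 → F) :
    sympForm F (Matrix.SpecialLinearGroup.toLin' g x) (Matrix.SpecialLinearGroup.toLin' g y)
      = sympForm F x y := by
  have hd := g.det_coe
  rw [Matrix.det_fin_two] at hd
  simp only [sympForm, Matrix.toBilin'_apply, Matrix.SpecialLinearGroup.toLin'_apply,
    Matrix.toLin'_apply, Matrix.mulVec, dotProduct, Fin.sum_univ_two, Matrix.of_apply,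
    Matrix.cons_val', Matrix.cons_val_zero, Matrix.cons_val_one, Matrix.cons_val_fin_one]
  linear_combination (x 0 * y 1 - x 1 * y 0) * hd

/-- The homomorphism `O_β × G → Sp(U ⊗ V)`, `(a, g) ↦ a ⊗ g`. -/
def dualPairHom (ε : F) : Ortho ε × SL2 F →* isometryGroup (tensorForm ε) where
  toFun p := ⟨TensorProduct.congr (p.1 : (Fin 2 → F) ≃ₗ[F] (Fin 2 → F))
      (Matrix.SpecialLinearGroup.toLin' p.2), by
    intro x y
    have h : (tensorForm ε).compl₁₂
        (TensorProduct.congr (p.1 : (Fin 2 → F) ≃ₗ[F] (Fin 2 → F))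
          (Matrix.SpecialLinearGroup.toLin' p.2)).toLinearMap
        (TensorProduct.congr (p.1 : (Fin 2 → F) ≃ₗ[F] (Fin 2 → F))
          (Matrix.SpecialLinearGroup.toLin' p.2)).toLinearMap = tensorForm ε := by
      refine TensorProduct.ext' fun a b => TensorProduct.ext' fun c d => ?_
      simp only [LinearMap.compl₁₂_apply, LinearEquiv.coe_coe, TensorProduct.congr_tmul,
        tensorForm, LinearMap.BilinForm.tensorDistrib_tmul, sympForm_toLin', p.1.2 a c]
    exact LinearMap.congr_fun₂ h x y⟩
  map_one' := by
    apply Subtype.ext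
    apply LinearEquiv.toLinearMap_injective
    refine TensorProduct.ext' fun a b => ?_
    simp
  map_mul' p p' := by
    apply Subtype.ext
    apply LinearEquiv.toLinearMap_injective
    refine TensorProduct.ext' fun a b => ?_
    simp

/-- The determinant on `O_β`. -/
def detO (ε : F) : Ortho ε →* Fˣ := LinearEquiv.det.comp (isometryGroup (betaForm ε)).subtype

/-- The special orthogonal group of `(U, β)`, as a subgroup of `O_β`. -/
def SOrtho (ε : F) : Subgroup (Ortho ε) := (detO ε).ker

/-- The restriction of `ω` to `O_β × G`, normalised on `O_β` by the quadratic character of the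
determinant: `(a, g) ↦ χ(det a) ω(a ⊗ g)`, where `χ` is the Legendre symbol of `F`. In the
Schrödinger model on the functions on `U`, where `ω(a ⊗ 1) f = χ(det a) f ∘ a⁻¹`, the group `O_β`
then acts by permutations of `U`. As `det a = ±1`, the factor is trivial when `-1` is a square. -/
def oscRes [Fintype F] [DecidableEq F] (ε : F) {E : Type*} [AddCommGroup E] [Module ℂ E]
    (ω : Representation ℂ (isometryGroup (tensorForm ε)) E) :
    Representation ℂ (Ortho ε × SL2 F) E where
  toFun p := ((quadraticChar F (detO ε p.1 : F) : ℤ) : ℂ) • ω (dualPairHom ε p)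
  map_one' := by simp
  map_mul' p p' := by
    simp only [Prod.fst_mul, map_mul, Units.val_mul, Int.cast_mul]
    rw [smul_mul_smul_comm]

end DualPair

/-! ### Representations of the orthogonal group -/

section OrthoReps

variable {F : Type u} [Field F]

/-- `τ` is (isomorphic to) the sign representation `det : O_β → {±1}`. -/
def IsSgn {ε : F} {T : Type*} [AddCommGroup T] [Module ℂ T]
    (τ : Representation ℂ (Ortho ε) T) : Prop :=
  Module.finrank ℂ T = 1 ∧
    ∀ a : Ortho ε, (detO ε a = 1 → τ a = LinearMap.id) ∧ (detO ε a ≠ 1 → τ a = -LinearMap.id)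

/-- The functions `f` on `O_β` with `f (s h) = μ(s) f(h)` for `s ∈ SO_β`. -/
def tauSpace {ε : F} (μ : SOrtho ε →* ℂˣ) : Submodule ℂ (Ortho ε → ℂ) where
  carrier := {f | ∀ (s : SOrtho ε) (h : Ortho ε), f ((s : Ortho ε) * h) = (μ s : ℂ) * f h}
  add_mem' := fun {f f'} hf hf' s h => by
    change f _ + f' _ = _ * (f h + f' h)
    rw [hf, hf', mul_add]
  zero_mem' := fun s h => (mul_zero _).symm
  smul_mem' := fun c f hf s h => by
    change c * f _ = _ * (c * f h)
    rw [hf, mul_left_comm]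

/-- The representation `τ_μ` of `O_β` induced from a character `μ` of `SO_β`: the functions `f` on
`O_β` with `f (s h) = μ(s) f(h)`, with `O_β` acting by right translations. -/
def tauInd {ε : F} (μ : SOrtho ε →* ℂˣ) : Representation ℂ (Ortho ε) (tauSpace μ) where
  toFun a := (LinearMap.funLeft ℂ ℂ (fun h : Ortho ε => h * a)).restrict
    (fun f hf s h => by
      change f ((s : Ortho ε) * h * a) = _ * f (h * a)
      rw [mul_assoc]
      exact hf s (h * a))
  map_one' := by
    ext f h
    change f.1 (h * 1) = f.1 h
    rw [mul_one]
  map_mul' a b := by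
    ext f h
    change f.1 (h * (a * b)) = f.1 (h * a * b)
    rw [mul_assoc]

/-- A subrepresentation, as a representation. -/
abbrev subRep {Γ : Type*} [Group Γ] {V : Type*} [AddCommGroup V] [Module ℂ V]
    {ρ : Representation ℂ Γ V} (s : Subrepresentation ρ) : Representation ℂ Γ s.toSubmodule :=
  s.toRepresentation

end OrthoReps

/-! ### Multiplicity spaces -/

section Theta

variable {A B : Type*} [Group A] [Group B] {E : Type*} [AddCommGroup E] [Module ℂ E]

/-- Restriction of a representation of `A × B` to the first factor. -/
abbrev resFst (R : Representation ℂ (A × B) E) : Representation ℂ A E :=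
  R.comp (MonoidHom.inl A B)

/-- Restriction of a representation of `A × B` to the second factor. -/
abbrev resSnd (R : Representation ℂ (A × B) E) : Representation ℂ B E :=
  R.comp (MonoidHom.inr A B)

lemma res_commute (R : Representation ℂ (A × B) E) (a : A) (b : B) :
    resSnd R b ∘ₗ resFst R a = resFst R a ∘ₗ resSnd R b := by
  change R (1, b) * R (a, 1) = R (a, 1) * R (1, b)
  rw [← map_mul, ← map_mul]
  simp

/-- The action of `B` as endomorphisms of the restriction to `A`. -/
def sndIntertwining (R : Representation ℂ (A × B) E) (b : B) :
    IntertwiningMap (resFst R) (resFst R) :=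
  ⟨resSnd R b, fun a => res_commute R a b⟩

/-- The action of `A` as endomorphisms of the restriction to `B`. -/
def fstIntertwining (R : Representation ℂ (A × B) E) (a : A) :
    IntertwiningMap (resSnd R) (resSnd R) :=
  ⟨resFst R a, fun b => (res_commute R a b).symm⟩

/-- The multiplicity space `Hom_A(τ, R)` of `τ` in a representation `R` of `A × B`. -/
abbrev ThetaSpace {T : Type*} [AddCommMonoid T] [Module ℂ T] (R : Representation ℂ (A × B) E)
    (τ : Representation ℂ A T) : Type _ := IntertwiningMap τ (resFst R)

/-- The representation `Θ(τ)` of `B` in the decomposition `R = ∑ τ ⊗ Θ(τ)` of a representation of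
`A × B` into isotypic components for `A`: the multiplicity space `Hom_A(τ, R)`, with `B` acting on
the values. -/
def Theta {T : Type*} [AddCommMonoid T] [Module ℂ T] (R : Representation ℂ (A × B) E)
    (τ : Representation ℂ A T) : Representation ℂ B (ThetaSpace R τ) where
  toFun b :=
    { toFun := fun f => (sndIntertwining R b).comp f
      map_add' := fun f f' => by ext x; simp
      map_smul' := fun c f => by ext x; simp }
  map_one' := by
    ext f x
    change resSnd R 1 (f x) = f x
    rw [map_one]; rfl
  map_mul' b b' := by
    ext f x
    change resSnd R (b * b') (f x) = resSnd R b (resSnd R b' (f x))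
    rw [map_mul]; rfl

end Theta

/-! ### Tensor rank -/

section TensorRank

variable {F : Type u} [Field F]

/-- `σ` is isomorphic to each of its conjugates `g ↦ σ(h g h⁻¹)`, `h ∈ GL₂(F)`. -/
def IsGLInvariant {E : Type*} [AddCommGroup E] [Module ℂ E]
    (σ : Representation ℂ (SL2 F) E) : Prop :=
  ∀ (h : GL (Fin 2) F) (φ : SL2 F ≃* SL2 F),
    (∀ g : SL2 F, (φ g : Matrix (Fin 2) (Fin 2) F) = h * (g : Matrix (Fin 2) (Fin 2) F) *
      ((h⁻¹ : GL (Fin 2) F) : Matrix (Fin 2) (Fin 2) F)) →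
    Nonempty (Representation.Equiv σ (σ.comp φ.toMonoidHom))

/-- `σ` is one of the four irreducible representations of `SL₂(F_q)` of dimension `(q ± 1) / 2`.
For `q = 3` there are two more irreducible representations of dimension `1` or `2`, the trivial one
and one of dimension `2`; they are the `GL₂`-invariant ones (the four are the proper constituents
of restrictions of irreducible representations of `GL₂(F_q)`). -/
def IsDegenerate [Fintype F] {E : Type*} [AddCommGroup E] [Module ℂ E]
    (σ : Representation ℂ (SL2 F) E) : Prop :=
  σ.IsIrreducible ∧
    (2 * Module.finrank ℂ E = Fintype.card F - 1 ∨ 2 * Module.finrank ℂ E = Fintype.card F + 1) ∧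
    (Fintype.card F = 3 → ¬ IsGLInvariant σ)

/-- The `ℓ`-fold tensor products of the four irreducible representations of dimension
`(q ± 1) / 2`. -/
inductive IsFoldProduct [Fintype F] : ℕ → ∀ (E : Type) [AddCommGroup E] [Module ℂ E],
    Representation ℂ (SL2 F) E → Prop
  | zero : IsFoldProduct 0 ℂ (Representation.trivial ℂ (SL2 F) ℂ)
  | succ (ℓ : ℕ) (E E' : Type) [AddCommGroup E] [Module ℂ E] [AddCommGroup E'] [Module ℂ E']
      (ρ : Representation ℂ (SL2 F) E) (σ : Representation ℂ (SL2 F) E') :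
      IsFoldProduct ℓ E ρ → IsDegenerate σ → IsFoldProduct (ℓ + 1) (E ⊗[ℂ] E') (ρ.tprod σ)

/-- `ρ` belongs to `F^k`: it appears in a finite sum of `ℓ`-fold tensor products, `ℓ ≤ k`, of the
four irreducible representations of dimension `(q ± 1) / 2`. -/
def InFiltration [Fintype F] (k : ℕ) {E : Type*} [AddCommGroup E] [Module ℂ E]
    (ρ : Representation ℂ (SL2 F) E) : Prop :=
  ∃ (m : ℕ) (D : Fin m → Type) (_ : ∀ i, AddCommGroup (D i)) (_ : ∀ i, Module ℂ (D i))
    (σ : ∀ i, Representation ℂ (SL2 F) (D i)),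
    (∀ i, ∃ ℓ ≤ k, IsFoldProduct ℓ (D i) (σ i)) ∧
    ∃ f : IntertwiningMap ρ (Representation.directSum σ), Function.Injective f

/-- `ρ` has tensor rank `k`: it belongs to `F^k` but not to `F^{k-1}`. -/
def HasTensorRank [Fintype F] (k : ℕ) {E : Type*} [AddCommGroup E] [Module ℂ E]
    (ρ : Representation ℂ (SL2 F) E) : Prop :=
  InFiltration k ρ ∧ ∀ j < k, ¬ InFiltration j ρ

/-- The `k`-spectrum: the sum of the isotypic components (spanned by the images of intertwining
maps) of the irreducible representations of `SL₂(F)` of tensor rank `k`. It is stable under both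
factors. -/
def rankSpectrum [Fintype F] {A : Type*} [Group A] {E : Type*} [AddCommGroup E] [Module ℂ E]
    (R : Representation ℂ (A × SL2 F) E) (k : ℕ) : Subrepresentation R where
  toSubmodule := Submodule.span ℂ {v | ∃ (D : Type) (_ : AddCommGroup D) (_ : Module ℂ D)
    (σ : Representation ℂ (SL2 F) D), σ.IsIrreducible ∧ HasTensorRank k σ ∧
      ∃ (f : IntertwiningMap σ (resSnd R)) (x : D), f x = v}
  apply_mem_toSubmodule p v hv := by
    induction hv using Submodule.span_induction with
    | mem v hv =>
      obtain ⟨D, i1, i2, σ, h1, h2, f, x, rfl⟩ := hv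
      refine Submodule.subset_span
        ⟨D, i1, i2, σ, h1, h2, (fstIntertwining R p.1).comp f, σ p.2 x, ?_⟩
      have h3 : f (σ p.2 x) = resSnd R p.2 (f x) := IntertwiningMap.isIntertwining _ _ f p.2 x
      change resFst R p.1 (f (σ p.2 x)) = R p (f x)
      rw [h3]
      change (R (p.1, 1) * R (1, p.2)) (f x) = R p (f x)
      rw [← map_mul]
      simp
    | zero => simp
    | add x y _ _ hx hy => rw [map_add]; exact Submodule.add_mem _ hx hy
    | smul c x _ hx => rw [map_smul]; exact Submodule.smul_mem _ c hx

end TensorRank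

/-- The algebra of endomorphisms generated by (the operators of) a representation. -/
def groupAlg {Γ : Type*} [Group Γ] {E : Type*} [AddCommGroup E] [Module ℂ E]
    (ρ : Representation ℂ Γ E) : Subalgebra ℂ (Module.End ℂ E) :=
  Algebra.adjoin ℂ (Set.range ρ)

/-! ### The Steinberg representation -/

section Steinberg

variable (F : Type u) [Field F] [Finite F]

/-- The permutation representation of `SL₂(F)` on the functions on the lines of `V = F²`. -/
def lineRep : Representation ℂ (SL2 F) (Projectivization F (Fin 2 → F) → ℂ) where
  toFun g := LinearMap.funLeft ℂ ℂ (fun x => g⁻¹ • x)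
  map_one' := by ext; simp
  map_mul' g h := by
    ext
    simp [mul_smul]

/-- The Steinberg representation: functions of sum zero on the set of lines of `V = F²`. -/
def steinbergSub : Subrepresentation (lineRep F) where
  toSubmodule :=
    { carrier := {f | ∑ᶠ x, f x = 0}
      add_mem' := by
        intro f f' hf hf'
        simp only [Set.mem_ofPred_eq, Pi.add_apply] at *
        rw [finsum_add_distrib (Set.toFinite _) (Set.toFinite _), hf, hf', add_zero]
      zero_mem' := by simp
      smul_mem' := by
        intro c f hf
        simp only [Set.mem_ofPred_eq, Pi.smul_apply] at *
        rw [← smul_finsum, hf, smul_zero] }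
  apply_mem_toSubmodule g f hf := by
    change ∑ᶠ x, f (g⁻¹ • x) = 0
    exact (finsum_comp_equiv (MulAction.toPerm g⁻¹) (f := f)).trans hf

/-- The Steinberg representation of `SL₂(F)`. -/
def steinberg : Representation ℂ (SL2 F) (steinbergSub F).toSubmodule :=
  (steinbergSub F).toRepresentation

end Steinberg

end EtaCorr

end

open scoped TensorProduct
open Representation

noncomputable section

namespace EtaCorr

universe u v w

/-! ### Representations of finite groups -/

section Finite

variable {Γ : Type*} [Group Γ] {V V' : Type*} [AddCommGroup V] [Module ℂ V]
  [AddCommGroup V'] [Module ℂ V']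

/-! By Stone–von Neumann every oscillator representation is realised on functions on `U`, where the
operator implementing a symplectic map is unique up to a scalar. The scalar is pinned down by
`parityDet`: the even functions have one dimension more than the odd ones, so `parityDet A • A` is
unchanged when `A` is rescaled, and these operators form a genuine representation (`exists_weil`).
An arbitrary oscillator representation differs from this one by a character of the symplectic group.
That character is trivial on `G` and on the reflections of `U`, because both act as products of
transvections (`hom_sl2Pair`, `hom_orthoPair_refl`). So, up to equivalence, `R` is an explicit model
(`exists_isModel`): the orthogonal group permutes the points of `U`, and lower unipotent elements
multiply by `ψ(-t N / 2)`, with `N` the norm form of the plane.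

The duality is a dimension count. The product of the character values at `g` and `g⁻¹` is the number
of fixed points of `g` on `U × U`; summing over `G` shows that the commutant of `G` has dimension
`2q + 1` (`IsModel.finrank_end`). The `2(q + 1)` permutation operators satisfy at most one linear
relation (`add_eq_zero_of_sum_permOp`), hence span this commutant (`IsModel.commutantSpanned`).
Irreducibility of `Θ(τ)`, recovery of `τ` from `Θ(τ)` and the mutual commutants are then formal
consequences of complete reducibility (`theta_isIrreducible`, `nonempty_equiv_of_theta`,
`centralizer_groupAlg_snd`, `centralizer_centralizer_groupAlg`). The permutation character gives all
dimensions (`IsModel.finrank_theta`); `sgn` is the one irreducible representation for which the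
result is zero.

For the rank, the form on `U` is diagonal, so `R` on `G` is a product of Weil representations of two
lines, and each of these is the sum of two of the four small representations, on even and odd
functions. So every `Θ(τ)` lies in `F²` (`IsWeil.inFiltration_two`). An irreducible member of `F¹`
is trivial or small; dimensions `q` and `q - 1` exclude this, except that `q - 1 = (q + 1) / 2` for
`q = 3`. There the similitudes of `U` show that `Θ(τ_μ)` is invariant under `GL₂`
(`IsModel.isGLInvariant_theta`), which the four small representations are not.

In dimension `(q - 1) / 2` rank one is direct, and completeness is the hard direction: such a
representation has no vector fixed by the unipotent elements (`forall_eq_id_of_low_fixed`), a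
Cauchy–Schwarz estimate of characters then forces it to occur in `R`
(`IsModel.exists_intertwining`), and so it is some `Θ(τ)`, with `τ` determined up to sign by its
dimension. Finally, the delta function at the origin gives a vector of `Θ(1)` fixed by the lower
triangular group, which identifies `Θ(1)` with the Steinberg representation (`equiv_steinberg`). -/

theorem map_rep {ρ : Representation ℂ Γ V} {σ : Representation ℂ Γ V'} (f : IntertwiningMap ρ σ)
    (g : Γ) (v : V) : f (ρ g v) = σ g (f v) :=
  IntertwiningMap.isIntertwining ρ σ f g v

theorem Equiv.map_rep {ρ : Representation ℂ Γ V} {σ : Representation ℂ Γ V'}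
    (e : Representation.Equiv ρ σ) (g : Γ) (v : V) : e (ρ g v) = σ g (e v) :=
  IntertwiningMap.isIntertwining ρ σ e.toIntertwiningMap g v

theorem isIrreducible_of_forall [Nontrivial V] {ρ : Representation ℂ Γ V}
    (h : ∀ X : Subrepresentation ρ, ∀ v ∈ X, v ≠ 0 → ∀ w, w ∈ X) : ρ.IsIrreducible := by
  refine { exists_pair_ne := ⟨⊥, ⊤, fun hbt => ?_⟩, eq_bot_or_eq_top := fun X => ?_ }
  · obtain ⟨v, hv⟩ := exists_ne (0 : V)
    have h1 : v ∈ (⊤ : Subrepresentation ρ).toSubmodule := Submodule.mem_top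
    rw [← hbt] at h1
    exact hv ((Submodule.mem_bot ℂ).1 h1)
  · by_cases hX : ∃ v ∈ X, v ≠ 0
    · right
      obtain ⟨v, hv, hv0⟩ := hX
      apply SetLike.ext
      intro w
      exact ⟨fun _ => Submodule.mem_top (R := ℂ), fun _ => h X v hv hv0 w⟩
    · left
      push Not at hX
      apply SetLike.ext
      intro w
      exact ⟨fun hw => (Submodule.mem_bot ℂ).2 (hX w hw), fun hw => by
        rw [(Submodule.mem_bot ℂ).1 hw]; exact X.toSubmodule.zero_mem⟩

theorem IsIrred.mem {ρ : Representation ℂ Γ V} (hρ : ρ.IsIrreducible)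
    (X : Subrepresentation ρ) {v : V} (hv : v ∈ X) (hv0 : v ≠ 0) (w : V) : w ∈ X := by
  rcases hρ.eq_bot_or_eq_top X with h | h
  · rw [h] at hv
    exact absurd ((Submodule.mem_bot ℂ).1 hv) hv0
  · rw [h]
    exact Submodule.mem_top (R := ℂ)

theorem IsIrred.nontrivial {ρ : Representation ℂ Γ V} (hρ : ρ.IsIrreducible) : Nontrivial V := by
  by_contra h
  rw [not_nontrivial_iff_subsingleton] at h
  obtain ⟨X, Y, hXY⟩ := hρ.exists_pair_ne
  apply hXY
  apply SetLike.ext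
  intro w
  rw [Subsingleton.elim w 0]
  exact ⟨fun _ => Y.toSubmodule.zero_mem, fun _ => X.toSubmodule.zero_mem⟩

theorem IsIrred.exists_ne {ρ : Representation ℂ Γ V} (hρ : ρ.IsIrreducible) : ∃ v : V, v ≠ 0 :=
  have := IsIrred.nontrivial hρ
  _root_.exists_ne 0

theorem IsIrred.injective {ρ : Representation ℂ Γ V} {σ : Representation ℂ Γ V'}
    (hρ : ρ.IsIrreducible) (f : IntertwiningMap ρ σ) (hf : f ≠ 0) : Function.Injective f :=
  (IsIrreducible.injective_or_eq_zero f).resolve_right hf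

theorem IsIrred.surjective {ρ : Representation ℂ Γ V} {σ : Representation ℂ Γ V'}
    (hσ : σ.IsIrreducible) (f : IntertwiningMap ρ σ) (hf : f ≠ 0) : Function.Surjective f :=
  (IsIrreducible.surjective_or_eq_zero f).resolve_right hf

theorem IsIrred.nonempty_equiv {ρ : Representation ℂ Γ V} {σ : Representation ℂ Γ V'}
    (hρ : ρ.IsIrreducible) (hσ : σ.IsIrreducible) (f : IntertwiningMap ρ σ) (hf : f ≠ 0) :
    Nonempty (Representation.Equiv ρ σ) :=
  ⟨f.ofBijective ⟨IsIrred.injective hρ f hf, IsIrred.surjective hσ f hf⟩⟩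

theorem IsIrred.congr {ρ : Representation ℂ Γ V} {σ : Representation ℂ Γ V'}
    (e : Representation.Equiv ρ σ) (hρ : ρ.IsIrreducible) : σ.IsIrreducible := by
  have : Nontrivial V' := by
    have := IsIrred.nontrivial hρ
    exact e.toLinearEquiv.symm.toEquiv.nontrivial
  refine isIrreducible_of_forall fun X v hv hv0 w => ?_
  let Y : Subrepresentation ρ := ⟨X.toSubmodule.comap e.toLinearEquiv.toLinearMap, fun g v hv => by
    change e (ρ g v) ∈ X
    rw [← e.coe_toIntertwiningMap, e.toIntertwiningMap.isIntertwining]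
    exact X.apply_mem_toSubmodule g hv⟩
  have h := IsIrred.mem hρ Y (v := e.symm v) (by change e (e.symm v) ∈ X; simpa using hv)
    (by intro h; apply hv0; have := congrArg e h; simpa using this) (e.symm w)
  change e (e.symm w) ∈ X at h
  simpa using h

theorem exists_equivariant_projection [Finite Γ] {ρ : Representation ℂ Γ V}
    (X : Subrepresentation ρ) :
    ∃ p : IntertwiningMap ρ ρ, (∀ v, p v ∈ X) ∧ ∀ v ∈ X, p v = v := by
  obtain ⟨Y, hY⟩ := exists_isCompl X
  have hc : IsCompl X.toSubmodule Y.toSubmodule := by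
    rw [isCompl_iff, disjoint_iff, codisjoint_iff] at hY ⊢
    exact ⟨congrArg Subrepresentation.toSubmodule hY.1,
      congrArg Subrepresentation.toSubmodule hY.2⟩
  refine ⟨⟨X.toSubmodule.subtype ∘ₗ X.toSubmodule.projectionOnto Y.toSubmodule hc, ?_⟩,
    fun v => ?_, fun v hv => ?_⟩
  · intro g
    ext v
    obtain ⟨x, hx, y, hy, rfl⟩ : ∃ x ∈ X.toSubmodule, ∃ y ∈ Y.toSubmodule, x + y = v := by
      rw [← Submodule.mem_sup, hc.sup_eq_top]; trivial
    have e1 : ∀ z (hz : z ∈ X.toSubmodule), X.toSubmodule.projectionOnto Y.toSubmodule hc z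
        = ⟨z, hz⟩ := fun z hz => Submodule.projectionOnto_apply_left hc ⟨z, hz⟩
    have e2 : ∀ z (hz : z ∈ Y.toSubmodule),
        X.toSubmodule.projectionOnto Y.toSubmodule hc z = 0 :=
      fun z hz => (Submodule.projectionOnto_apply_eq_zero_iff hc).2 hz
    simp [e1 _ hx, e2 _ hy, e1 _ (X.apply_mem_toSubmodule g hx),
      e2 _ (Y.apply_mem_toSubmodule g hy)]
  · exact (X.toSubmodule.projectionOnto Y.toSubmodule hc v).2
  · exact congrArg Subtype.val (Submodule.projectionOnto_apply_left hc ⟨v, hv⟩)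

/-- Converse of Schur's lemma: the equivariant projection onto a subrepresentation is a scalar, and
a nonzero vector which it fixes makes that scalar `1`. -/
theorem isIrreducible_of_forall_scalar [Finite Γ] [Nontrivial V] {ρ : Representation ℂ Γ V}
    (h : ∀ f : IntertwiningMap ρ ρ, ∃ c : ℂ, ∀ v, f v = c • v) : ρ.IsIrreducible := by
  refine isIrreducible_of_forall fun X v hv hv0 w => ?_
  obtain ⟨p, hp1, hp2⟩ := exists_equivariant_projection X
  obtain ⟨c, hc⟩ := h p
  have h1 : c = 1 := by
    have h2 := hp2 v hv
    rw [hc] at h2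
    exact smul_left_injective ℂ hv0 (h2.trans (one_smul ℂ v).symm)
  have h3 := hp1 w
  rwa [hc, h1, one_smul] at h3

/-- The subrepresentation generated by a vector. -/
def cyclicSub (ρ : Representation ℂ Γ V) (v : V) : Subrepresentation ρ where
  toSubmodule := Submodule.span ℂ (Set.range fun g => ρ g v)
  apply_mem_toSubmodule g w hw := by
    induction hw using Submodule.span_induction with
    | mem w hw =>
      obtain ⟨h, rfl⟩ := hw
      exact Submodule.subset_span ⟨g * h, by simp⟩
    | zero => simp
    | add x y _ _ hx hy => rw [map_add]; exact Submodule.add_mem _ hx hy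
    | smul c x _ hx => rw [map_smul]; exact Submodule.smul_mem _ c hx

theorem mem_cyclicSub (ρ : Representation ℂ Γ V) (v : V) : v ∈ cyclicSub ρ v :=
  Submodule.subset_span ⟨1, by simp⟩

theorem IsIrred.finiteDimensional [Finite Γ] {ρ : Representation ℂ Γ V}
    (hρ : ρ.IsIrreducible) : FiniteDimensional ℂ V := by
  obtain ⟨v, hv⟩ := IsIrred.exists_ne hρ
  have h : (⊤ : Submodule ℂ V) = Submodule.span ℂ (Set.range fun g => ρ g v) := by
    symm
    rw [eq_top_iff]
    intro w _
    exact IsIrred.mem hρ (cyclicSub ρ v) (mem_cyclicSub ρ v) hv w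
  refine ⟨?_⟩
  rw [h]
  exact Submodule.fg_span (Set.finite_range _)

theorem IsIrred.exists_scalar [Finite Γ] {ρ : Representation ℂ Γ V} (hρ : ρ.IsIrreducible)
    (f : IntertwiningMap ρ ρ) : ∃ c : ℂ, ∀ v, f v = c • v := by
  have := IsIrred.finiteDimensional hρ
  obtain ⟨c, hc⟩ :=
    (IsIrreducible.algebraMap_intertwiningMap_bijective_of_isAlgClosed (ρ := ρ) (k := ℂ)).2 f
  refine ⟨c, fun v => ?_⟩
  rw [← hc]
  simp

theorem IsIrred.finrank_eq_one {ρ : Representation ℂ Γ V} (hρ : ρ.IsIrreducible)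
    (h : ∀ g, ∃ c : ℂ, ∀ v, ρ g v = c • v) : Module.finrank ℂ V = 1 := by
  obtain ⟨v, hv⟩ := IsIrred.exists_ne hρ
  refine _root_.finrank_eq_one v hv fun w => ?_
  let X : Subrepresentation ρ := ⟨Submodule.span ℂ {v}, fun g x hx => by
    obtain ⟨c, hc⟩ := h g
    rw [hc]
    exact Submodule.smul_mem _ _ hx⟩
  exact Submodule.mem_span_singleton.1
    (IsIrred.mem hρ X (Submodule.mem_span_singleton_self v) hv w)

theorem isIrreducible_of_finrank_eq_one {ρ : Representation ℂ Γ V}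
    (h : Module.finrank ℂ V = 1) : ρ.IsIrreducible := by
  have : Nontrivial V := Module.nontrivial_of_finrank_pos (R := ℂ) (by omega)
  refine isIrreducible_of_forall fun X v hv hv0 w => ?_
  obtain ⟨c, rfl⟩ := (finrank_eq_one_iff_of_nonzero' v hv0).1 h w
  exact X.toSubmodule.smul_mem c hv

/-- A nonzero subrepresentation of least dimension is irreducible. -/
theorem exists_irreducible_sub [FiniteDimensional ℂ V] [Nontrivial V]
    (ρ : Representation ℂ Γ V) : ∃ X : Subrepresentation ρ, (subRep X).IsIrreducible := by
  have hex : ∃ n, ∃ X : Subrepresentation ρ, (∃ v ∈ X, v ≠ 0) ∧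
      Module.finrank ℂ X.toSubmodule = n := by
    obtain ⟨v, hv⟩ := exists_ne (0 : V)
    exact ⟨_, ⊤, ⟨v, Submodule.mem_top (R := ℂ), hv⟩, rfl⟩
  classical
  obtain ⟨X, ⟨v, hvX, hv0⟩, hX⟩ := Nat.find_spec hex
  refine ⟨X, ?_⟩
  have : Nontrivial X.toSubmodule := ⟨⟨⟨v, hvX⟩, 0, fun h => hv0 (congrArg Subtype.val h)⟩⟩
  refine isIrreducible_of_forall fun Y y hy hy0 w => ?_
  let Z : Subrepresentation ρ := ⟨Y.toSubmodule.map X.toSubmodule.subtype, fun g x hx => by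
    obtain ⟨x', hx', rfl⟩ := hx
    exact ⟨subRep X g x', Y.apply_mem_toSubmodule g hx', rfl⟩⟩
  have hZX : Z.toSubmodule ≤ X.toSubmodule := by
    rintro _ ⟨x', _, rfl⟩
    exact x'.2
  have hle : Nat.find hex ≤ Module.finrank ℂ Z.toSubmodule :=
    Nat.find_min' hex ⟨Z, ⟨y.1, ⟨y, hy, rfl⟩, fun h => hy0 (Subtype.ext h)⟩, rfl⟩
  rw [← hX] at hle
  have heq : Z.toSubmodule = X.toSubmodule := Submodule.eq_of_le_of_finrank_le hZX hle
  have hw : (w : V) ∈ Z.toSubmodule := by rw [heq]; exact w.2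
  obtain ⟨w', hw', h⟩ := hw
  have : w' = w := Subtype.ext h
  exact this ▸ hw'

instance invertibleCard [Finite Γ] : Invertible (Nat.card Γ : ℂ) :=
  invertibleOfNonzero (Nat.cast_ne_zero.2 Nat.card_pos.ne')

theorem sum_char_mul_char [Fintype Γ] [FiniteDimensional ℂ V] [FiniteDimensional ℂ V']
    (ρ : Representation ℂ Γ V) (σ : Representation ℂ Γ V') :
    ∑ g : Γ, σ.character g * ρ.character g⁻¹
      = Fintype.card Γ * Module.finrank ℂ (IntertwiningMap ρ σ) := by
  rw [← card_inv_mul_sum_char_mul_char_eq_finrank, ← mul_assoc, Nat.card_eq_fintype_card,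
    mul_inv_cancel₀ (Nat.cast_ne_zero.2 Fintype.card_ne_zero), one_mul]

theorem sum_char [Fintype Γ] [FiniteDimensional ℂ V] (ρ : Representation ℂ Γ V) :
    ∑ g : Γ, ρ.character g = Fintype.card Γ * Module.finrank ℂ (invariants ρ) := by
  rw [← card_inv_mul_sum_char_eq_finrank, ← mul_assoc, Nat.card_eq_fintype_card,
    mul_inv_cancel₀ (Nat.cast_ne_zero.2 Fintype.card_ne_zero), one_mul]

open scoped ComplexOrder in
-- Averaging makes the representation unitary: for the invariant hermitian matrix `H = ∑ M(h)* M(h)`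
-- one has `M(g⁻¹) = H⁻¹ M(g)* H`, and traces are compared.
theorem char_inv_eq_conj [Finite Γ] [FiniteDimensional ℂ V] (ρ : Representation ℂ Γ V) (g : Γ) :
    ρ.character g⁻¹ = star (ρ.character g) := by
  classical
  have := Fintype.ofFinite Γ
  let B := Module.finBasis ℂ V
  let M : Γ → Matrix _ _ ℂ := fun g => LinearMap.toMatrix B B (ρ g)
  have hM : ∀ a b, M (a * b) = M a * M b := fun a b => by
    simp only [M, map_mul, LinearMap.toMatrix_mul]
  have hM1 : M 1 = 1 := by simp [M]
  have htr : ∀ g, ρ.character g = (M g).trace := fun g =>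
    LinearMap.trace_eq_matrix_trace ℂ B (ρ g)
  let H := ∑ h : Γ, (M h).conjTranspose * M h
  have hH : ∀ g, (M g).conjTranspose * H * M g = H := fun g => by
    simp only [H, Finset.mul_sum, Finset.sum_mul]
    refine Fintype.sum_equiv (Equiv.mulRight g) _ _ fun h => ?_
    simp only [Equiv.coe_mulRight, hM, Matrix.conjTranspose_mul, Matrix.mul_assoc]
  -- The summand of the identity element is the identity matrix, so `H` is definite and hence
  -- invertible.
  have hpos : H.PosDef := by
    have h1 : H = (M 1).conjTranspose * M 1 +
        ∑ h ∈ Finset.univ.erase (1 : Γ), (M h).conjTranspose * M h :=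
      (Finset.add_sum_erase _ _ (Finset.mem_univ 1)).symm
    rw [h1, hM1]
    simp only [Matrix.conjTranspose_one, Matrix.mul_one]
    exact Matrix.PosDef.one.add_posSemidef
      (Matrix.posSemidef_sum _ fun h _ => Matrix.posSemidef_conjTranspose_mul_self _)
  have hu : IsUnit H.det := (Matrix.isUnit_iff_isUnit_det _).1 hpos.isUnit
  have h1 : M g⁻¹ = H⁻¹ * (M g).conjTranspose * H := by
    have h2 : (M g).conjTranspose * H = H * M g⁻¹ := by
      conv_rhs => rw [← hH g]
      rw [Matrix.mul_assoc, ← hM, mul_inv_cancel, hM1, Matrix.mul_one]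
    rw [Matrix.mul_assoc, h2, ← Matrix.mul_assoc, Matrix.nonsing_inv_mul _ hu, Matrix.one_mul]
  rw [htr, htr, h1, Matrix.trace_mul_comm, ← Matrix.mul_assoc, Matrix.mul_nonsing_inv _ hu,
    Matrix.one_mul, Matrix.trace_conjTranspose]

end Finite

/-! ### Dual pairs of commutants -/

section Commutant

variable {Γ : Type*} [Group Γ] {V : Type*} [AddCommGroup V] [Module ℂ V]

theorem mem_centralizer_groupAlg {ρ : Representation ℂ Γ V} {T : Module.End ℂ V} :
    T ∈ Subalgebra.centralizer ℂ (groupAlg ρ : Set (Module.End ℂ V)) ↔ ∀ g, ρ g * T = T * ρ g := by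
  rw [Subalgebra.mem_centralizer_iff]
  refine ⟨fun h g => h _ (Algebra.subset_adjoin ⟨g, rfl⟩), fun h x hx => ?_⟩
  have h1 : groupAlg ρ ≤ Subalgebra.centralizer ℂ {T} := by
    refine Algebra.adjoin_le ?_
    rintro _ ⟨g, rfl⟩
    rw [SetLike.mem_coe, Subalgebra.mem_centralizer_iff]
    rintro _ rfl
    exact (h g).symm
  exact ((Subalgebra.mem_centralizer_iff ℂ).1 (h1 hx) T rfl).symm

/-- Double commutant theorem by the density argument. In `Vⁿ` the orbit of the tuple `(B i)` under
the group algebra is a subrepresentation; an element `T` of the double commutant, acting diagonally,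
commutes with the projection onto it. So `T` sends `(B i)` to some `(a (B i))`, and `a = T` because
the `B i` form a basis. -/
theorem centralizer_centralizer_groupAlg [Finite Γ] [FiniteDimensional ℂ V]
    (ρ : Representation ℂ Γ V) :
    Subalgebra.centralizer ℂ
      (Subalgebra.centralizer ℂ (groupAlg ρ : Set (Module.End ℂ V)) : Set (Module.End ℂ V))
      = groupAlg ρ := by
  refine le_antisymm (fun T hT => ?_) (Subalgebra.le_centralizer_centralizer ℂ)
  let B := Module.finBasis ℂ V
  let n := Module.finrank ℂ V
  let ρn : Representation ℂ Γ (Fin n → V) :=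
    { toFun := fun g => LinearMap.pi fun i => ρ g ∘ₗ LinearMap.proj i
      map_one' := by ext; simp
      map_mul' := fun a b => by ext; simp }
  let X : Subrepresentation ρn :=
    { toSubmodule := (Subalgebra.toSubmodule (groupAlg ρ)).map
        (LinearMap.pi fun i => LinearMap.applyₗ (B i))
      apply_mem_toSubmodule := by
        rintro g _ ⟨a, ha, rfl⟩
        refine ⟨ρ g * a, (groupAlg ρ).mul_mem (Algebra.subset_adjoin ⟨g, rfl⟩) ha, ?_⟩
        ext i
        rfl }
  obtain ⟨p, hp1, hp2⟩ := exists_equivariant_projection X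
  let Tn : (Fin n → V) →ₗ[ℂ] (Fin n → V) := LinearMap.pi fun i => T ∘ₗ LinearMap.proj i
  have hcomm : ∀ x, Tn (p x) = p (Tn x) := by
    intro x
    have hx : x = ∑ j, LinearMap.single ℂ (fun _ => V) j (x j) := by
      simp [Finset.univ_sum_single]
    -- Each block of the projection, from the `j`-th to the `i`-th copy of `V`, commutes with the
    -- group, so `T` commutes with it.
    have key : ∀ (i j : Fin n) (y : V), T (p (LinearMap.single ℂ (fun _ => V) j y) i)
        = p (LinearMap.single ℂ (fun _ => V) j (T y)) i := by
      intro i j y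
      let q : Module.End ℂ V := LinearMap.proj i ∘ₗ p.toLinearMap ∘ₗ
        LinearMap.single ℂ (fun _ => V) j
      have hq : q ∈ Subalgebra.centralizer ℂ (groupAlg ρ : Set (Module.End ℂ V)) := by
        rw [mem_centralizer_groupAlg]
        intro g
        ext y
        change ρ g (p (Pi.single j y) i) = p (Pi.single j (ρ g y)) i
        have h1 : Pi.single j (ρ g y) = ρn g (Pi.single j y) := by
          ext k
          change _ = ρ g ((Pi.single j y : Fin n → V) k)
          by_cases hk : k = j
          · subst hk; simp
          · simp [hk]
        rw [h1, p.isIntertwining]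
        rfl
      have h2 := (Subalgebra.mem_centralizer_iff ℂ).1 hT q hq
      exact (LinearMap.congr_fun h2 y).symm
    have hTx : Tn x = ∑ j, LinearMap.single ℂ (fun _ => V) j (T (x j)) := by
      ext i
      simp [Tn]
    rw [hTx]
    conv_lhs => rw [hx]
    rw [map_sum, map_sum, map_sum]
    ext i
    rw [Finset.sum_apply, Finset.sum_apply]
    exact Finset.sum_congr rfl fun j _ => key i j (x j)
  have hB : (fun i => B i) ∈ X :=
    ⟨1, (groupAlg ρ).one_mem, by ext i; rfl⟩
  have hTB : Tn (fun i => B i) ∈ X := by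
    rw [← hp2 _ hB, hcomm]
    exact hp1 _
  obtain ⟨a, ha, h⟩ := hTB
  have : a = T := B.ext fun i => congrFun h i
  exact this ▸ ha

end Commutant

/-! ### Abstract duality in a representation of a product of two groups -/

section Howe

variable {A B : Type*} [Group A] [Group B] {E E' : Type*} [AddCommGroup E] [Module ℂ E]
  [AddCommGroup E'] [Module ℂ E']
  {T T' : Type*} [AddCommGroup T] [Module ℂ T] [AddCommGroup T'] [Module ℂ T']

/-- Every endomorphism of `R` commuting with `B` is a combination of operators from `A`. -/
def CommutantSpanned (R : Representation ℂ (A × B) E) : Prop :=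
  ∀ f : IntertwiningMap (resSnd R) (resSnd R),
    f.toLinearMap ∈ Submodule.span ℂ (Set.range (resFst R))

/-- The same combination of group elements is formed in `ρ` and in `σ`; intertwining maps carry one
to the other. One `c` serves all `f` at once, which is what the duality arguments exploit. -/
theorem exists_intertwining_of_mem_span {ρ : Representation ℂ A E} {σ : Representation ℂ A T}
    {p : Module.End ℂ E} (hp : p ∈ Submodule.span ℂ (Set.range ρ)) :
    ∃ c : Module.End ℂ T, c ∈ Submodule.span ℂ (Set.range σ) ∧
      ∀ (f : IntertwiningMap σ ρ) v, p (f v) = f (c v) := by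
  induction hp using Submodule.span_induction with
  | mem p hp =>
    obtain ⟨a, rfl⟩ := hp
    exact ⟨σ a, Submodule.subset_span ⟨a, rfl⟩, fun f v => (map_rep f a v).symm⟩
  | zero => exact ⟨0, Submodule.zero_mem _, fun f v => by simp⟩
  | add x y _ _ hx hy =>
    obtain ⟨c, hc, h⟩ := hx
    obtain ⟨d, hd, h'⟩ := hy
    exact ⟨c + d, Submodule.add_mem _ hc hd, fun f v => by simp [h, h']⟩
  | smul t x _ hx =>
    obtain ⟨c, hc, h⟩ := hx
    exact ⟨t • c, Submodule.smul_mem _ _ hc, fun f v => by simp [h]⟩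

/-- Evaluation of the multiplicity space at a vector of `τ`. -/
def thetaEval (R : Representation ℂ (A × B) E) (τ : Representation ℂ A T) (v : T) :
    IntertwiningMap (Theta R τ) (resSnd R) :=
  ⟨{ toFun := fun f => f v
     map_add' := fun _ _ => rfl
     map_smul' := fun _ _ => rfl }, fun _ => rfl⟩

theorem thetaEval_injective (R : Representation ℂ (A × B) E) {τ : Representation ℂ A T}
    (hτ : τ.IsIrreducible) {v : T} (hv : v ≠ 0) : Function.Injective (thetaEval R τ v) := by
  rw [← IntertwiningMap.coe_toLinearMap, ← LinearMap.ker_eq_bot, LinearMap.ker_eq_bot']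
  intro f hf
  by_contra hne
  exact hv (IsIrred.injective hτ f hne (hf.trans (map_zero f).symm))

/-- The image of a subrepresentation under an intertwining map. -/
def mapSub {Γ : Type*} [Group Γ] {ρ : Representation ℂ Γ E} {σ : Representation ℂ Γ E'}
    (f : IntertwiningMap ρ σ) (X : Subrepresentation ρ) : Subrepresentation σ where
  toSubmodule := X.toSubmodule.map f.toLinearMap
  apply_mem_toSubmodule g v hv := by
    obtain ⟨x, hx, rfl⟩ := hv
    exact ⟨ρ g x, X.apply_mem_toSubmodule g hx, map_rep f g x⟩

/-- Let `X` contain `f ≠ 0` and let `p` project `E` onto the vectors `x v`, `x ∈ X`. As `p` comes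
from `A`, it acts on every `f' v` as `f' (c v)` with one and the same `c`. Since `p` fixes `f v`,
injectivity of `f` gives `c v = v`; so `p` fixes every `f' v`, and all `f'` lie in `X`. -/
theorem theta_isIrreducible [Finite B] {R : Representation ℂ (A × B) E} (hR : CommutantSpanned R)
    {τ : Representation ℂ A T} (hτ : τ.IsIrreducible) [Nontrivial (ThetaSpace R τ)] :
    (Theta R τ).IsIrreducible := by
  obtain ⟨v, hv⟩ := IsIrred.exists_ne hτ
  refine isIrreducible_of_forall fun X f hf hf0 f' => ?_
  obtain ⟨p, hp1, hp2⟩ := exists_equivariant_projection (mapSub (thetaEval R τ v) X)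
  obtain ⟨c, -, hc⟩ := exists_intertwining_of_mem_span (σ := τ) (hR p)
  have h1 : c v = v := by
    refine IsIrred.injective hτ f hf0 ?_
    rw [← hc f v]
    exact hp2 _ ⟨f, hf, rfl⟩
  obtain ⟨x, hx, hxv⟩ := hp1 (f' v)
  have h2 : thetaEval R τ v x = thetaEval R τ v f' := by
    refine hxv.trans ((hc f' v).trans ?_)
    rw [h1]
    rfl
  exact thetaEval_injective R hτ hv h2 ▸ hx

/-- An equivalence `φ` of multiplicity spaces yields an operator `q` commuting with `B` and sending
`f v` to `φ f v'`. As `q` comes from `A`, it keeps `f v` inside the image of `f`; so the copies of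
`τ` and `τ'` given by `f` and `φ f` meet, and irreducible subrepresentations that meet are
equivalent. -/
theorem nonempty_equiv_of_theta [Finite B] {R : Representation ℂ (A × B) E}
    (hR : CommutantSpanned R) {τ : Representation ℂ A T} {τ' : Representation ℂ A T'}
    (hτ : τ.IsIrreducible) (hτ' : τ'.IsIrreducible) [Nontrivial (ThetaSpace R τ)]
    (φ : Representation.Equiv (Theta R τ) (Theta R τ')) :
    Nonempty (Representation.Equiv τ τ') := by
  obtain ⟨v, hv⟩ := IsIrred.exists_ne hτ
  obtain ⟨v', hv'⟩ := IsIrred.exists_ne hτ'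
  obtain ⟨f, hf⟩ := exists_ne (0 : ThetaSpace R τ)
  obtain ⟨p, hp1, hp2⟩ := exists_equivariant_projection (mapSub (thetaEval R τ v) ⊤)
  have hinj := thetaEval_injective R hτ hv
  let e := LinearEquiv.ofInjective (thetaEval R τ v).toLinearMap hinj
  have hpr : ∀ x, p x ∈ LinearMap.range (thetaEval R τ v).toLinearMap := fun x => by
    obtain ⟨y, -, hy⟩ := hp1 x
    exact ⟨y, hy⟩
  let q : IntertwiningMap (resSnd R) (resSnd R) :=
    ⟨(thetaEval R τ' v').toLinearMap ∘ₗ φ.toLinearMap ∘ₗ e.symm.toLinearMap ∘ₗ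
      LinearMap.codRestrict _ p.toLinearMap hpr, fun b => by
      ext x
      have h1 : e.symm (LinearMap.codRestrict _ p.toLinearMap hpr (resSnd R b x))
          = Theta R τ b (e.symm (LinearMap.codRestrict _ p.toLinearMap hpr x)) := by
        rw [LinearEquiv.symm_apply_eq]
        apply Subtype.ext
        have h2 : ((e (Theta R τ b (e.symm (LinearMap.codRestrict _ p.toLinearMap hpr x)))) : E)
            = resSnd R b (e (e.symm (LinearMap.codRestrict _ p.toLinearMap hpr x)) : E) := rfl
        rw [h2, LinearEquiv.apply_symm_apply]
        exact map_rep p b x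
      change thetaEval R τ' v' (φ (e.symm _)) = resSnd R b (thetaEval R τ' v' (φ (e.symm _)))
      rw [h1, ← IntertwiningMap.isIntertwining]
      exact congrArg _ (Equiv.map_rep φ b _)⟩
  obtain ⟨c, -, hc⟩ := exists_intertwining_of_mem_span (σ := τ) (hR q)
  have hq : q (f v) = φ f v' := by
    have h1 : e.symm (LinearMap.codRestrict _ p.toLinearMap hpr (f v)) = f := by
      rw [LinearEquiv.symm_apply_eq]
      apply Subtype.ext
      exact hp2 (f v) ⟨f, Submodule.mem_top, rfl⟩
    change (φ (e.symm (LinearMap.codRestrict _ p.toLinearMap hpr (f v)))) v' = _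
    rw [h1]
  have hφ : φ f ≠ 0 := fun h => hf (φ.toLinearEquiv.injective (h.trans (map_zero φ).symm))
  have hfi := IsIrred.injective hτ f hf
  have hfi' := IsIrred.injective hτ' (φ f) hφ
  have hmeet : f (c v) = φ f v' := (hc f v).symm.trans hq
  obtain ⟨r, hr1, hr2⟩ : ∃ r : IntertwiningMap τ τ', ∃ x, r x ≠ 0 := by
    -- The preimage under `f` of the image of `φ f` contains `c v ≠ 0`, hence is all of `τ`;
    -- inverting `φ f` on its image then gives a map from `τ` to `τ'`.
    let Y : Subrepresentation τ := ⟨(LinearMap.range (φ f).toLinearMap).comap f.toLinearMap, by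
      rintro a x ⟨y, hy⟩
      refine ⟨τ' a y, ?_⟩
      change φ f (τ' a y) = f (τ a x)
      rw [(φ f).isIntertwining, f.isIntertwining]
      exact congrArg _ hy⟩
    have hcv : c v ≠ 0 := by
      intro h
      rw [h, map_zero] at hmeet
      exact hv' (hfi' (hmeet.symm.trans (map_zero _).symm))
    have hall : ∀ x, f x ∈ LinearMap.range (φ f).toLinearMap := fun x =>
      IsIrred.mem hτ Y (v := c v) ⟨v', hmeet.symm⟩ hcv x
    let e' := LinearEquiv.ofInjective (φ f).toLinearMap hfi'
    refine ⟨⟨e'.symm.toLinearMap ∘ₗ LinearMap.codRestrict _ f.toLinearMap hall, fun a => ?_⟩,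
      c v, ?_⟩
    · ext x
      change e'.symm _ = τ' a (e'.symm _)
      rw [LinearEquiv.symm_apply_eq]
      apply Subtype.ext
      have h2 : ∀ y, ((e' (τ' a y)) : E) = resFst R a (e' y : E) := fun y =>
        map_rep (φ f) a y
      rw [h2, LinearEquiv.apply_symm_apply]
      exact map_rep f a x
    · change e'.symm (LinearMap.codRestrict _ f.toLinearMap hall (c v)) ≠ 0
      rw [Ne, LinearEquiv.map_eq_zero_iff]
      intro h
      exact hcv (hfi ((congrArg Subtype.val h).trans (map_zero f).symm))
  exact IsIrred.nonempty_equiv hτ hτ' r fun h => hr2 (by rw [h]; rfl)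

/-- An endomorphism of `Y` commuting with `B` extends to `E` by precomposing with an equivariant
projection; the extension is a combination of operators from `A`, and restricting back to `Y` keeps
the coefficients. -/
theorem centralizer_groupAlg_snd [Finite B] {R : Representation ℂ (A × B) E}
    (hR : CommutantSpanned R) (Y : Subrepresentation R) :
    Subalgebra.centralizer ℂ (groupAlg (resSnd Y.toRepresentation) : Set _)
      = groupAlg (resFst Y.toRepresentation) := by
  refine le_antisymm (fun t ht => ?_) (Algebra.adjoin_le ?_)
  · rw [mem_centralizer_groupAlg] at ht
    let Y' : Subrepresentation (resSnd R) :=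
      ⟨Y.toSubmodule, fun b _ hv => Y.apply_mem_toSubmodule (1, b) hv⟩
    obtain ⟨p, hp1, hp2⟩ := exists_equivariant_projection Y'
    let q : IntertwiningMap (resSnd R) (resSnd R) :=
      ⟨Y.toSubmodule.subtype ∘ₗ t ∘ₗ LinearMap.codRestrict _ p.toLinearMap hp1, fun b => by
        ext x
        have h1 : LinearMap.codRestrict Y.toSubmodule p.toLinearMap hp1 (resSnd R b x)
            = resSnd Y.toRepresentation b
              (LinearMap.codRestrict Y.toSubmodule p.toLinearMap hp1 x) :=
          Subtype.ext (map_rep p b x)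
        change ((t _ : Y.toSubmodule) : E) = resSnd R b (t _ : Y.toSubmodule)
        rw [h1]
        exact congrArg Subtype.val (LinearMap.congr_fun (ht b) _).symm⟩
    let ι : IntertwiningMap (resFst Y.toRepresentation) (resFst R) :=
      ⟨Y.toSubmodule.subtype, fun _ => rfl⟩
    obtain ⟨c, hc1, hc2⟩ :=
      exists_intertwining_of_mem_span (σ := resFst Y.toRepresentation) (hR q)
    have h : c = t := by
      ext y
      refine (hc2 ι y).symm.trans ?_
      change ((t (LinearMap.codRestrict Y.toSubmodule p.toLinearMap hp1 y.1)) : E) = t y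
      congr 2
      exact Subtype.ext (hp2 y.1 y.2)
    rw [← h]
    exact Algebra.span_le_adjoin ℂ _ hc1
  · rintro _ ⟨a, rfl⟩
    rw [SetLike.mem_coe, mem_centralizer_groupAlg]
    exact fun b => res_commute Y.toRepresentation a b

theorem centralizer_groupAlg_fst [Finite B] [FiniteDimensional ℂ E]
    {R : Representation ℂ (A × B) E} (hR : CommutantSpanned R) (Y : Subrepresentation R) :
    Subalgebra.centralizer ℂ (groupAlg (resFst Y.toRepresentation) : Set _)
      = groupAlg (resSnd Y.toRepresentation) := by
  rw [← centralizer_groupAlg_snd hR, centralizer_centralizer_groupAlg]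

/-- An equivalence of representations of `A × B` induces an equivalence of multiplicity spaces. -/
def thetaCongr {T : Type*} [AddCommMonoid T] [Module ℂ T] {R : Representation ℂ (A × B) E} {R' : Representation ℂ (A × B) E'}
    (e : Representation.Equiv R R') (τ : Representation ℂ A T) :
    Representation.Equiv (Theta R τ) (Theta R' τ) :=
  Representation.Equiv.mk
    { toFun := fun f => ⟨e.toLinearMap ∘ₗ f.toLinearMap, fun a => by
        ext x
        change e (f (τ a x)) = R' (a, 1) (e (f x))
        rw [f.isIntertwining]
        exact Equiv.map_rep e (a, 1) (f x)⟩
      invFun := fun f => ⟨e.symm.toLinearMap ∘ₗ f.toLinearMap, fun a => by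
        ext x
        change e.symm (f (τ a x)) = R (a, 1) (e.symm (f x))
        rw [f.isIntertwining]
        exact Equiv.map_rep e.symm (a, 1) (f x)⟩
      map_add' := fun f f' => by
        ext x
        exact map_add e (f x) (f' x)
      map_smul' := fun c f => by
        ext x
        exact map_smul e c (f x)
      left_inv := fun f => by
        ext x
        exact e.symm_apply_apply (f x)
      right_inv := fun f => by
        ext x
        exact e.apply_symm_apply (f x) }
    (fun b => by
      ext f x
      exact Equiv.map_rep e (1, b) (f x))

theorem CommutantSpanned.congr {R : Representation ℂ (A × B) E} {R' : Representation ℂ (A × B) E'}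
    (e : Representation.Equiv R R') (hR : CommutantSpanned R) : CommutantSpanned R' := by
  intro f
  have hg := hR ⟨e.symm.toLinearMap ∘ₗ f.toLinearMap ∘ₗ e.toLinearMap, fun b => by
    ext x
    change e.symm (f (e (R (1, b) x))) = R (1, b) (e.symm (f (e x)))
    have h1 : e (R (1, b) x) = R' (1, b) (e x) := Equiv.map_rep e (1, b) x
    have h2 : f (R' (1, b) (e x)) = R' (1, b) (f (e x)) := map_rep f b (e x)
    rw [h1, h2]
    exact Equiv.map_rep e.symm (1, b) _⟩
  have h3 := Submodule.mem_map_of_mem (f := e.toLinearEquiv.conj.toLinearMap) hg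
  rw [Submodule.map_span] at h3
  have h4 : e.toLinearEquiv.conj (e.symm.toLinearMap ∘ₗ f.toLinearMap ∘ₗ e.toLinearMap)
      = f.toLinearMap := by
    ext x
    change e (e.symm (f (e (e.symm x)))) = f x
    simp
  rw [← h4]
  refine Submodule.span_mono ?_ h3
  rintro _ ⟨_, ⟨a, rfl⟩, rfl⟩
  refine ⟨a, ?_⟩
  exact (e.conj_apply_self (a, 1)).symm

end Howe

/-! ### The Schrödinger model -/

section Operators

variable {U : Type*} [Fintype U]

theorem trace_fun [DecidableEq U] (T : Module.End ℂ (U → ℂ)) :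
    LinearMap.trace ℂ _ T = ∑ x, T (Pi.single x 1) x := by
  rw [LinearMap.trace_eq_matrix_trace ℂ (Pi.basisFun ℂ U), Matrix.trace]
  refine Finset.sum_congr rfl fun x _ => ?_
  simp

theorem trace_funLeft [DecidableEq U] (φ : U → U) :
    LinearMap.trace ℂ _ (LinearMap.funLeft ℂ ℂ φ) = (Finset.univ.filter fun x => φ x = x).card := by
  rw [trace_fun, Finset.card_filter, Nat.cast_sum]
  refine Finset.sum_congr rfl fun x _ => ?_
  simp [LinearMap.funLeft_apply, Pi.single_apply]

/-- The operator of multiplication by a function. -/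
def mulOp (a : U → ℂ) : Module.End ℂ (U → ℂ) := LinearMap.mulLeft ℂ a

omit [Fintype U] in
@[simp] theorem mulOp_apply (a f : U → ℂ) (x : U) : mulOp a f x = a x * f x := rfl

theorem trace_mulOp (a : U → ℂ) : LinearMap.trace ℂ _ (mulOp a) = ∑ x, a x := by
  classical
  rw [trace_fun]
  simp

/-- Splitting the space into range and kernel, the operator is the scalar `1 + c` on the first and
the identity on the second. This evaluates determinants of scalars on one parity part and of
involutions. -/
theorem det_one_add_smul_of_idem {E : Type*} [AddCommGroup E] [Module ℂ E]
    [FiniteDimensional ℂ E] {P : Module.End ℂ E} (hP : P * P = P) :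
    (Module.finrank ℂ (LinearMap.range P) : ℂ) = LinearMap.trace ℂ E P ∧
      ∀ c : ℂ, LinearMap.det (1 + c • P) = (1 + c) ^ Module.finrank ℂ (LinearMap.range P) := by
  have h : LinearMap.IsProj (LinearMap.range P) P :=
    ⟨fun x => ⟨x, rfl⟩, by rintro _ ⟨y, rfl⟩; exact LinearMap.congr_fun hP y⟩
  refine ⟨h.trace.symm, fun c => ?_⟩
  have h1 := h.eq_conj_prodMap
  have h2 : (1 + c • P : Module.End ℂ E) =
      ((LinearMap.range P).prodEquivOfIsCompl _ h.isCompl).conj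
        (LinearMap.prodMap ((1 + c) • LinearMap.id) LinearMap.id) := by
    have h3 : (LinearMap.prodMap ((1 + c) • LinearMap.id) LinearMap.id :
        Module.End ℂ (LinearMap.range P × LinearMap.ker P))
        = 1 + c • LinearMap.prodMap LinearMap.id 0 := by
      ext x <;> simp [add_smul]
    rw [h3, map_add, map_smul, ← h1]
    congr 1
    exact (LinearEquiv.conj_id _).symm
  rw [h2, LinearEquiv.conj_apply, LinearMap.comp_assoc, LinearMap.det_conj, LinearMap.det_prodMap, LinearMap.det_smul]
  simp

end Operators

/-! ### Even and odd functions, and the determinant quotient that fixes scalars -/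

section Parity

variable {U : Type*} [AddCommGroup U]

/-- The operator `f ↦ (x ↦ f (-x))`. -/
def flip : Module.End ℂ (U → ℂ) := LinearMap.funLeft ℂ ℂ fun x => -x

@[simp] theorem flip_apply (f : U → ℂ) (x : U) : flip f x = f (-x) := rfl

theorem flip_mul_flip : (flip : Module.End ℂ (U → ℂ)) * flip = 1 := by
  ext f x
  simp

/-- The projection onto even functions. -/
def evenProj : Module.End ℂ (U → ℂ) := (1 / 2 : ℂ) • (1 + flip)

/-- The projection onto odd functions. -/
def oddProj : Module.End ℂ (U → ℂ) := (1 / 2 : ℂ) • (1 - flip)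

theorem evenProj_mul_evenProj : (evenProj : Module.End ℂ (U → ℂ)) * evenProj = evenProj := by
  have h := flip_mul_flip (U := U)
  simp only [evenProj, smul_mul_smul_comm, add_mul, mul_add, one_mul, mul_one, h]
  module

theorem oddProj_mul_oddProj : (oddProj : Module.End ℂ (U → ℂ)) * oddProj = oddProj := by
  have h := flip_mul_flip (U := U)
  simp only [oddProj, smul_mul_smul_comm, sub_mul, mul_sub, one_mul, mul_one, h]
  module

theorem evenProj_mul_oddProj : (evenProj : Module.End ℂ (U → ℂ)) * oddProj = 0 := by
  have h := flip_mul_flip (U := U)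
  simp only [evenProj, oddProj, smul_mul_smul_comm, add_mul, mul_sub, one_mul, mul_one, h]
  module

theorem oddProj_mul_evenProj : (oddProj : Module.End ℂ (U → ℂ)) * evenProj = 0 := by
  have h := flip_mul_flip (U := U)
  simp only [evenProj, oddProj, smul_mul_smul_comm, sub_mul, mul_add, one_mul, mul_one, h]
  module

theorem evenProj_add_oddProj : (evenProj : Module.End ℂ (U → ℂ)) + oddProj = 1 := by
  simp only [evenProj, oddProj]
  module

theorem mul_evenProj_comm {A : Module.End ℂ (U → ℂ)} (h : A * flip = flip * A) :
    A * evenProj = evenProj * A := by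
  simp [evenProj, mul_add, add_mul, h]

theorem mul_oddProj_comm {A : Module.End ℂ (U → ℂ)} (h : A * flip = flip * A) :
    A * oddProj = oddProj * A := by
  simp [oddProj, mul_sub, sub_mul, h]

variable [Fintype U]

/-- The quotient of the determinants of an operator on odd and on even functions. -/
def parityDet (A : Module.End ℂ (U → ℂ)) : ℂ :=
  LinearMap.det (A * oddProj + evenProj) / LinearMap.det (A * evenProj + oddProj)

omit [Fintype U] in
-- The operator `A * oddProj + evenProj` is `A` on odd functions and the identity on even ones; an
-- operator commuting with `flip` preserves the two parts.
theorem odd_part_mul {A B : Module.End ℂ (U → ℂ)} (hB : B * flip = flip * B) :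
    (A * oddProj + evenProj) * (B * oddProj + evenProj) = A * B * oddProj + evenProj := by
  have h1 : oddProj * (B * oddProj) = B * oddProj := by
    rw [← mul_assoc, ← mul_oddProj_comm hB, mul_assoc, oddProj_mul_oddProj]
  have h2 : evenProj * (B * oddProj) = 0 := by
    rw [← mul_assoc, ← mul_evenProj_comm hB, mul_assoc, evenProj_mul_oddProj, mul_zero]
  rw [add_mul, mul_add, mul_add, mul_assoc A, h1, mul_assoc A, oddProj_mul_evenProj, h2,
    evenProj_mul_evenProj, mul_zero, add_zero, zero_add, mul_assoc]

omit [Fintype U] in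
theorem even_part_mul {A B : Module.End ℂ (U → ℂ)} (hB : B * flip = flip * B) :
    (A * evenProj + oddProj) * (B * evenProj + oddProj) = A * B * evenProj + oddProj := by
  have h1 : evenProj * (B * evenProj) = B * evenProj := by
    rw [← mul_assoc, ← mul_evenProj_comm hB, mul_assoc, evenProj_mul_evenProj]
  have h2 : oddProj * (B * evenProj) = 0 := by
    rw [← mul_assoc, ← mul_oddProj_comm hB, mul_assoc, oddProj_mul_evenProj, mul_zero]
  rw [add_mul, mul_add, mul_add, mul_assoc A, h1, mul_assoc A, evenProj_mul_oddProj, h2,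
    oddProj_mul_oddProj, mul_zero, add_zero, zero_add, mul_assoc]

omit [Fintype U] in
theorem parityDet_mul {A B : Module.End ℂ (U → ℂ)} (hB : B * flip = flip * B) :
    parityDet (A * B) = parityDet A * parityDet B := by
  rw [parityDet, ← odd_part_mul hB, ← even_part_mul hB, map_mul, map_mul, mul_div_mul_comm]
  rfl

omit [Fintype U] in
theorem parityDet_one : parityDet (1 : Module.End ℂ (U → ℂ)) = 1 := by
  rw [parityDet, one_mul, one_mul, add_comm, evenProj_add_oddProj]
  simp

theorem card_fixed_neg [DecidableEq U] (h2 : ∀ x : U, -x = x → x = 0) :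
    (Finset.univ.filter fun x : U => -x = x).card = 1 := by
  rw [Finset.card_eq_one]
  refine ⟨0, Finset.ext fun x => ?_⟩
  simp only [Finset.mem_filter, Finset.mem_univ, true_and, Finset.mem_singleton]
  exact ⟨h2 x, by rintro rfl; simp⟩

theorem trace_flip (h2 : ∀ x : U, -x = x → x = 0) :
    LinearMap.trace ℂ (U → ℂ) flip = 1 := by
  classical
  rw [flip, trace_funLeft, card_fixed_neg h2, Nat.cast_one]

theorem finrank_even (h2 : ∀ x : U, -x = x → x = 0) :
    2 * Module.finrank ℂ (LinearMap.range (evenProj : Module.End ℂ (U → ℂ)))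
      = Fintype.card U + 1 := by
  have h := (det_one_add_smul_of_idem (evenProj_mul_evenProj (U := U))).1
  rw [evenProj, map_smul, map_add, trace_flip h2, LinearMap.trace_one] at h
  have h3 : ((2 * Module.finrank ℂ (LinearMap.range (evenProj : Module.End ℂ (U → ℂ))) : ℕ) : ℂ)
      = ((Fintype.card U + 1 : ℕ) : ℂ) := by
    push_cast
    rw [evenProj, h, smul_eq_mul, Module.finrank_fintype_fun_eq_card]
    ring
  exact_mod_cast h3

theorem finrank_odd (h2 : ∀ x : U, -x = x → x = 0) :
    2 * Module.finrank ℂ (LinearMap.range (oddProj : Module.End ℂ (U → ℂ))) + 1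
      = Fintype.card U := by
  have h := (det_one_add_smul_of_idem (oddProj_mul_oddProj (U := U))).1
  rw [oddProj, map_smul, map_sub, trace_flip h2, LinearMap.trace_one] at h
  have h3 : ((2 * Module.finrank ℂ (LinearMap.range (oddProj : Module.End ℂ (U → ℂ))) + 1 : ℕ) : ℂ)
      = ((Fintype.card U : ℕ) : ℂ) := by
    push_cast
    rw [oddProj, h, smul_eq_mul, Module.finrank_fintype_fun_eq_card]
    ring
  exact_mod_cast h3

/-- The even part has exactly one dimension more than the odd part, so all but one power of `c`
cancels. Hence `parityDet A • A` does not depend on the scaling of `A`. -/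
theorem parityDet_smul (h2 : ∀ x : U, -x = x → x = 0) (c : ℂ) (hc : c ≠ 0)
    {A : Module.End ℂ (U → ℂ)} (hA : A * flip = flip * A) :
    parityDet (c • A) = c⁻¹ * parityDet A := by
  have h1 : c • A = (c • 1) * A := by simp
  rw [h1, parityDet_mul hA]
  congr 1
  have h3 : (c • 1 * oddProj + evenProj : Module.End ℂ (U → ℂ)) = 1 + (c - 1) • oddProj := by
    rw [smul_mul_assoc, one_mul, ← evenProj_add_oddProj (U := U)]
    module
  have h4 : (c • 1 * evenProj + oddProj : Module.End ℂ (U → ℂ)) = 1 + (c - 1) • evenProj := by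
    rw [smul_mul_assoc, one_mul, ← evenProj_add_oddProj (U := U)]
    module
  rw [parityDet, h3, h4, (det_one_add_smul_of_idem oddProj_mul_oddProj).2,
    (det_one_add_smul_of_idem evenProj_mul_evenProj).2]
  have h5 := finrank_even h2
  have h6 := finrank_odd h2
  have h7 : Module.finrank ℂ (LinearMap.range (evenProj : Module.End ℂ (U → ℂ)))
      = Module.finrank ℂ (LinearMap.range (oddProj : Module.End ℂ (U → ℂ))) + 1 := by omega
  rw [h7, add_sub_cancel, pow_succ, div_mul_eq_div_div, div_self (pow_ne_zero _ hc), one_div]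

theorem exists_sign (h2 : ∀ x : U, -x = x → x = 0) :
    ∃ s : U → ℂ, (∀ x, s x * s x = 1) ∧ ∀ x, x ≠ 0 → s (-x) = -s x := by
  classical
  -- An arbitrary ordering of `U` distinguishes `x` from `-x` when `x ≠ 0`; at the origin only the
  -- square of the value matters.
  let e := Fintype.equivFin U
  refine ⟨fun x => if e x < e (-x) then 1 else -1, fun x => ?_, fun x hx => ?_⟩
  · beta_reduce; split_ifs <;> simp
  · have hne : e x ≠ e (-x) := fun h => hx (h2 x (e.injective h).symm)
    beta_reduce
    rw [neg_neg]
    rcases lt_or_gt_of_ne hne with h | h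
    · simp [h, h.le]
    · simp [h, not_lt.2 h.le]

/-- Multiplication by a sign function odd away from the origin exchanges the parity conditions
there, and at the origin `a 0 = 1`; so it conjugates the odd factor of the quotient into the even
factor. -/
theorem parityDet_mulOp (h2 : ∀ x : U, -x = x → x = 0) {a : U → ℂ} (ha : ∀ x, a x ≠ 0)
    (heven : ∀ x, a (-x) = a x) (ha0 : a 0 = 1) : parityDet (mulOp a) = 1 := by
  obtain ⟨s, hs, hneg⟩ := exists_sign h2
  have hD : (mulOp s : Module.End ℂ (U → ℂ)) * mulOp s = 1 := by
    ext f x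
    simp [← mul_assoc, hs]
  have h1 : mulOp s * (mulOp a * oddProj + evenProj) * mulOp s = mulOp a * evenProj + oddProj := by
    refine LinearMap.ext fun f => funext fun x => ?_
    simp only [Module.End.mul_apply, LinearMap.add_apply, evenProj, oddProj, LinearMap.smul_apply,
      LinearMap.sub_apply, Module.End.one_apply, mulOp_apply, Pi.add_apply, Pi.smul_apply,
      Pi.sub_apply, flip_apply, smul_eq_mul]
    rcases eq_or_ne x 0 with rfl | hx
    · rw [neg_zero, ha0]
      linear_combination (1 / 2 * (1 + 1) * f 0) * hs 0
    · rw [hneg x hx]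
      linear_combination (1 / 2 * (a x * (f x + f (-x)) + f x - f (-x))) * hs x
  have h3 : LinearMap.det (mulOp a * evenProj + oddProj)
      = LinearMap.det (mulOp a * oddProj + evenProj) := by
    rw [← h1, map_mul, map_mul, mul_comm, ← mul_assoc, ← map_mul, hD, map_one, one_mul]
  rw [parityDet, h3]
  refine div_self fun h0 => ?_
  have hc : mulOp a⁻¹ * flip = flip * mulOp a⁻¹ := by
    ext f x
    simp [heven]
  have h4 := odd_part_mul (A := mulOp a) hc
  have h5 : mulOp a * mulOp a⁻¹ = 1 := by
    ext f x
    simp [ha]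
  rw [h5, one_mul, add_comm oddProj, evenProj_add_oddProj] at h4
  have h6 := congrArg LinearMap.det h4
  rw [map_mul, h0, zero_mul, map_one] at h6
  exact zero_ne_one h6

end Parity

/-! ### Heisenberg operators, Stone–von Neumann and the canonical lift -/

section Schrodinger

variable {F : Type*} [Field F] {U : Type*} [AddCommGroup U] [Module F U]

/-- The symplectic form on `U × U` attached to a bilinear form on `U`. -/
def sympPair (b : LinearMap.BilinForm F U) : LinearMap.BilinForm F (U × U) :=
  b.compl₁₂ (LinearMap.fst F U U) (LinearMap.snd F U U) -
    (b.compl₁₂ (LinearMap.fst F U U) (LinearMap.snd F U U)).flip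

theorem sympPair_apply (b : LinearMap.BilinForm F U) (d e : U × U) :
    sympPair b d e = b d.1 e.2 - b e.1 d.2 := rfl

/-- The assumptions on the data of the Schrödinger model: odd characteristic, a symmetric
nondegenerate form, and a non-trivial additive character. -/
structure IsSchrodingerDatum (b : LinearMap.BilinForm F U) (ψ : AddChar F ℂ) : Prop where
  two_ne : (2 : F) ≠ 0
  symm : ∀ x y, b x y = b y x
  nondeg : ∀ x, (∀ y, b x y = 0) → x = 0
  psi_ne : ψ ≠ 1

/-- The Heisenberg operators on functions on `U`. -/
def schr (b : LinearMap.BilinForm F U) (ψ : AddChar F ℂ) (d : U × U) : Module.End ℂ (U → ℂ) :=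
  mulOp (fun x => ψ (1 / 2 * b d.1 d.2 + b d.2 x)) ∘ₗ LinearMap.funLeft ℂ ℂ fun x => x + d.1

variable {b : LinearMap.BilinForm F U} {ψ : AddChar F ℂ}

theorem schr_apply (d : U × U) (f : U → ℂ) (x : U) :
    schr b ψ d f x = ψ (1 / 2 * b d.1 d.2 + b d.2 x) * f (x + d.1) := rfl

/-- Operators satisfying the commutation relations of the Heisenberg group. -/
structure IsHeisenberg (b : LinearMap.BilinForm F U) (ψ : AddChar F ℂ) {E : Type*}
    [AddCommGroup E] [Module ℂ E] (T : U × U → Module.End ℂ E) : Prop where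
  zero : T 0 = 1
  mul : ∀ d e, T d * T e = ψ (1 / 2 * sympPair b d e) • T (d + e)

theorem IsSchrodingerDatum.neg_eq (h : IsSchrodingerDatum b ψ) (x : U) (hx : -x = x) : x = 0 := by
  have h1 : (2 : F) • x = 0 := by
    rw [two_smul]
    nth_rw 1 [← hx]
    exact neg_add_cancel x
  exact (smul_eq_zero.1 h1).resolve_left h.two_ne

theorem schr_isHeisenberg (h : IsSchrodingerDatum b ψ) : IsHeisenberg b ψ (schr b ψ) := by
  refine ⟨?_, fun d e => ?_⟩
  · ext f x
    simp [schr_apply]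
  · refine LinearMap.ext fun f => funext fun x => ?_
    rw [Module.End.mul_apply, schr_apply, schr_apply, LinearMap.smul_apply, Pi.smul_apply,
      schr_apply, smul_eq_mul, ← mul_assoc, ← mul_assoc, ← AddChar.map_add_eq_mul,
      ← AddChar.map_add_eq_mul, add_assoc x]
    congr 2
    have h2 := h.two_ne
    simp only [sympPair_apply, Prod.fst_add, Prod.snd_add, map_add, LinearMap.add_apply]
    rw [h.symm e.2 d.1]
    field_simp
    ring

theorem sympPair_self (b : LinearMap.BilinForm F U) (d : U × U) : sympPair b d d = 0 := by
  rw [sympPair_apply, sub_self]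

theorem sympPair_swap (b : LinearMap.BilinForm F U) (d e : U × U) :
    sympPair b d e = -sympPair b e d := by
  simp only [sympPair_apply, neg_sub]

variable [Fintype U]

/-- Two families of Heisenberg operators are related by a nonzero intertwiner, provided that the
target operators are linearly independent. -/
theorem exists_heisenberg_intertwiner {E E' : Type*} [AddCommGroup E] [Module ℂ E]
    [AddCommGroup E'] [Module ℂ E'] [Nontrivial E] [Nontrivial E']
    {T : U × U → Module.End ℂ E} {S : U × U → Module.End ℂ E'}
    (hT : IsHeisenberg b ψ T) (hS : IsHeisenberg b ψ S) (hli : LinearIndependent ℂ S) :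
    ∃ A : E →ₗ[ℂ] E', A ≠ 0 ∧ ∀ d, A ∘ₗ T d = S d ∘ₗ A := by
  obtain ⟨v, hv⟩ := exists_ne (0 : E)
  obtain ⟨ξ, hξ⟩ : ∃ ξ : E →ₗ[ℂ] ℂ, ξ v = 1 := by
    obtain ⟨f, hf⟩ : ∃ f : Module.Dual ℂ E, f v ≠ 0 := by
      by_contra hcon
      push Not at hcon
      exact hv ((Module.forall_dual_apply_eq_zero_iff ℂ v).1 hcon)
    exact ⟨(f v)⁻¹ • f, by simp [hf]⟩
  -- Average the rank one map `ξ(·) y` over the Heisenberg group modulo its centre. The central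
  -- factors of `S e * S d` and of `T (-(e + d)) * T e` agree, so the average intertwines.
  let A : E' → (E →ₗ[ℂ] E') := fun y => ∑ d, S d ∘ₗ (ξ.smulRight y) ∘ₗ T (-d)
  by_contra hcon
  push Not at hcon
  have hA : ∀ y, A y = 0 := by
    intro y
    by_contra hne
    obtain ⟨e, he⟩ := hcon (A y) hne
    apply he
    refine LinearMap.ext fun x => ?_
    simp only [A, LinearMap.comp_apply, LinearMap.sum_apply, map_sum]
    refine (Fintype.sum_equiv (Equiv.addLeft e) _ _ fun d => ?_).symm
    have h1 : S e ∘ₗ S d = ψ (1 / 2 * sympPair b e d) • S (e + d) := hS.mul e d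
    have h2 : T (-(e + d)) ∘ₗ T e = ψ (1 / 2 * sympPair b e d) • T (-d) := by
      have := hT.mul (-(e + d)) e
      rw [show -(e + d) + e = -d by abel] at this
      rw [← Module.End.mul_eq_comp, this, sympPair_swap b e d]
      congr 3
      simp [sympPair_self]
    have h1' := fun z => LinearMap.congr_fun h1 z
    have h2' := LinearMap.congr_fun h2 x
    simp only [LinearMap.comp_apply, LinearMap.smul_apply] at h1' h2'
    rw [h1', Equiv.coe_addLeft, h2', map_smul, map_smul]
  -- If all averages vanish, evaluation at `v` gives a linear relation among the `S d` whose
  -- coefficient at `d = 0` is `ξ v = 1`.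
  have h0 : ∑ d, ξ (T (-d) v) • S d = 0 := by
    ext y
    have := LinearMap.congr_fun (hA y) v
    simp only [A, LinearMap.sum_apply, LinearMap.comp_apply, LinearMap.smulRight_apply,
      map_smul] at this
    simpa [LinearMap.sum_apply] using this
  have h1 := Fintype.linearIndependent_iff.1 hli _ h0 0
  rw [neg_zero, hT.zero, Module.End.one_apply, hξ] at h1
  exact one_ne_zero h1

variable [Fintype F]

/-- A translation by `d.1 ≠ 0` has no fixed point, and for `d.1 = 0` the trace is a sum over `U` of
the character `x ↦ ψ(b d.2 x)`, non-trivial by nondegeneracy when `d.2 ≠ 0`. -/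
theorem trace_schr [DecidableEq U] (h : IsSchrodingerDatum b ψ) (d : U × U) :
    LinearMap.trace ℂ _ (schr b ψ d) = if d = 0 then (Fintype.card U : ℂ) else 0 := by
  rw [trace_fun]
  simp only [schr_apply, Pi.single_apply]
  by_cases h1 : d.1 = 0
  · simp only [h1, add_zero, if_true, mul_one, map_zero, LinearMap.zero_apply, mul_zero, zero_add]
    by_cases h2 : d.2 = 0
    · have : d = 0 := Prod.ext h1 h2
      simp [this]
    · rw [if_neg fun h3 => h2 (by rw [h3]; rfl)]
      let φ : AddChar U ℂ := ψ.compAddMonoidHom (b d.2).toAddMonoidHom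
      have hφ : φ ≠ 1 := by
        obtain ⟨y, hy⟩ : ∃ y, b d.2 y ≠ 0 := by
          by_contra hcon
          push Not at hcon
          exact h2 (h.nondeg _ hcon)
        obtain ⟨t, ht⟩ : ∃ t, ψ t ≠ 1 := by
          by_contra hcon
          push Not at hcon
          exact h.psi_ne (DFunLike.ext _ _ hcon)
        intro h3
        apply ht
        have h4 := DFunLike.congr_fun h3 ((t / b d.2 y) • y)
        have h5 : φ ((t / b d.2 y) • y) = ψ (b d.2 ((t / b d.2 y) • y)) := rfl
        rw [h5, map_smul, smul_eq_mul, div_mul_cancel₀ _ hy] at h4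
        exact h4
      exact AddChar.sum_eq_zero_of_ne_one hφ
  · rw [if_neg fun h3 => h1 (by rw [h3]; rfl)]
    refine Finset.sum_eq_zero fun x _ => ?_
    rw [if_neg, mul_zero]
    intro h2
    exact h1 (by simpa using h2)

/-- The trace of the product with the operator of `-e` isolates the coefficient at `e`. -/
theorem linearIndependent_schr (h : IsSchrodingerDatum b ψ) :
    LinearIndependent ℂ (schr b ψ) := by
  classical
  rw [Fintype.linearIndependent_iff]
  intro c hc e
  have hH := schr_isHeisenberg h
  have h1 := congrArg (fun X => LinearMap.trace ℂ _ (X * schr b ψ (-e))) hc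
  simp only [Finset.sum_mul, map_sum, smul_mul_assoc, map_smul, hH.mul, trace_schr h, zero_mul,
    map_zero, smul_eq_mul, mul_ite, mul_zero, ← sub_eq_add_neg, sub_eq_zero] at h1
  rw [Finset.sum_ite_eq' Finset.univ e] at h1
  simp only [Finset.mem_univ, if_true, map_neg, sympPair_self, neg_zero, mul_zero,
    AddChar.map_zero_eq_one, one_mul] at h1
  exact (mul_eq_zero.1 h1).resolve_right (Nat.cast_ne_zero.2 Fintype.card_ne_zero)

/-- The Heisenberg operators form a basis of the space of operators. -/
def schrBasis (h : IsSchrodingerDatum b ψ) : Module.Basis (U × U) ℂ (Module.End ℂ (U → ℂ)) :=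
  basisOfLinearIndependentOfCardEqFinrank (linearIndependent_schr h) (by
    simp [Module.finrank_linearMap])

theorem schrBasis_apply (h : IsSchrodingerDatum b ψ) (d : U × U) :
    schrBasis h d = schr b ψ d := by
  simp [schrBasis]

theorem mul_comm_of_forall_schr (h : IsSchrodingerDatum b ψ) {A : Module.End ℂ (U → ℂ)}
    (hA : ∀ d, A * schr b ψ d = schr b ψ d * A) (X : Module.End ℂ (U → ℂ)) : A * X = X * A := by
  have h1 : LinearMap.mulLeft ℂ A = LinearMap.mulRight ℂ A :=
    (schrBasis h).ext fun d => by simpa [schrBasis_apply] using hA d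
  exact LinearMap.congr_fun h1 X

theorem exists_scalar_of_forall_schr (h : IsSchrodingerDatum b ψ) {A : Module.End ℂ (U → ℂ)}
    (hA : ∀ d, A * schr b ψ d = schr b ψ d * A) : ∃ c : ℂ, A = c • 1 := by
  have h1 : A ∈ Subalgebra.center ℂ (Module.End ℂ (U → ℂ)) :=
    Subalgebra.mem_center_iff.2 fun X => (mul_comm_of_forall_schr h hA X).symm
  rw [Algebra.IsCentral.center_eq_bot, Algebra.mem_bot] at h1
  obtain ⟨c, hc⟩ := h1
  exact ⟨c, by rw [← hc, Algebra.algebraMap_eq_smul_one]⟩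

/-- A subspace stable under the Heisenberg operators which contains a nonzero vector is everything. -/
theorem eq_top_of_schr_stable (h : IsSchrodingerDatum b ψ) {X : Submodule ℂ (U → ℂ)}
    (hX : ∀ d, ∀ f ∈ X, schr b ψ d f ∈ X) {f : U → ℂ} (hf : f ∈ X) (hf0 : f ≠ 0) (g : U → ℂ) :
    g ∈ X := by
  have h1 : ∀ Y : Module.End ℂ (U → ℂ), Y f ∈ X := by
    intro Y
    rw [← (schrBasis h).sum_repr Y, LinearMap.sum_apply]
    refine Submodule.sum_mem _ fun d _ => ?_
    rw [schrBasis_apply]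
    exact Submodule.smul_mem _ _ (hX d f hf)
  obtain ⟨x, hx⟩ : ∃ x, f x ≠ 0 := by
    by_contra hcon
    push Not at hcon
    exact hf0 (funext hcon)
  -- As the Heisenberg operators span all operators, a rank one operator carrying `f` to `g`
  -- preserves the subspace.
  have h2 : (LinearMap.proj x : (U → ℂ) →ₗ[ℂ] ℂ).smulRight ((f x)⁻¹ • g) f = g := by
    simp [smul_smul, hx]
  rw [← h2]
  exact h1 _

/-- `A` implements the transformation `g` of `U × U` on the Heisenberg operators. -/
def IsEgorov (b : LinearMap.BilinForm F U) (ψ : AddChar F ℂ) (g : U × U → U × U)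
    (A : Module.End ℂ (U → ℂ)) : Prop :=
  ∀ d, A * schr b ψ d = schr b ψ (g d) * A

omit [Fintype U] [Fintype F] in
theorem IsEgorov.mul {g g' : U × U → U × U} {A A' : Module.End ℂ (U → ℂ)}
    (hA : IsEgorov b ψ g A) (hA' : IsEgorov b ψ g' A') : IsEgorov b ψ (g ∘ g') (A * A') := by
  intro d
  rw [mul_assoc, hA', ← mul_assoc, hA, mul_assoc]
  rfl

/-- The twisted operators `schr b ψ (g d)` satisfy the same relations and are still independent, so
an intertwiner exists. Its kernel is stable under all Heisenberg operators, hence zero. -/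
theorem exists_isEgorov (h : IsSchrodingerDatum b ψ) (g : (U × U) ≃ₗ[F] (U × U))
    (hg : ∀ d e, sympPair b (g d) (g e) = sympPair b d e) :
    ∃ A A' : Module.End ℂ (U → ℂ), A * A' = 1 ∧ IsEgorov b ψ g A := by
  have hH := schr_isHeisenberg h
  have hS : IsHeisenberg b ψ fun d => schr b ψ (g d) :=
    ⟨by rw [map_zero, hH.zero], fun d e => by rw [hH.mul, hg, map_add]⟩
  obtain ⟨A, hA0, hA⟩ := exists_heisenberg_intertwiner hH hS
    ((linearIndependent_schr h).comp _ g.injective)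
  have hinj : LinearMap.ker A = ⊥ := by
    rw [LinearMap.ker_eq_bot']
    intro f hf
    by_contra hf0
    apply hA0
    ext1 f'
    exact eq_top_of_schr_stable h (X := LinearMap.ker A)
      (fun d f hf => by
        rw [LinearMap.mem_ker] at hf ⊢
        have := LinearMap.congr_fun (hA d) f
        simpa [hf] using this) hf hf0 _
  have hu : IsUnit A := (LinearMap.isUnit_iff_ker_eq_bot A).2 hinj
  obtain ⟨A', hA'⟩ := hu.exists_right_inv
  exact ⟨A, A', hA', hA⟩

/-- `A' * B` commutes with all Heisenberg operators, so it is a scalar. -/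
theorem IsEgorov.exists_smul (h : IsSchrodingerDatum b ψ) {g : U × U → U × U}
    {A A' B : Module.End ℂ (U → ℂ)} (hAA' : A * A' = 1) (hA : IsEgorov b ψ g A)
    (hB : IsEgorov b ψ g B) : ∃ c : ℂ, B = c • A := by
  have hA'A : A' * A = 1 := mul_eq_one_comm.1 hAA'
  obtain ⟨c, hc⟩ := exists_scalar_of_forall_schr h (A := A' * B) fun d => by
    have h1 : schr b ψ d * A' = A' * schr b ψ (g d) := by
      calc schr b ψ d * A' = A' * (A * schr b ψ d) * A' := by
            rw [← mul_assoc A', hA'A, one_mul]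
        _ = A' * schr b ψ (g d) := by rw [hA, mul_assoc, mul_assoc, hAA', mul_one]
    rw [mul_assoc, hB, ← mul_assoc, ← h1, mul_assoc]
  refine ⟨c, ?_⟩
  rw [← one_mul B, ← hAA', mul_assoc, hc]
  simp

omit [Fintype U] [Fintype F] in
theorem flip_isEgorov (b : LinearMap.BilinForm F U) (ψ : AddChar F ℂ) :
    IsEgorov b ψ (fun d => -d) flip := by
  intro d
  refine LinearMap.ext fun f => funext fun x => ?_
  simp only [Module.End.mul_apply, flip_apply, schr_apply, Prod.fst_neg, Prod.snd_neg, map_neg,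
    LinearMap.neg_apply, neg_neg, neg_add]

/-- Since `-1` is central, `A * flip` and `flip * A` implement the same map and are proportional.
Conjugation preserves the trace of `flip`, which is `1` and not `0`, so the factor is `1`. -/
theorem IsEgorov.mul_flip (h : IsSchrodingerDatum b ψ) {g : (U × U) ≃ₗ[F] (U × U)}
    {A A' : Module.End ℂ (U → ℂ)} (hAA' : A * A' = 1) (hA : IsEgorov b ψ g A) :
    A * flip = flip * A := by
  have hf := flip_isEgorov b ψ
  have h1 : IsEgorov b ψ (g ∘ fun d => -d) (A * flip) := hA.mul hf
  have h2 : IsEgorov b ψ (g ∘ fun d => -d) (flip * A) := by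
    have := hf.mul hA
    convert this using 1
    ext d <;> simp
  have h3 : (flip * A) * (A' * flip) = 1 := by
    rw [mul_assoc, ← mul_assoc A, hAA', one_mul, flip_mul_flip]
  obtain ⟨c, hc⟩ := IsEgorov.exists_smul h h3 h2 h1
  have hc2 : c = 1 := by
    have h4 : A * flip * A' = c • flip := by
      rw [hc, smul_mul_assoc, mul_assoc, hAA', mul_one]
    have h5 := congrArg (LinearMap.trace ℂ _) h4
    rw [LinearMap.trace_mul_comm, ← mul_assoc, mul_eq_one_comm.1 hAA', one_mul, map_smul,
      trace_flip h.neg_eq, smul_eq_mul, mul_one] at h5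
    exact h5.symm
  rw [hc, hc2, one_smul]

section Rep

variable {Γ : Type*} [Group Γ] {act : Γ →* ((U × U) ≃ₗ[F] (U × U))}

/-- The normalised operator `parityDet A • A` does not depend on the choice of `A`, and `parityDet`
is multiplicative, so the projective representation lifts. -/
theorem exists_weil (h : IsSchrodingerDatum b ψ)
    (hact : ∀ g d e, sympPair b (act g d) (act g e) = sympPair b d e) :
    ∃ ω : Representation ℂ Γ (U → ℂ), (∀ g, IsEgorov b ψ (act g) (ω g)) ∧
      ∀ g A A', A * A' = 1 → IsEgorov b ψ (act g) A → ω g = parityDet A • A := by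
  choose A A' hAA' hA using fun g => exists_isEgorov h (act g) (hact g)
  have key : ∀ g B B', B * B' = 1 → IsEgorov b ψ (act g) B →
      parityDet (A g) • A g = parityDet B • B := by
    intro g B B' hBB' hB
    obtain ⟨c, hc⟩ := IsEgorov.exists_smul h (hAA' g) (hA g) hB
    have hc0 : c ≠ 0 := by
      rintro rfl
      rw [hc, zero_smul, zero_mul] at hBB'
      exact zero_ne_one hBB'
    rw [hc, parityDet_smul h.neg_eq c hc0 ((hA g).mul_flip h (hAA' g)), smul_smul]
    congr 1
    field_simp
  have hmul : ∀ g g', A g * A g' * (A' g' * A' g) = 1 := fun g g' => by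
    rw [mul_assoc, ← mul_assoc (A g'), hAA' g', one_mul, hAA' g]
  refine ⟨{ toFun := fun g => parityDet (A g) • A g, map_one' := ?_, map_mul' := ?_ }, ?_, ?_⟩
  · rw [key 1 1 1 (mul_one 1) fun d => by simp, parityDet_one, one_smul]
  · intro g g'
    rw [key (g * g') (A g * A g') _ (hmul g g') (by
        have := (hA g).mul (hA g')
        rw [map_mul]
        exact this),
      parityDet_mul ((hA g').mul_flip h (hAA' g')), smul_mul_smul_comm]
  · intro g d
    change (parityDet (A g) • A g) * _ = _ * (parityDet (A g) • A g)
    rw [smul_mul_assoc, hA, mul_smul_comm]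
  · intro g B B' hBB' hB
    exact key g B B' hBB' hB

variable {ω : Representation ℂ Γ (U → ℂ)}

omit [AddCommGroup U] [Fintype U] in
theorem weil_mul_inv (ω : Representation ℂ Γ (U → ℂ)) (g : Γ) : ω g * ω g⁻¹ = 1 := by
  rw [← map_mul, mul_inv_cancel, map_one]

theorem weil_flip (h : IsSchrodingerDatum b ψ) (hω : ∀ g, IsEgorov b ψ (act g) (ω g)) (g : Γ) :
    ω g * flip = flip * ω g :=
  (hω g).mul_flip h (weil_mul_inv ω g)

/-- The character by which an oscillator representation differs from the canonical one. -/
def weilChar (h : IsSchrodingerDatum b ψ) (hω : ∀ g, IsEgorov b ψ (act g) (ω g)) : Γ →* ℂ where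
  toFun g := parityDet (ω g)
  map_one' := by rw [map_one, parityDet_one]
  map_mul' g g' := by rw [map_mul, parityDet_mul (weil_flip h hω g')]

/-- `parityDet (ω g) = 1` already fixes the scalar in `ω g`, so any other implementing operator
recovers it after normalisation. -/
theorem weil_eq_of_weilChar (h : IsSchrodingerDatum b ψ)
    (hω : ∀ g, IsEgorov b ψ (act g) (ω g)) {g : Γ} (hg : weilChar h hω g = 1)
    {A A' : Module.End ℂ (U → ℂ)} (hAA' : A * A' = 1) (hA : IsEgorov b ψ (act g) A) :
    ω g = parityDet A • A := by
  obtain ⟨c, hc⟩ := IsEgorov.exists_smul h (weil_mul_inv ω g) (hω g) hA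
  have hc0 : c ≠ 0 := by
    rintro rfl
    rw [hc, zero_smul, zero_mul] at hAA'
    exact zero_ne_one hAA'
  have hg' : parityDet (ω g) = 1 := hg
  rw [hc, parityDet_smul h.neg_eq c hc0 (weil_flip h hω g), hg', smul_smul, mul_one,
    inv_mul_cancel₀ hc0, one_smul]

/-- The left side is the trace of conjugation by `ω g` on operators, and this conjugation permutes
the Heisenberg basis by `act g`. -/
theorem char_mul_char_inv [DecidableEq U] (h : IsSchrodingerDatum b ψ)
    (hω : ∀ g, IsEgorov b ψ (act g) (ω g)) (g : Γ) :
    ω.character g * ω.character g⁻¹ = (Finset.univ.filter fun d => act g d = d).card := by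
  rw [mul_comm, ← char_linHom, character,
    LinearMap.trace_eq_matrix_trace ℂ (schrBasis h), Matrix.trace, Finset.card_filter,
    Nat.cast_sum]
  refine Finset.sum_congr rfl fun d _ => ?_
  have h1 : linHom ω ω g (schrBasis h d) = schrBasis h (act g d) := by
    rw [linHom_apply, schrBasis_apply, schrBasis_apply, ← LinearMap.comp_assoc,
      ← Module.End.mul_eq_comp (ω g), hω, ← Module.End.mul_eq_comp, mul_assoc, weil_mul_inv,
      mul_one]
  rw [Matrix.diag_apply, LinearMap.toMatrix_apply, h1, Module.Basis.repr_self,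
    Finsupp.single_apply]
  simp

end Rep

end Schrodinger

/-! ### The group `SL₂` -/

section SL2

variable {F : Type*} [Field F]

/-- Lower unipotent elements. -/
def low (t : F) : SL2 F := ⟨!![1, 0; t, 1], by simp [Matrix.det_fin_two]⟩

@[simp] theorem low_zero_zero (t : F) : low t 0 0 = 1 := rfl
@[simp] theorem low_zero_one (t : F) : low t 0 1 = 0 := rfl
@[simp] theorem low_one_zero (t : F) : low t 1 0 = t := rfl
@[simp] theorem low_one_one (t : F) : low t 1 1 = 1 := rfl

/-- Upper unipotent elements. -/
def upp (t : F) : SL2 F := ⟨!![1, t; 0, 1], by simp [Matrix.det_fin_two]⟩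

/-- Diagonal elements. -/
def dg (s : Fˣ) : SL2 F := ⟨!![(s : F), 0; 0, ((s⁻¹ : Fˣ) : F)], by simp [Matrix.det_fin_two]⟩

/-- The Weyl element. -/
def wel : SL2 F := ⟨!![0, 1; -1, 0], by simp [Matrix.det_fin_two]⟩

theorem sl2_ext {g h : SL2 F} (h00 : g 0 0 = h 0 0) (h01 : g 0 1 = h 0 1) (h10 : g 1 0 = h 1 0)
    (h11 : g 1 1 = h 1 1) : g = h := by
  apply Matrix.SpecialLinearGroup.ext
  intro i j
  fin_cases i <;> fin_cases j <;> assumption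

theorem sl2_mul_apply (g h : SL2 F) (i j : Fin 2) :
    (g * h) i j = g i 0 * h 0 j + g i 1 * h 1 j := by
  rw [Matrix.SpecialLinearGroup.coe_mul, Matrix.mul_apply, Fin.sum_univ_two]

theorem sl2_det (g : SL2 F) : g 0 0 * g 1 1 - g 0 1 * g 1 0 = 1 := by
  have := g.det_coe
  rwa [Matrix.det_fin_two] at this

theorem low_add (s t : F) : low (s + t) = low s * low t := by
  apply sl2_ext <;> rw [sl2_mul_apply] <;> simp [low]

theorem low_zero : low (0 : F) = 1 := by
  apply sl2_ext <;> simp [low]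

theorem wel_mul_low (t : F) : wel * low (-t) = upp t * wel := by
  apply sl2_ext <;> rw [sl2_mul_apply, sl2_mul_apply] <;> simp [low, upp, wel]

theorem upp_eq (t : F) : upp t = wel * low (-t) * wel⁻¹ := by
  rw [wel_mul_low, mul_inv_cancel_right]

theorem upp_neg (t : F) : upp (-t) = (upp t)⁻¹ := by
  rw [eq_inv_iff_mul_eq_one]
  apply sl2_ext <;> rw [sl2_mul_apply] <;> simp [upp]

theorem dg_mul_low (s : Fˣ) (t : F) :
    dg s * low ((s : F) * s * t) = low t * dg s := by
  apply sl2_ext <;> rw [sl2_mul_apply, sl2_mul_apply] <;> simp [dg, low]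
  field_simp

/-- If the lower left entry is nonzero, `g` is an upper times a lower times an upper unipotent
element; otherwise multiplication by `low 1` makes that entry nonzero. -/
theorem sl2_mem_of_unipotent (K : Subgroup (SL2 F)) (hl : ∀ t, low t ∈ K) (hu : ∀ t, upp t ∈ K)
    (g : SL2 F) : g ∈ K := by
  have key : ∀ g : SL2 F, g 1 0 ≠ 0 → g ∈ K := by
    intro g hg
    have h : g = upp ((g 0 0 - 1) / g 1 0) * low (g 1 0) * upp ((g 1 1 - 1) / g 1 0) := by
      have hd := sl2_det g
      apply sl2_ext <;> simp only [sl2_mul_apply] <;> simp [low, upp] <;> field_simp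
      all_goals first | ring1 | linear_combination hd | linear_combination -hd
    rw [h]
    exact K.mul_mem (K.mul_mem (hu _) (hl _)) (hu _)
  by_cases hg : g 1 0 = 0
  · have h1 : g * low 1 ∈ K := by
      apply key
      rw [sl2_mul_apply, hg]
      have hd := sl2_det g
      rw [hg, mul_zero, sub_zero] at hd
      simpa [low] using right_ne_zero_of_mul_eq_one hd
    exact (K.mul_mem_cancel_right (hl 1)).1 h1
  · exact key g hg

/-- Upper unipotent elements are conjugates of lower ones by `wel`, and together they generate. No
appeal to perfectness is made, which would fail for `q = 3`. -/
theorem sl2_hom_eq_one {M : Type*} [Monoid M] (f : SL2 F →* M) (h : ∀ t, f (low t) = 1)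
    (g : SL2 F) : f g = 1 := by
  refine MonoidHom.mem_ker.1 (sl2_mem_of_unipotent f.ker (fun t => h t) (fun t => ?_) g)
  rw [MonoidHom.mem_ker, upp_eq, map_mul, map_mul, h, mul_one, ← map_mul, mul_inv_cancel, map_one]

/-! ### Counting in `SL₂` according to the trace -/

section Card

variable [Fintype F] [DecidableEq F]

omit [DecidableEq F] in
theorem card_SL2 : Nat.card (SL2 F) = Fintype.card F ^ 3 - Fintype.card F := by
  set q := Fintype.card F with hq
  have hq1 : 1 < q := Fintype.one_lt_card
  have h1 : Nat.card (GL (Fin 2) F) = (q ^ 2 - 1) * (q ^ 2 - q) := by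
    rw [Matrix.card_GL_field, Fin.prod_univ_two]
    simp [hq]
  let D : GL (Fin 2) F →* Fˣ := Matrix.GeneralLinearGroup.det
  have hsurj : Function.Surjective D := by
    intro x
    refine ⟨Matrix.GeneralLinearGroup.mkOfDetNeZero !![(x : F), 0; 0, 1] (by simp [Matrix.det_fin_two]), ?_⟩
    ext
    simp [D, Matrix.GeneralLinearGroup.mkOfDetNeZero]
  have h2 : Nat.card D.ker = Nat.card (SL2 F) := by
    refine Nat.card_congr
      { toFun := fun g => ⟨(g : GL (Fin 2) F), ?_⟩
        invFun := fun g => ⟨Matrix.SpecialLinearGroup.toGL g, ?_⟩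
        left_inv := fun g => ?_
        right_inv := fun g => ?_ }
    · have := congrArg Units.val (MonoidHom.mem_ker.1 g.2)
      simpa [D] using this
    · rw [MonoidHom.mem_ker]
      ext
      simp [D]
    · ext; rfl
    · ext; rfl
  have h3 := D.ker.card_mul_index
  rw [Subgroup.index_ker, MonoidHom.range_eq_top.2 hsurj, Subgroup.card_top, h2, h1,
    Nat.card_units, Nat.card_eq_fintype_card (α := F), ← hq] at h3
  have h4 : (q ^ 2 - 1) * (q ^ 2 - q) = (q ^ 3 - q) * (q - 1) := by
    have e1 : 1 ≤ q ^ 2 := Nat.one_le_pow _ _ (by omega)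
    have e2 : q ≤ q ^ 2 := Nat.le_self_pow (by norm_num) q
    have e3 : q ≤ q ^ 3 := Nat.le_self_pow (by norm_num) q
    zify [e1, e2, e3, hq1.le]
    ring
  rw [h4] at h3
  exact Nat.eq_of_mul_eq_mul_right (by omega) h3

variable [Fintype (SL2 F)]

/-- Elements of trace `2` with lower left entry zero are the `upp (-t)`, conjugate to `low t` by
`wel`. The others are uniquely `upp x * low t * (upp x)⁻¹` with `t ≠ 0`. So each `t ≠ 0` is counted
`1 + q` times. -/
theorem sum_trace_two {M : Type*} [AddCommGroup M] (Φ : SL2 F → M)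
    (hΦ : ∀ g h, Φ (h * g * h⁻¹) = Φ g) :
    ∑ g ∈ Finset.univ.filter (fun g : SL2 F => g 0 0 + g 1 1 = 2), Φ g
      = Φ 1 + (Fintype.card F + 1) • ∑ t ∈ Finset.univ.erase (0 : F), Φ (low t) := by
  rw [← Finset.sum_filter_add_sum_filter_not _ (fun g : SL2 F => g 1 0 = 0)]
  have h1 : ∑ g ∈ (Finset.univ.filter (fun g : SL2 F => g 0 0 + g 1 1 = 2)).filter
      (fun g => g 1 0 = 0), Φ g = ∑ t : F, Φ (low t) := by
    refine Finset.sum_bij' (fun g _ => -(g 0 1)) (fun t _ => upp (-t)) ?_ ?_ ?_ ?_ ?_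
    · intro g _; exact Finset.mem_univ _
    · intro t _
      simp only [Finset.mem_filter, Finset.mem_univ, true_and]
      constructor
      · simp [upp]; norm_num
      · simp [upp]
    · intro g hg
      simp only [Finset.mem_filter, Finset.mem_univ, true_and] at hg
      obtain ⟨htr, h10⟩ := hg
      have hd := sl2_det g
      rw [h10, mul_zero, sub_zero] at hd
      have h00 : g 0 0 = 1 := by
        have : (g 0 0 - 1) ^ 2 = 0 := by
          have : g 1 1 = 2 - g 0 0 := by linear_combination htr
          rw [this] at hd
          linear_combination -hd
        exact sub_eq_zero.1 (pow_eq_zero_iff (two_ne_zero)|>.1 this)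
      have h11 : g 1 1 = 1 := by linear_combination htr - h00
      apply sl2_ext <;> simp [upp, h00, h11, h10]
    · intro t _
      simp [upp]
    · intro g hg
      simp only [Finset.mem_filter, Finset.mem_univ, true_and] at hg
      obtain ⟨htr, h10⟩ := hg
      have hd := sl2_det g
      rw [h10, mul_zero, sub_zero] at hd
      have h00 : g 0 0 = 1 := by
        have : (g 0 0 - 1) ^ 2 = 0 := by
          have : g 1 1 = 2 - g 0 0 := by linear_combination htr
          rw [this] at hd
          linear_combination -hd
        exact sub_eq_zero.1 (pow_eq_zero_iff (two_ne_zero)|>.1 this)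
      have h11 : g 1 1 = 1 := by linear_combination htr - h00
      have h : g = upp (g 0 1) := by
        apply sl2_ext <;> simp [upp, h00, h11, h10]
      conv_lhs => rw [h, upp_eq, hΦ]
  have h2 : ∑ g ∈ (Finset.univ.filter (fun g : SL2 F => g 0 0 + g 1 1 = 2)).filter
      (fun g => ¬ g 1 0 = 0), Φ g
      = ∑ p ∈ (Finset.univ.erase (0 : F)) ×ˢ (Finset.univ : Finset F), Φ (low p.1) := by
    refine Finset.sum_bij' (fun g _ => (g 1 0, (g 0 0 - 1) / g 1 0))
      (fun p _ => upp p.2 * low p.1 * (upp p.2)⁻¹) ?_ ?_ ?_ ?_ ?_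
    · intro g hg
      simp only [Finset.mem_filter, Finset.mem_univ, true_and] at hg
      simp [hg.2]
    · intro p hp
      simp only [Finset.mem_product, Finset.mem_erase, Finset.mem_univ, and_true] at hp
      rw [← upp_neg]
      simp only [Finset.mem_filter, Finset.mem_univ, true_and, sl2_mul_apply]
      constructor
      · simp [upp, low]; ring
      · simpa [upp, low] using hp
    · intro g hg
      simp only [Finset.mem_filter, Finset.mem_univ, true_and] at hg
      obtain ⟨htr, h10⟩ := hg
      have hd := sl2_det g
      have h11 : g 1 1 = 2 - g 0 0 := by linear_combination htr
      rw [h11] at hd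
      rw [← upp_neg]
      apply sl2_ext <;> simp only [sl2_mul_apply] <;> simp [upp, low] <;> field_simp
      · ring
      · linear_combination hd
      · linear_combination -h11
    · intro p hp
      simp only [Finset.mem_product, Finset.mem_erase, Finset.mem_univ, and_true] at hp
      rw [← upp_neg]
      simp only [sl2_mul_apply]
      ext <;> simp [upp, low]
      field_simp
    · intro g hg
      simp only [Finset.mem_filter, Finset.mem_univ, true_and] at hg
      obtain ⟨htr, h10⟩ := hg
      have hd := sl2_det g
      have h11 : g 1 1 = 2 - g 0 0 := by linear_combination htr
      rw [h11] at hd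
      have h : g = upp ((g 0 0 - 1) / g 1 0) * low (g 1 0) * (upp ((g 0 0 - 1) / g 1 0))⁻¹ := by
        rw [← upp_neg]
        apply sl2_ext <;> simp only [sl2_mul_apply] <;> simp [upp, low] <;> field_simp
        · ring
        · linear_combination -hd
        · linear_combination h11
      conv_lhs => rw [h, hΦ]
  rw [h1, h2, Finset.sum_product, ← Finset.add_sum_erase _ _ (Finset.mem_univ (0 : F)), low_zero]
  simp only [Finset.sum_const, Finset.card_univ]
  rw [← Finset.smul_sum, add_smul, one_smul, add_assoc, add_comm (∑ t ∈ _, _)]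

theorem card_trace_two :
    (Finset.univ.filter (fun g : SL2 F => g 0 0 + g 1 1 = 2)).card = Fintype.card F ^ 2 := by
  have h := sum_trace_two (F := F) (M := ℤ) (fun _ => 1) fun _ _ => rfl
  simp only [Finset.sum_const, nsmul_eq_mul, mul_one,
    Finset.card_erase_of_mem (Finset.mem_univ (0 : F)), Finset.card_univ] at h
  rw [Nat.cast_sub Fintype.card_pos] at h
  have : ((Finset.univ.filter (fun g : SL2 F => g 0 0 + g 1 1 = 2)).card : ℤ)
      = (Fintype.card F : ℤ) ^ 2 := by
    rw [h]
    push_cast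
    ring
  exact_mod_cast this

end Card

/-! ### The action on pairs and its fixed points -/

section Act

variable {U : Type*} [AddCommGroup U] [Module F U]

/-- The action of `SL₂` on pairs, as on `U ⊗ F²`. -/
def sl2Fun (g : SL2 F) : U × U →ₗ[F] U × U :=
  (g 0 0 • LinearMap.fst F U U + g 0 1 • LinearMap.snd F U U).prod
    (g 1 0 • LinearMap.fst F U U + g 1 1 • LinearMap.snd F U U)

theorem sl2Fun_apply (g : SL2 F) (d : U × U) :
    sl2Fun g d = (g 0 0 • d.1 + g 0 1 • d.2, g 1 0 • d.1 + g 1 1 • d.2) := rfl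

theorem sl2Fun_mul (g h : SL2 F) (d : U × U) : sl2Fun (g * h) d = sl2Fun g (sl2Fun h d) := by
  simp only [sl2Fun_apply, sl2_mul_apply]
  ext <;> simp only <;> module

theorem sl2Fun_one (d : U × U) : sl2Fun (1 : SL2 F) d = d := by
  simp [sl2Fun_apply]

/-- The action of `SL₂` on pairs by linear automorphisms. -/
def sl2Act : SL2 F →* ((U × U) ≃ₗ[F] (U × U)) where
  toFun g := LinearEquiv.ofLinearMap (sl2Fun g) (sl2Fun g⁻¹)
    (by ext1 <;> ext1 x <;> simp [← sl2Fun_mul, sl2Fun_one])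
    (by ext1 <;> ext1 x <;> simp [← sl2Fun_mul, sl2Fun_one])
  map_one' := by
    apply LinearEquiv.ext
    exact sl2Fun_one
  map_mul' g h := by
    apply LinearEquiv.ext
    exact sl2Fun_mul g h

theorem sl2Act_apply (g : SL2 F) (d : U × U) :
    sl2Act g d = (g 0 0 • d.1 + g 0 1 • d.2, g 1 0 • d.1 + g 1 1 • d.2) := rfl

theorem sympPair_sl2Act (b : LinearMap.BilinForm F U) (hb : ∀ x y, b x y = b y x) (g : SL2 F)
    (d e : U × U) : sympPair b (sl2Act g d) (sl2Act g e) = sympPair b d e := by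
  have hd := sl2_det g
  simp only [sympPair_apply, sl2Act_apply, map_add, map_smul, LinearMap.add_apply,
    LinearMap.smul_apply, smul_eq_mul]
  rw [hb e.1 d.1, hb e.2 d.1, hb e.1 d.2, hb e.2 d.2]
  linear_combination (b d.1 e.2 - b d.2 e.1) * hd

variable [Fintype F] [DecidableEq F] [Fintype U] [DecidableEq U]

omit [Fintype F] [DecidableEq F] in
theorem card_fixed_one :
    (Finset.univ.filter fun d : U × U => sl2Act (1 : SL2 F) d = d).card = Fintype.card U ^ 2 := by
  rw [map_one]
  simp [sq]

omit [Fintype F] [DecidableEq F] in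
theorem card_fixed_low {t : F} (ht : t ≠ 0) :
    (Finset.univ.filter fun d : U × U => sl2Act (low t) d = d).card = Fintype.card U := by
  have h : (Finset.univ.filter fun d : U × U => sl2Act (low t) d = d)
      = {(0 : U)} ×ˢ Finset.univ := by
    ext d
    simp [sl2Act_apply, Prod.ext_iff, ht, eq_comm]
  rw [h, Finset.card_product, Finset.card_singleton, one_mul, Finset.card_univ]

omit [Fintype F] [DecidableEq F] in
-- `2 - (g 0 0 + g 1 1)` is the determinant of `g - 1`; applying the adjugate of `g - 1` to the
-- fixed point equations shows that it annihilates both components.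
theorem card_fixed_of_trace {g : SL2 F} (hg : g 0 0 + g 1 1 ≠ 2) :
    (Finset.univ.filter fun d : U × U => sl2Act g d = d).card = 1 := by
  rw [Finset.card_eq_one]
  refine ⟨0, Finset.ext fun d => ?_⟩
  simp only [Finset.mem_filter, Finset.mem_univ, true_and, Finset.mem_singleton]
  refine ⟨fun h => ?_, by rintro rfl; exact map_zero _⟩
  have hd := sl2_det g
  rw [sl2Act_apply, Prod.ext_iff] at h
  obtain ⟨h1, h2⟩ := h
  have hne : 2 - (g 0 0 + g 1 1) ≠ 0 := fun h => hg (sub_eq_zero.1 h).symm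
  have e1 : (g 0 0 - 1) • d.1 + g 0 1 • d.2 = 0 := by
    simp only at h1
    rw [← sub_eq_zero] at h1
    rw [← h1]
    module
  have e2 : g 1 0 • d.1 + (g 1 1 - 1) • d.2 = 0 := by
    simp only at h2
    rw [← sub_eq_zero] at h2
    rw [← h2]
    module
  have e3 : (2 - (g 0 0 + g 1 1)) • d.1 = 0 := by
    have : (2 - (g 0 0 + g 1 1)) = (g 1 1 - 1) * (g 0 0 - 1) - g 0 1 * g 1 0 := by
      linear_combination -hd
    rw [this]
    have h3 : ((g 1 1 - 1) * (g 0 0 - 1) - g 0 1 * g 1 0) • d.1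
        = (g 1 1 - 1) • ((g 0 0 - 1) • d.1 + g 0 1 • d.2)
          - g 0 1 • (g 1 0 • d.1 + (g 1 1 - 1) • d.2) := by module
    rw [h3, e1, e2, smul_zero, smul_zero, sub_zero]
  have e4 : (2 - (g 0 0 + g 1 1)) • d.2 = 0 := by
    have : (2 - (g 0 0 + g 1 1)) = (g 0 0 - 1) * (g 1 1 - 1) - g 1 0 * g 0 1 := by
      linear_combination -hd
    rw [this]
    have h3 : ((g 0 0 - 1) * (g 1 1 - 1) - g 1 0 * g 0 1) • d.2
        = (g 0 0 - 1) • (g 1 0 • d.1 + (g 1 1 - 1) • d.2)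
          - g 1 0 • ((g 0 0 - 1) • d.1 + g 0 1 • d.2) := by module
    rw [h3, e1, e2, smul_zero, smul_zero, sub_zero]
  exact Prod.ext ((smul_eq_zero.1 e3).resolve_left hne) ((smul_eq_zero.1 e4).resolve_left hne)

/-- With `N = |U|`, the identity contributes `N²`, the `q² - 1` other elements of trace `2`
contribute `N` each, and all remaining elements contribute `1`. -/
theorem sum_card_fixed [Fintype (SL2 F)] :
    (∑ g : SL2 F, ((Finset.univ.filter fun d : U × U => sl2Act g d = d).card : ℤ))
      = (Fintype.card U : ℤ) ^ 2 + (Fintype.card F ^ 2 - 1) * Fintype.card U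
        + (Fintype.card F ^ 3 - Fintype.card F - Fintype.card F ^ 2) := by
  classical
  rw [← Finset.sum_filter_add_sum_filter_not _ (fun g : SL2 F => g 0 0 + g 1 1 = 2)]
  have hcl : ∀ g h : SL2 F,
      ((Finset.univ.filter fun d : U × U => sl2Act (h * g * h⁻¹) d = d).card : ℤ)
        = (Finset.univ.filter fun d : U × U => sl2Act g d = d).card := by
    intro g h
    norm_cast
    refine Finset.card_bij' (fun d _ => sl2Act h⁻¹ d) (fun d _ => sl2Act h d) ?_ ?_ ?_ ?_
    · intro d hd
      simp only [Finset.mem_filter, Finset.mem_univ, true_and] at hd ⊢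
      nth_rw 2 [← hd]
      simp [map_mul]
    · intro d hd
      simp only [Finset.mem_filter, Finset.mem_univ, true_and] at hd ⊢
      simp [map_mul, hd]
    · intro d _; simp
    · intro d _; simp
  have hlow : ∑ t ∈ Finset.univ.erase (0 : F),
      ((Finset.univ.filter fun d : U × U => sl2Act (low t) d = d).card : ℤ)
        = ∑ t ∈ Finset.univ.erase (0 : F), (Fintype.card U : ℤ) :=
    Finset.sum_congr rfl fun t ht => by rw [card_fixed_low (Finset.ne_of_mem_erase ht)]
  have hoff : ∑ g ∈ Finset.univ.filter (fun g : SL2 F => ¬ (g 0 0 + g 1 1 = 2)),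
      ((Finset.univ.filter fun d : U × U => sl2Act g d = d).card : ℤ)
        = ∑ g ∈ Finset.univ.filter (fun g : SL2 F => ¬ (g 0 0 + g 1 1 = 2)), (1 : ℤ) :=
    Finset.sum_congr rfl fun g hg => by
      rw [card_fixed_of_trace (Finset.mem_filter.1 hg).2, Nat.cast_one]
  rw [sum_trace_two _ hcl, card_fixed_one, hlow, hoff]
  have h2 := Finset.card_filter_add_card_filter_not (s := (Finset.univ : Finset (SL2 F)))
    (fun g : SL2 F => g 0 0 + g 1 1 = 2)
  rw [card_trace_two, Finset.card_univ, ← Nat.card_eq_fintype_card (α := SL2 F), card_SL2] at h2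
  have hq1 : Fintype.card F ≤ Fintype.card F ^ 3 := Nat.le_self_pow (by norm_num) _
  have h3 : ((Finset.univ.filter fun g : SL2 F => ¬ (g 0 0 + g 1 1 = 2)).card : ℤ)
      = Fintype.card F ^ 3 - Fintype.card F - Fintype.card F ^ 2 := by
    have := congrArg (Nat.cast : ℕ → ℤ) h2
    push_cast [hq1] at this
    linear_combination this
  simp only [Finset.sum_const, nsmul_eq_mul, Finset.card_erase_of_mem (Finset.mem_univ (0 : F)),
    Finset.card_univ]
  rw [h3, mul_one, Nat.cast_sub Fintype.card_pos]
  push_cast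
  ring

end Act

end SL2

/-! ### The anisotropic plane -/

section Plane

variable {F : Type u} [Field F] {ε : F}

theorem betaForm_apply (ε : F) (x y : Fin 2 → F) :
    betaForm ε x y = x 0 * y 0 - ε * x 1 * y 1 := by
  simp [betaForm, Matrix.toBilin'_apply, Fin.sum_univ_two]
  ring

/-- The norm form of the plane. -/
def nrm (ε : F) (z : Fin 2 → F) : F := z 0 * z 0 - ε * z 1 * z 1

theorem betaForm_self (ε : F) (x : Fin 2 → F) : betaForm ε x x = nrm ε x := betaForm_apply ε x x

theorem betaForm_symm (ε : F) (x y : Fin 2 → F) : betaForm ε x y = betaForm ε y x := by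
  rw [betaForm_apply, betaForm_apply]; ring

theorem eps_ne_zero (hε : ¬ IsSquare ε) : ε ≠ 0 := by
  rintro rfl
  exact hε ⟨0, by simp⟩

theorem nrm_eq_zero (hε : ¬ IsSquare ε) {z : Fin 2 → F} (hz : nrm ε z = 0) : z = 0 := by
  have h1 : z 1 = 0 := by
    by_contra h1
    apply hε
    refine ⟨z 0 / z 1, ?_⟩
    rw [nrm] at hz
    field_simp
    linear_combination -hz
  have h0 : z 0 = 0 := by
    rw [nrm, h1, mul_zero, sub_zero] at hz
    exact mul_self_eq_zero.1 hz
  ext i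
  fin_cases i <;> assumption

/-- Multiplication by `z` in the quadratic algebra `F + √ε F`. -/
def mulU (ε : F) (z : Fin 2 → F) : (Fin 2 → F) →ₗ[F] (Fin 2 → F) where
  toFun u := ![z 0 * u 0 + ε * z 1 * u 1, z 1 * u 0 + z 0 * u 1]
  map_add' u v := by ext i; fin_cases i <;> simp <;> ring
  map_smul' c u := by ext i; fin_cases i <;> simp <;> ring

@[simp] theorem mulU_zero (z u : Fin 2 → F) : mulU ε z u 0 = z 0 * u 0 + ε * z 1 * u 1 := rfl
@[simp] theorem mulU_one (z u : Fin 2 → F) : mulU ε z u 1 = z 1 * u 0 + z 0 * u 1 := rfl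

theorem plane_ext {u v : Fin 2 → F} (h0 : u 0 = v 0) (h1 : u 1 = v 1) : u = v := by
  ext i
  fin_cases i <;> assumption

theorem betaForm_mulU (z u v : Fin 2 → F) :
    betaForm ε (mulU ε z u) (mulU ε z v) = nrm ε z * betaForm ε u v := by
  simp only [betaForm_apply, mulU_zero, mulU_one, nrm]; ring

theorem nrm_mulU (z u : Fin 2 → F) : nrm ε (mulU ε z u) = nrm ε z * nrm ε u := by
  rw [← betaForm_self, betaForm_mulU, betaForm_self]

/-- Multiplication by a nonzero element, as an automorphism. -/
def mulEquiv (hε : ¬ IsSquare ε) (z : Fin 2 → F) (hz : z ≠ 0) : (Fin 2 → F) ≃ₗ[F] (Fin 2 → F) :=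
  LinearEquiv.ofLinearMap (mulU ε z) ((nrm ε z)⁻¹ • mulU ε ![z 0, -z 1])
    (by
      have h : nrm ε z ≠ 0 := fun h => hz (nrm_eq_zero hε h)
      refine LinearMap.ext fun u => plane_ext ?_ ?_ <;> simp <;> field_simp <;> rw [nrm] <;> ring)
    (by
      have h : nrm ε z ≠ 0 := fun h => hz (nrm_eq_zero hε h)
      refine LinearMap.ext fun u => plane_ext ?_ ?_ <;> simp <;> field_simp <;> rw [nrm] <;> ring)

theorem mulEquiv_apply (hε : ¬ IsSquare ε) (z : Fin 2 → F) (hz : z ≠ 0) (u : Fin 2 → F) :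
    mulEquiv hε z hz u = mulU ε z u := rfl

theorem mulU_e0 (z : Fin 2 → F) : mulU ε z ![1, 0] = z := plane_ext (by simp) (by simp)

theorem ne_zero_of_nrm {z : Fin 2 → F} {s : F} (hs : s ≠ 0) (hz : nrm ε z = s) : z ≠ 0 := by
  rintro rfl
  apply hs
  rw [← hz]
  simp [nrm]

/-! ### Rotations and reflections of the plane -/

section Ortho

theorem detO_eq (a : Ortho ε) :
    (detO ε a : F) = (a : (Fin 2 → F) ≃ₗ[F] (Fin 2 → F)) ![1, 0] 0 * (a : (Fin 2 → F) ≃ₗ[F] (Fin 2 → F)) ![0, 1] 1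
      - (a : (Fin 2 → F) ≃ₗ[F] (Fin 2 → F)) ![0, 1] 0 * (a : (Fin 2 → F) ≃ₗ[F] (Fin 2 → F)) ![1, 0] 1 := by
  have h : (detO ε a : F) = LinearMap.det
      ((a : (Fin 2 → F) ≃ₗ[F] (Fin 2 → F)) : (Fin 2 → F) →ₗ[F] (Fin 2 → F)) :=
    LinearEquiv.coe_det _
  rw [h, ← LinearMap.det_toMatrix', Matrix.det_fin_two]
  have e0 : (Pi.single 0 1 : Fin 2 → F) = ![1, 0] := plane_ext (by simp) (by simp)
  have e1 : (Pi.single 1 1 : Fin 2 → F) = ![0, 1] := plane_ext (by simp) (by simp)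
  simp [LinearMap.toMatrix'_apply, e0, e1]

theorem plane_decomp (u : Fin 2 → F) : u = u 0 • ![1, 0] + u 1 • ![0, 1] :=
  plane_ext (by simp) (by simp)

/-- The image `z` of the first basis vector has norm `1`. Orthogonality then makes the image of the
second vector the determinant times that of multiplication by `z`. -/
theorem ortho_form (hε : ¬ IsSquare ε) (a : Ortho ε) :
    ∃ (z : Fin 2 → F) (D : F), nrm ε z = 1 ∧ D * D = 1 ∧ (detO ε a : F) = D ∧
      ∀ u, (a : (Fin 2 → F) ≃ₗ[F] (Fin 2 → F)) u
        = ![z 0 * u 0 + ε * z 1 * D * u 1, z 1 * u 0 + z 0 * D * u 1] := by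
  have hε0 := eps_ne_zero hε
  set A := (a : (Fin 2 → F) ≃ₗ[F] (Fin 2 → F)) with hA
  have h00 := a.2 ![1, 0] ![1, 0]
  have h01 := a.2 ![1, 0] ![0, 1]
  have h11 := a.2 ![0, 1] ![0, 1]
  have hdet := detO_eq a
  rw [← hA] at h00 h01 h11 hdet
  simp only [betaForm_apply] at h00 h01 h11
  set p := A ![1, 0] 0
  set r := A ![1, 0] 1
  set s := A ![0, 1] 0
  set t := A ![0, 1] 1
  simp at h00 h01 h11
  have hs : s = ε * r * (p * t - s * r) := by linear_combination (-s) * h00 + p * h01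
  have ht : t = p * (p * t - s * r) := by linear_combination (-t) * h00 + r * h01
  refine ⟨A ![1, 0], p * t - s * r, ?_, ?_, ?_, fun u => ?_⟩
  · exact h00
  · apply mul_left_cancel₀ hε0
    linear_combination (-1) * h11 - (s * s - ε * t * t) * h00 + (p * s - ε * r * t) * h01
  · rw [hdet]
  · conv_lhs => rw [plane_decomp u, map_add, map_smul, map_smul]
    refine plane_ext ?_ ?_
    · change u 0 * p + u 1 * s = p * u 0 + ε * r * (p * t - s * r) * u 1
      rw [← hs]; ring
    · change u 0 * r + u 1 * t = r * u 0 + p * (p * t - s * r) * u 1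
      rw [← ht]; ring

/-- The isometry `u ↦ z (u₀ ± √ε u₁)`. -/
def orthoOf (hε : ¬ IsSquare ε) (z : Fin 2 → F) (hz : nrm ε z = 1) : Ortho ε :=
  ⟨mulEquiv hε z (ne_zero_of_nrm one_ne_zero hz), fun x y => by
    change betaForm ε (mulU ε z x) (mulU ε z y) = _
    rw [betaForm_mulU, hz, one_mul]⟩

theorem orthoOf_apply (hε : ¬ IsSquare ε) (z : Fin 2 → F) (hz : nrm ε z = 1) (u : Fin 2 → F) :
    (orthoOf hε z hz : (Fin 2 → F) ≃ₗ[F] (Fin 2 → F)) u = mulU ε z u := rfl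

/-- The reflection `(x, y) ↦ (x, -y)`. -/
def conjO (ε : F) : Ortho ε :=
  ⟨LinearEquiv.ofInvolutive
    { toFun := fun u => ![u 0, -u 1]
      map_add' := fun u v => by ext i; fin_cases i <;> simp; ring
      map_smul' := fun c u => by ext i; fin_cases i <;> simp }
    (fun u => plane_ext (by simp) (by simp)), fun x y => by
    change betaForm ε ![x 0, -x 1] ![y 0, -y 1] = _
    simp [betaForm_apply]⟩

theorem conjO_apply (u : Fin 2 → F) :
    (conjO ε : (Fin 2 → F) ≃ₗ[F] (Fin 2 → F)) u = ![u 0, -u 1] := rfl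

theorem mem_SOrtho_iff (a : Ortho ε) : a ∈ SOrtho ε ↔ (detO ε a : F) = 1 := by
  rw [SOrtho, MonoidHom.mem_ker, Units.ext_iff, Units.val_one]

theorem orthoOf_mem (hε : ¬ IsSquare ε) (z : Fin 2 → F) (hz : nrm ε z = 1) :
    orthoOf hε z hz ∈ SOrtho ε := by
  rw [mem_SOrtho_iff, detO_eq, orthoOf_apply, orthoOf_apply]
  rw [nrm] at hz
  simp
  linear_combination hz

theorem conjO_notMem (h2 : (2 : F) ≠ 0) : conjO ε ∉ SOrtho ε := by
  rw [mem_SOrtho_iff, detO_eq, conjO_apply, conjO_apply]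
  simp
  intro h
  apply h2
  linear_combination -h

theorem ortho_ext {a b : Ortho ε}
    (h : ∀ u, (a : (Fin 2 → F) ≃ₗ[F] (Fin 2 → F)) u = (b : (Fin 2 → F) ≃ₗ[F] (Fin 2 → F)) u) :
    a = b :=
  Subtype.ext (LinearEquiv.ext h)

theorem exists_orthoOf (hε : ¬ IsSquare ε) {a : Ortho ε} (ha : a ∈ SOrtho ε) :
    ∃ z hz, a = orthoOf hε z hz := by
  obtain ⟨z, D, hz, -, hD, h⟩ := ortho_form hε a
  rw [mem_SOrtho_iff, hD] at ha
  refine ⟨z, hz, ortho_ext fun u => ?_⟩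
  rw [h, orthoOf_apply, ha]
  exact plane_ext (by simp) (by simp)

theorem det_notMem (hε : ¬ IsSquare ε) {a : Ortho ε} (ha : a ∉ SOrtho ε) :
    (detO ε a : F) = -1 := by
  obtain ⟨z, D, hz, hDD, hD, h⟩ := ortho_form hε a
  rw [mem_SOrtho_iff, hD] at ha
  rw [hD]
  rcases mul_self_eq_one_iff.1 hDD with h1 | h1
  · exact absurd h1 ha
  · exact h1

theorem mul_self_notMem (hε : ¬ IsSquare ε) {a : Ortho ε} (ha : a ∉ SOrtho ε) : a * a = 1 := by
  obtain ⟨z, D, hz, -, hD, h⟩ := ortho_form hε a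
  rw [det_notMem hε ha] at hD
  refine ortho_ext fun u => ?_
  change (a : (Fin 2 → F) ≃ₗ[F] (Fin 2 → F)) ((a : (Fin 2 → F) ≃ₗ[F] (Fin 2 → F)) u) = u
  rw [h, h, ← hD]
  rw [nrm] at hz
  refine plane_ext ?_ ?_ <;> simp
  · linear_combination u 0 * hz
  · linear_combination u 1 * hz

theorem so_comm (hε : ¬ IsSquare ε) {a b : Ortho ε} (ha : a ∈ SOrtho ε) (hb : b ∈ SOrtho ε) :
    a * b = b * a := by
  obtain ⟨z, hz, rfl⟩ := exists_orthoOf hε ha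
  obtain ⟨w, hw, rfl⟩ := exists_orthoOf hε hb
  refine ortho_ext fun u => ?_
  change mulU ε z (mulU ε w u) = mulU ε w (mulU ε z u)
  refine plane_ext ?_ ?_ <;> simp <;> ring

theorem mul_mem_of_notMem (hε : ¬ IsSquare ε) {a b : Ortho ε} (ha : a ∉ SOrtho ε)
    (hb : b ∉ SOrtho ε) : a * b ∈ SOrtho ε := by
  rw [mem_SOrtho_iff, map_mul, Units.val_mul, det_notMem hε ha, det_notMem hε hb]
  ring

/-- `r * a` is again a reflection, so both `r` and `r * a` are involutions. -/
theorem refl_conj (hε : ¬ IsSquare ε) {a r : Ortho ε} (ha : a ∈ SOrtho ε) (hr : r ∉ SOrtho ε) :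
    r * a = a⁻¹ * r := by
  have h1 : r * a ∉ SOrtho ε := fun h => hr (((SOrtho ε).mul_mem_cancel_right ha).1 h)
  have h2 := mul_self_notMem hε h1
  have h3 := mul_self_notMem hε hr
  have h4 : r⁻¹ = r := inv_eq_of_mul_eq_one_right h3
  have h5 : r * a = (r * a)⁻¹ := (inv_eq_of_mul_eq_one_right h2).symm
  rw [h5, mul_inv_rev, h4]

/-- A reflection is given by the usual formula for some vector. -/
theorem exists_refl_vector (hε : ¬ IsSquare ε) {r : Ortho ε} (hr : r ∉ SOrtho ε) :
    ∃ u₀ : Fin 2 → F, u₀ ≠ 0 ∧ ∀ u, nrm ε u₀ • (r : (Fin 2 → F) ≃ₗ[F] (Fin 2 → F)) u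
      = nrm ε u₀ • u - (2 * betaForm ε u u₀) • u₀ := by
  obtain ⟨z, D, hz, -, hD, h⟩ := ortho_form hε r
  rw [det_notMem hε hr] at hD
  -- The two conditions say that `r u₀ = -u₀`. The vector `(ε z₁, z₀ + 1)` satisfies them and
  -- vanishes only for `z = -1`, where the first basis vector serves instead.
  have key : ∀ u₀ : Fin 2 → F, (z 0 + 1) * u₀ 0 = ε * z 1 * u₀ 1 →
      z 1 * u₀ 0 = (z 0 - 1) * u₀ 1 → ∀ u, nrm ε u₀ • (r : (Fin 2 → F) ≃ₗ[F] (Fin 2 → F)) u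
      = nrm ε u₀ • u - (2 * betaForm ε u u₀) • u₀ := by
    intro u₀ h1 h2 u
    rw [h, ← hD]
    refine plane_ext ?_ ?_ <;> simp [betaForm_apply, nrm]
    · linear_combination (u 0 * u₀ 0 - ε * u₀ 1 * u 1) * h1 + (ε * u₀ 1 * u 0 - ε * u 1 * u₀ 0) * h2
    · linear_combination (u 0 * u₀ 1 - u 1 * u₀ 0) * h1 + (u 0 * u₀ 0 - ε * u₀ 1 * u 1) * h2
  rw [nrm] at hz
  by_cases hc : z 1 = 0 ∧ z 0 + 1 = 0
  · refine ⟨![1, 0], fun h0 => one_ne_zero (congrFun h0 0), key _ ?_ ?_⟩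
    · simp [hc.1, hc.2]
    · simp [hc.1]
  · refine ⟨![ε * z 1, z 0 + 1], fun h0 => hc ?_, key _ ?_ ?_⟩
    · have e0 := congrFun h0 0
      have e1 := congrFun h0 1
      simp [eps_ne_zero hε] at e0 e1
      exact ⟨e0, e1⟩
    · simp; ring
    · simp; linear_combination -hz

end Ortho

/-! ### Cardinalities and fixed points in the plane, and a Gauss sum -/

section Count

variable [Fintype F] [DecidableEq F]

instance : Finite (Ortho ε) := by
  have : Finite ((Fin 2 → F) ≃ₗ[F] (Fin 2 → F)) := DFunLike.finite _
  infer_instance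

instance : Fintype (Ortho ε) := Fintype.ofFinite _

instance : Fintype (SOrtho ε) := Fintype.ofFinite _

instance : Fintype (SL2 F) := Fintype.ofFinite _

omit [DecidableEq F] in
theorem card_SL2_cast : (Fintype.card (SL2 F) : ℂ) = (Fintype.card F : ℂ) ^ 3 - Fintype.card F := by
  have h : Fintype.card F ≤ Fintype.card F ^ 3 := Nat.le_self_pow (by norm_num) _
  rw [← Nat.card_eq_fintype_card, card_SL2, Nat.cast_sub h, Nat.cast_pow]

theorem card_odd (h2 : (2 : F) ≠ 0) : Fintype.card F % 2 = 1 := by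
  refine FiniteField.odd_card_of_char_ne_two fun h => h2 ?_
  have := ringChar.Nat.cast_ringChar (R := F)
  rw [h] at this
  exact_mod_cast this

theorem three_le_card (h2 : (2 : F) ≠ 0) : 3 ≤ Fintype.card F := by
  have h1 := card_odd h2
  have h3 : 1 < Fintype.card F := Fintype.one_lt_card
  omega

theorem exists_nrm_eq (hε : ¬ IsSquare ε) (h2 : (2 : F) ≠ 0) (s : F) : ∃ z, nrm ε z = s := by
  have hε0 := eps_ne_zero hε
  obtain ⟨x, y, h⟩ := FiniteField.exists_root_sum_quadratic
    (f := (Polynomial.X ^ 2 : Polynomial F))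
    (g := Polynomial.C (-ε) * Polynomial.X ^ 2 + Polynomial.C 0 * Polynomial.X + Polynomial.C (-s))
    (Polynomial.degree_X_pow 2) (Polynomial.degree_quadratic (neg_ne_zero.2 hε0)) (card_odd h2)
  refine ⟨![x, y], ?_⟩
  simp at h
  simp [nrm]
  linear_combination h

theorem card_nrm_eq_aux (hε : ¬ IsSquare ε) (h2 : (2 : F) ≠ 0) {s : F} (hs : s ≠ 0) :
    (Finset.univ.filter fun z => nrm ε z = s).card
      = (Finset.univ.filter fun z => nrm ε z = 1).card := by
  obtain ⟨w, hw⟩ := exists_nrm_eq hε h2 s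
  have hw0 : w ≠ 0 := ne_zero_of_nrm hs hw
  symm
  refine Finset.card_bij' (fun z _ => mulEquiv hε w hw0 z) (fun z _ => (mulEquiv hε w hw0).symm z)
    ?_ ?_ ?_ ?_
  · intro z hz
    simp only [Finset.mem_filter, Finset.mem_univ, true_and] at hz ⊢
    rw [mulEquiv_apply, nrm_mulU, hz, hw, mul_one]
  · intro z hz
    simp only [Finset.mem_filter, Finset.mem_univ, true_and] at hz ⊢
    have h1 : nrm ε (mulEquiv hε w hw0 ((mulEquiv hε w hw0).symm z)) = s := by
      rw [LinearEquiv.apply_symm_apply, hz]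
    rw [mulEquiv_apply, nrm_mulU, hw] at h1
    exact mul_left_cancel₀ hs (by rw [h1, mul_one])
  · intro z _; simp
  · intro z _; simp

/-- Multiplication by an element of norm `s` carries norm `1` to norm `s`, so the `q - 1` nonzero
fibres of the norm have equal size and share the `q² - 1` nonzero vectors. -/
theorem card_nrm_eq (hε : ¬ IsSquare ε) (h2 : (2 : F) ≠ 0) {s : F} (hs : s ≠ 0) :
    (Finset.univ.filter fun z => nrm ε z = s).card = Fintype.card F + 1 := by
  rw [card_nrm_eq_aux hε h2 hs]
  set c := (Finset.univ.filter fun z => nrm ε z = 1).card with hc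
  have h1 : (Finset.univ : Finset (Fin 2 → F)).card
      = ∑ s : F, (Finset.univ.filter fun z => nrm ε z = s).card :=
    Finset.card_eq_sum_card_fiberwise fun _ _ => Finset.mem_univ _
  rw [← Finset.add_sum_erase _ _ (Finset.mem_univ (0 : F)),
    Finset.sum_congr rfl fun s hs => card_nrm_eq_aux hε h2 (Finset.ne_of_mem_erase hs),
    Finset.sum_const, Finset.card_erase_of_mem (Finset.mem_univ _), ← hc] at h1
  have h0 : (Finset.univ.filter fun z => nrm ε z = 0) = {0} := by
    ext z
    simp only [Finset.mem_filter, Finset.mem_univ, true_and, Finset.mem_singleton]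
    exact ⟨nrm_eq_zero hε, by rintro rfl; simp [nrm]⟩
  rw [h0, Finset.card_singleton] at h1
  simp only [Finset.card_univ, Fintype.card_fun, Fintype.card_fin, smul_eq_mul] at h1
  have hq : 1 < Fintype.card F := Fintype.one_lt_card
  obtain ⟨n, hn⟩ : ∃ n, Fintype.card F = n + 2 := ⟨Fintype.card F - 2, by omega⟩
  rw [hn] at h1 ⊢
  have h3 : (n + 1) * c = (n + 1) * (n + 2 + 1) := by
    have : n + 2 - 1 = n + 1 := by omega
    rw [this] at h1
    nlinarith
  exact Nat.eq_of_mul_eq_mul_left (by omega) h3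

theorem card_SOrtho (hε : ¬ IsSquare ε) (h2 : (2 : F) ≠ 0) :
    Fintype.card (SOrtho ε) = Fintype.card F + 1 := by
  rw [← card_nrm_eq hε h2 one_ne_zero, ← Fintype.card_subtype]
  symm
  refine Fintype.card_of_bijective
    (f := fun z : {z // nrm ε z = 1} => (⟨orthoOf hε z.1 z.2, orthoOf_mem hε z.1 z.2⟩ : SOrtho ε))
    ⟨fun z w h => ?_, fun a => ?_⟩
  · have h1 : (orthoOf hε z.1 z.2 : (Fin 2 → F) ≃ₗ[F] (Fin 2 → F)) ![1, 0]
        = (orthoOf hε w.1 w.2 : (Fin 2 → F) ≃ₗ[F] (Fin 2 → F)) ![1, 0] := by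
      have h' : orthoOf hε z.1 z.2 = orthoOf hε w.1 w.2 := congrArg Subtype.val h
      rw [h']
    rw [orthoOf_apply, orthoOf_apply, mulU_e0, mulU_e0] at h1
    exact Subtype.ext h1
  · obtain ⟨z, hz, h⟩ := exists_orthoOf hε a.2
    exact ⟨⟨z, hz⟩, Subtype.ext h.symm⟩

theorem card_Ortho (hε : ¬ IsSquare ε) (h2 : (2 : F) ≠ 0) :
    Fintype.card (Ortho ε) = 2 * (Fintype.card F + 1) := by
  have h1 : (SOrtho ε).index = 2 := by
    rw [Subgroup.index_eq_two_iff]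
    refine ⟨conjO ε, fun a => ?_⟩
    by_cases ha : a ∈ SOrtho ε
    · exact Or.inr ⟨ha, fun h => conjO_notMem h2 (((SOrtho ε).mul_mem_cancel_left ha).1 h)⟩
    · exact Or.inl ⟨mul_mem_of_notMem hε ha (conjO_notMem h2), ha⟩
  have h3 := (SOrtho ε).card_mul_index
  rw [h1, Nat.card_eq_fintype_card, Nat.card_eq_fintype_card, card_SOrtho hε h2] at h3
  rw [← h3, mul_comm]

/-- A fixed vector is killed by multiplication by `z - 1`, whose norm is nonzero unless the rotation
is the identity. -/
theorem card_fixed_rot (hε : ¬ IsSquare ε) {a : Ortho ε} (ha : a ∈ SOrtho ε) (ha1 : a ≠ 1) :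
    (Finset.univ.filter fun u => (a : (Fin 2 → F) ≃ₗ[F] (Fin 2 → F)) u = u).card = 1 := by
  rw [Finset.card_eq_one]
  refine ⟨0, Finset.ext fun u => ?_⟩
  simp only [Finset.mem_filter, Finset.mem_univ, true_and, Finset.mem_singleton]
  refine ⟨fun h => ?_, by rintro rfl; exact map_zero _⟩
  obtain ⟨z, hz, rfl⟩ := exists_orthoOf hε ha
  rw [orthoOf_apply] at h
  have h1 : mulU ε (z - ![1, 0]) u = 0 := by
    have e0 := congrFun h 0
    have e1 := congrFun h 1
    simp at e0 e1
    refine plane_ext ?_ ?_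
    · change (z 0 - 1) * u 0 + ε * (z 1 - 0) * u 1 = 0
      linear_combination e0
    · change (z 1 - 0) * u 0 + (z 0 - 1) * u 1 = 0
      linear_combination e1
  have h3 := nrm_mulU (ε := ε) (z - ![1, 0]) u
  rw [h1] at h3
  have h4 : nrm ε (0 : Fin 2 → F) = 0 := by simp [nrm]
  rw [h4] at h3
  rcases mul_eq_zero.1 h3.symm with h5 | h5
  · exfalso
    apply ha1
    have h6 := sub_eq_zero.1 (nrm_eq_zero hε h5)
    refine ortho_ext fun u => ?_
    rw [orthoOf_apply, h6]
    exact plane_ext (by simp) (by simp)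
  · exact nrm_eq_zero hε h5

theorem card_fixed_refl (hε : ¬ IsSquare ε) (h2 : (2 : F) ≠ 0) {r : Ortho ε} (hr : r ∉ SOrtho ε) :
    (Finset.univ.filter fun u => (r : (Fin 2 → F) ≃ₗ[F] (Fin 2 → F)) u = u).card
      = Fintype.card F := by
  obtain ⟨u₀, hu₀, h⟩ := exists_refl_vector hε hr
  have hn : nrm ε u₀ ≠ 0 := fun h => hu₀ (nrm_eq_zero hε h)
  have hfix : ∀ u, (r : (Fin 2 → F) ≃ₗ[F] (Fin 2 → F)) u = u ↔ betaForm ε u u₀ = 0 := by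
    intro u
    have h1 := h u
    constructor
    · intro h3
      rw [h3] at h1
      have h4 : (2 * betaForm ε u u₀) • u₀ = 0 := by
        have := sub_eq_self.1 h1.symm
        exact this
      exact (mul_eq_zero.1 ((smul_eq_zero.1 h4).resolve_right hu₀)).resolve_left h2
    · intro h3
      rw [h3, mul_zero, zero_smul, sub_zero] at h1
      exact smul_right_injective _ hn h1
  rw [← Finset.card_univ]
  symm
  -- This vector spans the line orthogonal to `u₀`, which is the fixed line of the reflection.
  have hv : (![ε * u₀ 1, u₀ 0] : Fin 2 → F) ≠ 0 := by
    intro h0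
    have e0 := congrFun h0 0
    have e1 := congrFun h0 1
    simp [eps_ne_zero hε] at e0 e1
    exact hu₀ (plane_ext e1 e0)
  refine Finset.card_bij (fun c _ => c • ![ε * u₀ 1, u₀ 0]) ?_ ?_ ?_
  · intro c _
    simp only [Finset.mem_filter, Finset.mem_univ, true_and]
    rw [hfix]
    simp [betaForm_apply]
    ring
  · intro c _ d _ hcd
    exact smul_left_injective _ hv hcd
  · intro u hu
    simp only [Finset.mem_filter, Finset.mem_univ, true_and] at hu
    rw [hfix, betaForm_apply] at hu
    rw [nrm] at hn
    refine ⟨(u 1 * u₀ 0 - u 0 * u₀ 1) / (u₀ 0 * u₀ 0 - ε * u₀ 1 * u₀ 1), Finset.mem_univ _, ?_⟩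
    refine plane_ext ?_ ?_ <;> simp <;> rw [div_mul_eq_mul_div, div_eq_iff hn]
    · linear_combination (-u₀ 0) * hu
    · linear_combination (-u₀ 1) * hu

/-- The origin contributes `1` and every nonzero value of the norm is taken `q + 1` times, so the
sum is `1 + (q + 1)(-1)`. -/
theorem sum_psi_nrm (hε : ¬ IsSquare ε) (h2 : (2 : F) ≠ 0) {ψ : AddChar F ℂ} (hψ : ψ ≠ 1) {c : F}
    (hc : c ≠ 0) : ∑ u, ψ (c * nrm ε u) = -(Fintype.card F : ℂ) := by
  have h1 : ∑ u, ψ (c * nrm ε u)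
      = ∑ s : F, ∑ u ∈ Finset.univ.filter (fun z => nrm ε z = s), ψ (c * s) := by
    rw [← Finset.sum_fiberwise Finset.univ (fun u => nrm ε u)]
    refine Finset.sum_congr rfl fun s _ => Finset.sum_congr rfl fun u hu => ?_
    rw [(Finset.mem_filter.1 hu).2]
  have h3 : ∑ s : F, ψ (c * s) = 0 := by
    have h4 : AddChar.mulShift ψ c ≠ 1 := by
      intro h5
      apply hψ
      ext t
      have := DFunLike.congr_fun h5 (c⁻¹ * t)
      rwa [AddChar.mulShift_apply, mul_inv_cancel_left₀ hc] at this
    exact AddChar.sum_eq_zero_of_ne_one h4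
  have h0 : (Finset.univ.filter fun z => nrm ε z = 0) = {0} := by
    ext z
    simp only [Finset.mem_filter, Finset.mem_univ, true_and, Finset.mem_singleton]
    exact ⟨nrm_eq_zero hε, by rintro rfl; simp [nrm]⟩
  rw [h1, ← Finset.add_sum_erase _ _ (Finset.mem_univ (0 : F)), h0]
  rw [← Finset.add_sum_erase _ _ (Finset.mem_univ (0 : F)), mul_zero, AddChar.map_zero_eq_one] at h3
  have h5 : ∀ s ∈ Finset.univ.erase (0 : F),
      ∑ u ∈ Finset.univ.filter (fun z => nrm ε z = s), ψ (c * s)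
        = (Fintype.card F + 1) * ψ (c * s) := fun s hs => by
    rw [Finset.sum_const, card_nrm_eq hε h2 (Finset.ne_of_mem_erase hs), nsmul_eq_mul]
    push_cast
    rfl
  rw [Finset.sum_congr rfl h5, ← Finset.mul_sum]
  rw [Finset.sum_singleton, mul_zero, AddChar.map_zero_eq_one]
  linear_combination (Fintype.card F + 1 : ℂ) * h3

end Count

end Plane

/-! ### The Schrödinger model of the oscillator representation -/

section Transport

variable {F : Type*} [Field F] {W W' : Type*} [AddCommGroup W] [Module F W]
  [AddCommGroup W'] [Module F W']

/-- An isometry of spaces induces a homomorphism of isometry groups. -/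
def isoTransport {B : LinearMap.BilinForm F W} {B' : LinearMap.BilinForm F W'} (e : W ≃ₗ[F] W')
    (he : ∀ x y, B' (e x) (e y) = B x y) : isometryGroup B →* isometryGroup B' where
  toFun g := ⟨e.symm ≪≫ₗ (g : W ≃ₗ[F] W) ≪≫ₗ e, fun x y => by
    change B' (e ((g : W ≃ₗ[F] W) (e.symm x))) (e ((g : W ≃ₗ[F] W) (e.symm y))) = B' x y
    rw [he, g.2, ← he, e.apply_symm_apply, e.apply_symm_apply]⟩
  map_one' := Subtype.ext (LinearEquiv.ext fun x => e.apply_symm_apply x)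
  map_mul' g h := Subtype.ext (LinearEquiv.ext fun x => by
    change e ((g : W ≃ₗ[F] W) ((h : W ≃ₗ[F] W) (e.symm x)))
      = e ((g : W ≃ₗ[F] W) (e.symm (e ((h : W ≃ₗ[F] W) (e.symm x)))))
    rw [e.symm_apply_apply])

theorem isoTransport_apply {B : LinearMap.BilinForm F W} {B' : LinearMap.BilinForm F W'}
    (e : W ≃ₗ[F] W') (he : ∀ x y, B' (e x) (e y) = B x y) (g : isometryGroup B) (x : W') :
    (isoTransport e he g : W' ≃ₗ[F] W') x = e ((g : W ≃ₗ[F] W) (e.symm x)) := rfl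

variable {Γ E E' : Type*} [Group Γ] [AddCommGroup E] [Module ℂ E] [AddCommGroup E'] [Module ℂ E']

/-- Transport of a representation along a linear equivalence. -/
def conjRep (A : E ≃ₗ[ℂ] E') (ρ : Representation ℂ Γ E) : Representation ℂ Γ E' :=
  (A.conjRingEquiv : Module.End ℂ E →* Module.End ℂ E').comp ρ

theorem conjRep_apply (A : E ≃ₗ[ℂ] E') (ρ : Representation ℂ Γ E) (g : Γ) (x : E') :
    conjRep A ρ g x = A (ρ g (A.symm x)) := rfl

/-- A representation is equivalent to its transport. -/
def conjRepEquiv (A : E ≃ₗ[ℂ] E') (ρ : Representation ℂ Γ E) :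
    Representation.Equiv ρ (conjRep A ρ) :=
  Representation.Equiv.mk A fun g => LinearMap.ext fun x => by
    change A (ρ g x) = A (ρ g (A.symm (A x)))
    rw [A.symm_apply_apply]

end Transport

/-! ### Identification of `U ⊗ V` with `U × U` and realisation in the Schrödinger model -/

section Pairs

variable {F : Type u} [Field F] {ε : F} {ψ : AddChar F ℂ}

/-- The group of isometries of `U × U`. -/
abbrev PairGroup (ε : F) := isometryGroup (sympPair (betaForm ε))

/-- The identification of `U × U` with `U ⊗ V`. -/
def pairTensor : ((Fin 2 → F) × (Fin 2 → F)) ≃ₗ[F] (Fin 2 → F) ⊗[F] (Fin 2 → F) :=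
  LinearEquiv.ofLinearMap
    (((TensorProduct.mk F (Fin 2 → F) (Fin 2 → F)).flip ![1, 0]).coprod
      ((TensorProduct.mk F (Fin 2 → F) (Fin 2 → F)).flip ![0, 1]))
    ((TensorProduct.lift ((LinearMap.lsmul F (Fin 2 → F)).comp (LinearMap.proj 0)).flip).prod
      (TensorProduct.lift ((LinearMap.lsmul F (Fin 2 → F)).comp (LinearMap.proj 1)).flip))
    (by
      refine TensorProduct.ext' fun x y => ?_
      change (y 0 • x) ⊗ₜ[F] ![1, 0] + (y 1 • x) ⊗ₜ[F] ![0, 1] = x ⊗ₜ[F] y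
      rw [TensorProduct.smul_tmul, TensorProduct.smul_tmul, ← TensorProduct.tmul_add,
        ← plane_decomp])
    (by
      refine LinearMap.ext fun d => ?_
      simp)

theorem pairTensor_apply (d : (Fin 2 → F) × (Fin 2 → F)) :
    pairTensor d = d.1 ⊗ₜ[F] ![1, 0] + d.2 ⊗ₜ[F] ![0, 1] := rfl

theorem tensorForm_pairTensor (d e : (Fin 2 → F) × (Fin 2 → F)) :
    tensorForm ε (pairTensor d) (pairTensor e) = sympPair (betaForm ε) d e := by
  simp only [pairTensor_apply, map_add, LinearMap.add_apply, tensorForm,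
    LinearMap.BilinForm.tensorDistrib_tmul, sympPair_apply, betaForm_symm ε e.1 d.2]
  simp [sympForm, Matrix.toBilin'_apply, Fin.sum_univ_two]
  ring

/-- `PairGroup` as the symplectic group of `U ⊗ V`. -/
def pairIso (ε : F) : PairGroup ε →* isometryGroup (tensorForm ε) :=
  isoTransport pairTensor tensorForm_pairTensor

/-- The action of the orthogonal group on pairs. -/
def orthoPair (ε : F) : Ortho ε →* PairGroup ε where
  toFun a := ⟨LinearEquiv.prodCongr (a : (Fin 2 → F) ≃ₗ[F] (Fin 2 → F)) a, fun d e => by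
    change betaForm ε ((a : (Fin 2 → F) ≃ₗ[F] (Fin 2 → F)) d.1) _
      - betaForm ε ((a : (Fin 2 → F) ≃ₗ[F] (Fin 2 → F)) e.1) _ = betaForm ε d.1 e.2 - betaForm ε e.1 d.2
    exact congrArg₂ _ (a.2 _ _) (a.2 _ _)⟩
  map_one' := rfl
  map_mul' _ _ := rfl

/-- The action of `SL₂` on pairs. -/
def sl2Pair (ε : F) : SL2 F →* PairGroup ε :=
  sl2Act.codRestrict (isometryGroup (sympPair (betaForm ε))) fun g =>
    sympPair_sl2Act (betaForm ε) (betaForm_symm ε) g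

theorem dualPairHom_fst (a : Ortho ε) : dualPairHom ε (a, 1) = pairIso ε (orthoPair ε a) := by
  refine Subtype.ext (LinearEquiv.ext fun x => ?_)
  obtain ⟨d, rfl⟩ := pairTensor.surjective x
  rw [pairIso, isoTransport_apply, LinearEquiv.symm_apply_apply]
  change TensorProduct.congr _ _ _ = pairTensor ((a : (Fin 2 → F) ≃ₗ[F] (Fin 2 → F)) d.1,
    (a : (Fin 2 → F) ≃ₗ[F] (Fin 2 → F)) d.2)
  simp only [pairTensor_apply, map_add, TensorProduct.congr_tmul, map_one, LinearEquiv.coe_one, id]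

theorem dualPairHom_snd (g : SL2 F) : dualPairHom ε (1, g) = pairIso ε (sl2Pair ε g) := by
  refine Subtype.ext (LinearEquiv.ext fun x => ?_)
  obtain ⟨d, rfl⟩ := pairTensor.surjective x
  rw [pairIso, isoTransport_apply, LinearEquiv.symm_apply_apply]
  change TensorProduct.congr ((1 : Ortho ε) : (Fin 2 → F) ≃ₗ[F] (Fin 2 → F)) _ _
    = pairTensor (sl2Act g d)
  have h0 : Matrix.SpecialLinearGroup.toLin' g ![1, 0] = g 0 0 • ![1, 0] + g 1 0 • ![0, 1] := by
    rw [Matrix.SpecialLinearGroup.toLin'_apply, Matrix.toLin'_apply]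
    refine plane_ext ?_ ?_ <;> simp [Matrix.mulVec, dotProduct, Fin.sum_univ_two]
  have h1 : Matrix.SpecialLinearGroup.toLin' g ![0, 1] = g 0 1 • ![1, 0] + g 1 1 • ![0, 1] := by
    rw [Matrix.SpecialLinearGroup.toLin'_apply, Matrix.toLin'_apply]
    refine plane_ext ?_ ?_ <;> simp [Matrix.mulVec, dotProduct, Fin.sum_univ_two]
  simp only [pairTensor_apply, map_add, TensorProduct.congr_tmul, h0, h1, sl2Act_apply,
    TensorProduct.tmul_add, TensorProduct.add_tmul, TensorProduct.tmul_smul,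
    TensorProduct.smul_tmul', OneMemClass.coe_one, LinearEquiv.coe_one, id]
  abel

theorem isSchrodingerDatum_plane (hε : ¬ IsSquare ε) (h2 : (2 : F) ≠ 0) (hψ : ψ ≠ 1) :
    IsSchrodingerDatum (betaForm ε) ψ :=
  ⟨h2, betaForm_symm ε, fun x hx => nrm_eq_zero hε (by rw [← betaForm_self, hx]), hψ⟩

variable [Fintype F]

/-- The Heisenberg operators with the central factor `ψ z` give `π`, and the parity normalisation
applied to the whole symplectic group gives `ω`. -/
theorem exists_isOscillator (h : IsSchrodingerDatum (betaForm ε) ψ) :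
    ∃ (π : Representation ℂ (Heis (tensorForm ε)) ((Fin 2 → F) → ℂ))
      (ω : Representation ℂ (isometryGroup (tensorForm ε)) ((Fin 2 → F) → ℂ)),
      IsOscillator (tensorForm ε) ψ π ω := by
  classical
  have hH := schr_isHeisenberg h
  have hsymm : ∀ x y, tensorForm ε x y = sympPair (betaForm ε) (pairTensor.symm x)
      (pairTensor.symm y) := fun x y => by
    rw [← tensorForm_pairTensor, LinearEquiv.apply_symm_apply, LinearEquiv.apply_symm_apply]
  let π : Representation ℂ (Heis (tensorForm ε)) ((Fin 2 → F) → ℂ) :=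
    { toFun := fun x => ψ x.z • schr (betaForm ε) ψ (pairTensor.symm x.w)
      map_one' := by
        simp only [Heis.one_w, Heis.one_z, map_zero, hH.zero, AddChar.map_zero_eq_one, one_smul]
      map_mul' := fun x y => by
        simp only [Heis.mul_w, Heis.mul_z, map_add]
        rw [smul_mul_smul_comm, hH.mul, smul_smul, hsymm, ← AddChar.map_add_eq_mul,
          ← AddChar.map_add_eq_mul] }
  have hπ : ∀ x z, π ⟨x, z⟩ = ψ z • schr (betaForm ε) ψ (pairTensor.symm x) := fun _ _ => rfl
  obtain ⟨ω, hω, -⟩ := exists_weil (Γ := isometryGroup (tensorForm ε))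
    (act := (isometryGroup (sympPair (betaForm ε))).subtype.comp
      (isoTransport pairTensor.symm fun x y => (hsymm x y).symm)) h
    (fun g d e => (isoTransport pairTensor.symm (fun x y => (hsymm x y).symm) g).2 d e)
  refine ⟨π, ω, ?_, fun z => ?_, fun g x z => ?_⟩
  · refine isIrreducible_of_forall fun X f hf hf0 f' => ?_
    refine eq_top_of_schr_stable h (X := X.toSubmodule) (fun d f hf => ?_) hf hf0 f'
    have h1 := X.apply_mem_toSubmodule ⟨pairTensor d, 0⟩ hf
    rw [hπ, AddChar.map_zero_eq_one, one_smul, LinearEquiv.symm_apply_apply] at h1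
    exact h1
  · rw [hπ, map_zero, hH.zero]
    rfl
  · have h1 := hω g (pairTensor.symm x)
    have h3 : ((((isometryGroup (sympPair (betaForm ε))).subtype.comp
      (isoTransport pairTensor.symm fun x y => (hsymm x y).symm)) g)) (pairTensor.symm x)
      = pairTensor.symm (g.1 x) := by
      change pairTensor.symm (g.1 (pairTensor.symm.symm (pairTensor.symm x))) = _
      rw [LinearEquiv.symm_symm, LinearEquiv.apply_symm_apply]
    rw [h3] at h1
    rw [← Module.End.mul_eq_comp, ← Module.End.mul_eq_comp, hπ, hπ, smul_mul_assoc, mul_smul_comm,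
      ← mul_assoc, h1, mul_assoc, weil_mul_inv, mul_one]

/-- Every oscillator representation is realised in the Schrödinger model. -/
theorem exists_schr_equiv (h : IsSchrodingerDatum (betaForm ε) ψ) {E : Type*} [AddCommGroup E]
    [Module ℂ E] {π : Representation ℂ (Heis (tensorForm ε)) E}
    {ω : Representation ℂ (isometryGroup (tensorForm ε)) E}
    (hω : IsOscillator (tensorForm ε) ψ π ω) :
    ∃ A : E ≃ₗ[ℂ] ((Fin 2 → F) → ℂ),
      ∀ g : PairGroup ε, IsEgorov (betaForm ε) ψ (g : _ ≃ₗ[F] _) (conjRep A ω (pairIso ε g)) := by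
  classical
  have hmul : ∀ x z, π ⟨x, z⟩ = ψ z • π ⟨x, 0⟩ := fun x z => by
    have : (⟨x, z⟩ : Heis (tensorForm ε)) = ⟨0, z⟩ * ⟨x, 0⟩ := by ext <;> simp
    rw [this, map_mul, hω.central, smul_mul_assoc]
    rfl
  have hT : IsHeisenberg (betaForm ε) ψ fun d => π ⟨pairTensor d, 0⟩ := by
    refine ⟨?_, fun d e => ?_⟩
    · rw [map_zero]
      exact map_one π
    · rw [← map_mul, ← hmul]
      congr 1
      ext
      · simp
      · simp [tensorForm_pairTensor]
  have := IsIrred.nontrivial hω.irreducible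
  obtain ⟨A, hA0, hA⟩ := exists_heisenberg_intertwiner hT (schr_isHeisenberg h)
    (linearIndependent_schr h)
  have hA' : ∀ d v, A (π ⟨pairTensor d, 0⟩ v) = schr (betaForm ε) ψ d (A v) := fun d v =>
    LinearMap.congr_fun (hA d) v
  obtain ⟨v, hv⟩ : ∃ v, A v ≠ 0 := by
    by_contra hcon
    push Not at hcon
    exact hA0 (LinearMap.ext hcon)
  have hinj : Function.Injective A := by
    rw [← LinearMap.ker_eq_bot, LinearMap.ker_eq_bot']
    intro w hw
    by_contra hw0
    let X : Subrepresentation π := ⟨LinearMap.ker A, fun x w hw => by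
      rw [LinearMap.mem_ker] at hw ⊢
      obtain ⟨d, hd⟩ := pairTensor.surjective x.w
      have hx : x = ⟨pairTensor d, x.z⟩ := by ext1 <;> simp [hd]
      rw [hx, hmul, LinearMap.smul_apply, map_smul, hA', hw, map_zero, smul_zero]⟩
    exact hv (IsIrred.mem hω.irreducible X (v := w) hw hw0 v)
  have hsurj : Function.Surjective A := by
    intro f
    refine eq_top_of_schr_stable h (X := LinearMap.range A) (fun d f hf => ?_) ⟨v, rfl⟩ hv f
    obtain ⟨w, rfl⟩ := hf
    exact ⟨_, hA' d w⟩
  have hbij : Function.Bijective A := ⟨hinj, hsurj⟩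
  refine ⟨LinearEquiv.ofBijective A hbij, fun g d => LinearMap.ext fun f => ?_⟩
  obtain ⟨w, rfl⟩ := hsurj f
  rw [Module.End.mul_apply, Module.End.mul_apply, conjRep_apply, conjRep_apply]
  have h1 : (LinearEquiv.ofBijective A hbij).symm (A w) = w :=
    LinearEquiv.symm_apply_apply (LinearEquiv.ofBijective A hbij) w
  have h3 : (LinearEquiv.ofBijective A hbij).symm (schr (betaForm ε) ψ d (A w))
      = π ⟨pairTensor d, 0⟩ w := by
    rw [← hA']
    exact LinearEquiv.symm_apply_apply (LinearEquiv.ofBijective A hbij) _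
  rw [h1, h3, LinearEquiv.ofBijective_apply, LinearEquiv.ofBijective_apply, ← hA']
  congr 1
  have h4 := LinearMap.congr_fun (hω.egorov (pairIso ε g) (pairTensor d) 0) (ω (pairIso ε g) w)
  have h5 : ω (pairIso ε g)⁻¹ (ω (pairIso ε g) w) = w := by
    rw [← Module.End.mul_apply, ← map_mul, inv_mul_cancel, map_one, Module.End.one_apply]
  rw [LinearMap.comp_apply, LinearMap.comp_apply, h5] at h4
  rw [h4, pairIso, isoTransport_apply, LinearEquiv.symm_apply_apply]

end Pairs

/-! ### Characters of the symplectic group -/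

section Transvections

variable {F : Type u} [Field F] {ε : F}

theorem pairGroup_ext {g h : PairGroup ε}
    (H : ∀ d : (Fin 2 → F) × (Fin 2 → F), g.1 d = h.1 d) : g = h :=
  Subtype.ext (LinearEquiv.ext H)

/-- The linear map `w ↦ w + t ⟨w, x⟩ x`. -/
def transvFun (ε : F) (x : (Fin 2 → F) × (Fin 2 → F)) (t : F) :
    (Fin 2 → F) × (Fin 2 → F) →ₗ[F] (Fin 2 → F) × (Fin 2 → F) :=
  LinearMap.id + t • ((sympPair (betaForm ε)).flip x).smulRight x

theorem transvFun_apply (x w : (Fin 2 → F) × (Fin 2 → F)) (t : F) :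
    transvFun ε x t w = w + (t * sympPair (betaForm ε) w x) • x := by
  simp [transvFun, smul_smul]

theorem transvFun_add (x w : (Fin 2 → F) × (Fin 2 → F)) (s t : F) :
    transvFun ε x (s + t) w = transvFun ε x s (transvFun ε x t w) := by
  have h : sympPair (betaForm ε) (transvFun ε x t w) x = sympPair (betaForm ε) w x := by
    rw [transvFun_apply, map_add, map_smul, LinearMap.add_apply, LinearMap.smul_apply,
      sympPair_self, smul_zero, add_zero]
  rw [transvFun_apply, transvFun_apply, h, transvFun_apply]
  module

theorem transvFun_zero (x w : (Fin 2 → F) × (Fin 2 → F)) : transvFun ε x 0 w = w := by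
  simp [transvFun_apply]

/-- The transvection `w ↦ w + t ⟨w, x⟩ x`. -/
def transv (ε : F) (x : (Fin 2 → F) × (Fin 2 → F)) (t : F) : PairGroup ε :=
  ⟨LinearEquiv.ofLinearMap (transvFun ε x t) (transvFun ε x (-t))
    (LinearMap.ext fun w => by
      rw [LinearMap.comp_apply, ← transvFun_add, add_neg_cancel, transvFun_zero]; rfl)
    (LinearMap.ext fun w => by
      rw [LinearMap.comp_apply, ← transvFun_add, neg_add_cancel, transvFun_zero]; rfl),
    fun d e => by
      change sympPair (betaForm ε) (transvFun ε x t d) (transvFun ε x t e) = _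
      simp only [transvFun_apply, map_add, map_smul, LinearMap.add_apply, LinearMap.smul_apply,
        sympPair_self, smul_eq_mul]
      rw [sympPair_swap _ x e]
      ring⟩

theorem transv_apply (x w : (Fin 2 → F) × (Fin 2 → F)) (t : F) :
    (transv ε x t).1 w = w + (t * sympPair (betaForm ε) w x) • x := transvFun_apply x w t

theorem transv_add (x : (Fin 2 → F) × (Fin 2 → F)) (s t : F) :
    transv ε x (s + t) = transv ε x s * transv ε x t :=
  pairGroup_ext fun w => transvFun_add x w s t

theorem mul_transv (g : PairGroup ε) (x : (Fin 2 → F) × (Fin 2 → F)) (t : F) :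
    g * transv ε x t = transv ε (g.1 x) t * g := by
  refine pairGroup_ext fun w => ?_
  change g.1 ((transv ε x t).1 w) = (transv ε (g.1 x) t).1 (g.1 w)
  rw [transv_apply, transv_apply, map_add, map_smul, g.2]

/-- Parallelogram law for `x ↦ ⟨w, x⟩ x`: the mixed terms of `x + y` and `x - y` cancel.
Orthogonality of `x` and `y` makes the product of transvections additive in these terms. -/
theorem transv_add_mul_transv_sub {x y : (Fin 2 → F) × (Fin 2 → F)}
    (hxy : sympPair (betaForm ε) x y = 0) (t : F) :
    transv ε (x + y) t * transv ε (x - y) t = transv ε x (2 * t) * transv ε y (2 * t) := by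
  have hyx : sympPair (betaForm ε) y x = 0 := by rw [sympPair_swap, hxy, neg_zero]
  refine pairGroup_ext fun w => ?_
  change (transv ε (x + y) t).1 ((transv ε (x - y) t).1 w)
    = (transv ε x (2 * t)).1 ((transv ε y (2 * t)).1 w)
  have h1 : sympPair (betaForm ε) ((transv ε (x - y) t).1 w) (x + y)
      = sympPair (betaForm ε) w x + sympPair (betaForm ε) w y := by
    simp [transv_apply, map_add, sympPair_self, hxy, hyx]
  have h3 : sympPair (betaForm ε) ((transv ε y (2 * t)).1 w) x = sympPair (betaForm ε) w x := by
    simp [transv_apply, map_add, hyx]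
  rw [transv_apply, h1, transv_apply _ (transv ε y (2 * t) |>.1 w), h3, transv_apply, transv_apply,
    map_sub]
  module

/-- The isometry `(u, u') ↦ (z u, N(z)⁻¹ z u')`. -/
def simPair (hε : ¬ IsSquare ε) (z : Fin 2 → F) (hz : z ≠ 0) : PairGroup ε :=
  ⟨LinearEquiv.prodCongr (mulEquiv hε z hz) (mulEquiv hε z hz ≪≫ₗ
      LinearEquiv.smulOfNeZero F (Fin 2 → F) (nrm ε z)⁻¹
        (inv_ne_zero fun h => hz (nrm_eq_zero hε h))), fun d e => by
    have hn : nrm ε z ≠ 0 := fun h => hz (nrm_eq_zero hε h)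
    change betaForm ε (mulU ε z d.1) ((nrm ε z)⁻¹ • mulU ε z e.2)
      - betaForm ε (mulU ε z e.1) ((nrm ε z)⁻¹ • mulU ε z d.2) = betaForm ε d.1 e.2 - betaForm ε e.1 d.2
    rw [map_smul, map_smul, betaForm_mulU, betaForm_mulU, smul_eq_mul, smul_eq_mul,
      inv_mul_cancel_left₀ hn, inv_mul_cancel_left₀ hn]⟩

theorem simPair_apply_fst (hε : ¬ IsSquare ε) (z : Fin 2 → F) (hz : z ≠ 0) (u : Fin 2 → F) :
    (simPair hε z hz).1 (u, 0) = (mulU ε z u, 0) := by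
  change (mulU ε z u, (nrm ε z)⁻¹ • mulU ε z 0) = _
  simp

variable (χ : PairGroup ε →* ℂ)

theorem hom_ne_zero (g : PairGroup ε) : χ g ≠ 0 := fun h => by
  have h1 : χ g * χ g⁻¹ = 1 := by rw [← map_mul, mul_inv_cancel, map_one]
  rw [h, zero_mul] at h1
  exact zero_ne_one h1

theorem hom_transv_congr (g : PairGroup ε) (x : (Fin 2 → F) × (Fin 2 → F)) (t : F) :
    χ (transv ε (g.1 x) t) = χ (transv ε x t) := by
  have h := congrArg χ (mul_transv g x t)
  rw [map_mul, map_mul, mul_comm] at h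
  exact (mul_right_cancel₀ (hom_ne_zero χ g) h).symm

/-- The elements `simPair` conjugate all these transvections into one another, so `χ` has one value
`f(t)` on them. Additivity gives `f(2t) = f(t)²` and the parallelogram law gives `f(t)² = f(2t)²`;
hence `f(2t) = 1`. The argument is uniform in odd `q`, including `q = 3`. -/
theorem hom_transv (hε : ¬ IsSquare ε) (h2 : (2 : F) ≠ 0) {y : Fin 2 → F} (hy : y ≠ 0) (t : F) :
    χ (transv ε (y, 0) t) = 1 := by
  have hc : ∀ (y : Fin 2 → F), y ≠ 0 → ∀ t,
      χ (transv ε (y, 0) t) = χ (transv ε (![1, 0], 0) t) := fun y hy t => by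
    rw [← hom_transv_congr χ (simPair hε y hy) (![1, 0], 0) t, simPair_apply_fst, mulU_e0]
  have hsq : ∀ t, χ (transv ε (![1, 0], 0) (2 * t)) = χ (transv ε (![1, 0], 0) t) ^ 2 := fun t => by
    rw [two_mul, transv_add, map_mul, sq]
  have h1 := fun t => congrArg χ (transv_add_mul_transv_sub (ε := ε)
    (x := (![1, 0], 0)) (y := (![0, 1], 0)) (by simp [sympPair_apply]) t)
  have hne : ∀ a b c d : F, (a, b) ≠ (0, 0) →
      ((![a, b], ![c, d]) : (Fin 2 → F) × (Fin 2 → F)).1 ≠ 0 := by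
    intro a b _ _ hab h
    exact hab (Prod.ext (congrFun h 0) (congrFun h 1))
  have hf : ∀ t, χ (transv ε (![1, 0], 0) (2 * t)) = 1 := fun t => by
    have h3 := h1 t
    rw [map_mul, map_mul] at h3
    have e1 : ((![1, 0], 0) : (Fin 2 → F) × (Fin 2 → F)) + (![0, 1], 0) = (![1, 1], 0) := by simp
    have e2 : ((![1, 0], 0) : (Fin 2 → F) × (Fin 2 → F)) - (![0, 1], 0) = (![1, -1], 0) := by simp
    rw [e1, e2, hc ![1, 1] (hne 1 1 0 0 (by simp)), hc ![1, -1] (hne 1 (-1) 0 0 (by simp)),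
      hc ![0, 1] (hne 0 1 0 0 (by simp)), ← sq, ← hsq] at h3
    exact (mul_eq_left₀ (hom_ne_zero χ _)).1 h3.symm
  rw [hc y hy, ← hf (t / 2), mul_div_cancel₀ t h2]

theorem sl2Pair_apply (g : SL2 F) (d : (Fin 2 → F) × (Fin 2 → F)) :
    (sl2Pair ε g).1 d = (g 0 0 • d.1 + g 0 1 • d.2, g 1 0 • d.1 + g 1 1 • d.2) := rfl

/-- Upper unipotent elements of `G` are products of two transvections of `U × U`, one for each
vector of an orthogonal basis of `U`. Triviality uses the larger group, since `SL₂` over the field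
of three elements has non-trivial characters. -/
theorem hom_sl2Pair (hε : ¬ IsSquare ε) (h2 : (2 : F) ≠ 0) (g : SL2 F) :
    χ (sl2Pair ε g) = 1 := by
  have hε0 := eps_ne_zero hε
  have h0 : (![1, 0] : Fin 2 → F) ≠ 0 := fun h => one_ne_zero (congrFun h 0)
  have h1 : (![0, 1] : Fin 2 → F) ≠ 0 := fun h => one_ne_zero (congrFun h 1)
  have hupp : ∀ t, χ (sl2Pair ε (upp t)) = 1 := fun t => by
    -- Each coefficient is `-t` divided by the norm of the basis vector, these norms being `1` and
    -- `-ε`.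
    have h3 : sl2Pair ε (upp t)
        = transv ε (![1, 0], 0) (-t) * transv ε (![0, 1], 0) (t / ε) := by
      refine pairGroup_ext fun d => ?_
      change (sl2Pair ε (upp t)).1 d
        = (transv ε (![1, 0], 0) (-t)).1 ((transv ε (![0, 1], 0) (t / ε)).1 d)
      rw [sl2Pair_apply, transv_apply, transv_apply]
      refine Prod.ext (plane_ext ?_ ?_) (plane_ext ?_ ?_) <;>
        simp [upp, sympPair_apply, betaForm_apply]
      · rfl
      · change _ = d.1 1 + _
        rw [← mul_assoc, div_mul_cancel₀ t hε0]
    rw [h3, map_mul, hom_transv χ hε h2 h0, hom_transv χ hε h2 h1, mul_one]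
  refine sl2_hom_eq_one (χ.comp (sl2Pair ε)) (fun t => ?_) g
  have h3 := hupp (-t)
  rw [upp_eq, neg_neg, map_mul, map_mul, map_mul, map_mul, mul_right_comm, ← map_mul χ,
    ← map_mul (sl2Pair ε), mul_inv_cancel, map_one, map_one, one_mul] at h3
  exact h3

theorem orthoPair_apply (a : Ortho ε) (d : (Fin 2 → F) × (Fin 2 → F)) :
    (orthoPair ε a).1 d = (a.1 d.1, a.1 d.2) := rfl

/-- On the symplectic plane `u₀ ⊗ V` the reflection is `-1`, and it fixes the orthogonal complement.
It is the square of a quarter turn of this plane, which is a product of three transvections. -/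
theorem hom_orthoPair_refl (hε : ¬ IsSquare ε) (h2 : (2 : F) ≠ 0) {r : Ortho ε}
    (hr : r ∉ SOrtho ε) : χ (orthoPair ε r) = 1 := by
  obtain ⟨u₀, hu₀, h⟩ := exists_refl_vector hε hr
  have hn : nrm ε u₀ ≠ 0 := fun h => hu₀ (nrm_eq_zero hε h)
  set k := (nrm ε u₀)⁻¹ with hk
  have hr' : ∀ u, r.1 u = u - (2 * k * betaForm ε u u₀) • u₀ := fun u => by
    have h3 := congrArg (fun v => k • v) (h u)
    simp only [smul_sub, smul_smul] at h3
    rw [hk, inv_mul_cancel₀ hn, one_smul, one_smul] at h3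
    rw [h3, hk]
    module
  have hx : χ (transv ε (u₀, 0) (-k)) = 1 := hom_transv χ hε h2 hu₀ _
  have hy : χ (transv ε (0, u₀) (-k)) = 1 := by
    rw [← hom_transv_congr χ (sl2Pair ε wel) (0, u₀), sl2Pair_apply]
    simp only [smul_zero, zero_add]
    have e0 : (wel : SL2 F) 0 1 = 1 := rfl
    have e1 : (wel : SL2 F) 1 1 = 0 := rfl
    rw [e0, e1, one_smul, zero_smul, hx]
  have hkn : k * betaForm ε u₀ u₀ = 1 := by rw [betaForm_self, hk, inv_mul_cancel₀ hn]
  have hX : ∀ d, (transv ε (u₀, 0) (-k)).1 d = (d.1 + (k * betaForm ε d.2 u₀) • u₀, d.2) := fun d => by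
    rw [transv_apply, sympPair_apply, betaForm_symm ε u₀]
    refine Prod.ext ?_ ?_ <;> simp
  have hY : ∀ d, (transv ε (0, u₀) (-k)).1 d = (d.1, d.2 - (k * betaForm ε d.1 u₀) • u₀) := fun d => by
    rw [transv_apply, sympPair_apply]
    refine Prod.ext ?_ ?_ <;> simp [sub_eq_add_neg]
  -- On the components along `u₀` this product is `(α, β) ↦ (β, -α)`; the coefficient `-k`, with `k`
  -- the inverse norm of `u₀`, is what makes it a quarter turn.
  let M : PairGroup ε :=
    transv ε (u₀, 0) (-k) * transv ε (0, u₀) (-k) * transv ε (u₀, 0) (-k)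
  have hM : ∀ d, M.1 d = (d.1 + (k * (betaForm ε d.2 u₀ - betaForm ε d.1 u₀)) • u₀,
      d.2 - (k * (betaForm ε d.1 u₀ + betaForm ε d.2 u₀)) • u₀) := fun d => by
    change (transv ε (u₀, 0) (-k)).1 ((transv ε (0, u₀) (-k)).1 ((transv ε (u₀, 0) (-k)).1 d)) = _
    rw [hX, hY, hX]
    simp only [map_add, map_sub, map_smul, LinearMap.add_apply, LinearMap.sub_apply,
      LinearMap.smul_apply, smul_eq_mul]
    set n := betaForm ε u₀ u₀
    set α := betaForm ε d.1 u₀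
    set β := betaForm ε d.2 u₀
    refine Prod.ext ?_ ?_
    · simp only
      rw [add_assoc, ← add_smul]
      congr 2
      linear_combination (-k * α - k * β * (1 + k * n)) * hkn
    · simp only
      congr 2
      linear_combination k * β * hkn
  have hMM : orthoPair ε r = M * M := by
    refine pairGroup_ext fun d => ?_
    change (orthoPair ε r).1 d = M.1 (M.1 d)
    rw [orthoPair_apply, hM, hM, hr', hr']
    simp only [map_add, map_sub, map_smul, LinearMap.add_apply, LinearMap.sub_apply,
      LinearMap.smul_apply, smul_eq_mul]
    set n := betaForm ε u₀ u₀
    set α := betaForm ε d.1 u₀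
    set β := betaForm ε d.2 u₀
    refine Prod.ext ?_ ?_
    · simp only
      rw [sub_eq_add_neg, ← neg_smul, add_assoc, ← add_smul]
      congr 2
      linear_combination (2 * k * β) * hkn
    · simp only
      rw [sub_sub, ← add_smul]
      congr 2
      linear_combination (2 * k * α) * hkn
  rw [hMM, map_mul, map_mul, map_mul, hx, hy]
  norm_num

end Transvections

/-! ### The normalised Weil representation and the model of the dual pair -/

section Model

/-- For an involution the even determinant squares to `1`, so dividing by it equals multiplying by
it, and the product of both determinants is `det A`. -/
theorem parityDet_of_mul_self {U : Type*} [AddCommGroup U] [Fintype U]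
    {A : Module.End ℂ (U → ℂ)} (hA : A * flip = flip * A) (hAA : A * A = 1) :
    parityDet A = LinearMap.det A := by
  have h1 : LinearMap.det (A * evenProj + oddProj) * LinearMap.det (A * evenProj + oddProj) = 1 := by
    rw [← map_mul, even_part_mul hA, hAA, one_mul, evenProj_add_oddProj, map_one]
  have h2 : (A * oddProj + evenProj) * (A * evenProj + oddProj) = A := by
    have e1 : oddProj * (A * evenProj) = 0 := by
      rw [← mul_assoc, ← mul_oddProj_comm hA, mul_assoc, oddProj_mul_evenProj, mul_zero]
    have e2 : evenProj * (A * evenProj) = A * evenProj := by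
      rw [← mul_assoc, ← mul_evenProj_comm hA, mul_assoc, evenProj_mul_evenProj]
    rw [mul_add, add_mul, add_mul, mul_assoc, mul_assoc, e1, oddProj_mul_oddProj, e2,
      evenProj_mul_oddProj, mul_zero, zero_add, add_zero, ← mul_add, evenProj_add_oddProj, mul_one]
  rw [parityDet, ← h2, map_mul, h2, div_eq_iff (left_ne_zero_of_mul_eq_one h1), mul_assoc, h1,
    mul_one]

theorem det_funLeft_sq {U : Type*} [Fintype U] (σ : Equiv.Perm U) :
    LinearMap.det (LinearMap.funLeft ℂ ℂ σ) ^ 2 = 1 := by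
  classical
  have h : LinearMap.toMatrix' (LinearMap.funLeft ℂ ℂ σ) = σ.permMatrix ℂ := by
    ext i j
    rw [LinearMap.toMatrix'_apply, LinearMap.funLeft_apply, Equiv.Perm.permMatrix,
      PEquiv.toMatrix_apply, Pi.single_apply]
    simp [Equiv.toPEquiv_apply, eq_comm]
  rw [← LinearMap.det_toMatrix', h, Matrix.det_permutation]
  rcases Int.units_eq_one_or (Equiv.Perm.sign σ) with h1 | h1 <;> simp [h1]

section Weil

variable {F : Type u} [Field F] {ψ : AddChar F ℂ} {U : Type*} [AddCommGroup U] [Module F U]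
  {b : LinearMap.BilinForm F U}

theorem mulOp_isEgorov (hb : ∀ x y, b x y = b y x) (h2 : (2 : F) ≠ 0) (t : F) :
    IsEgorov b ψ (sl2Act (low t)) (mulOp fun x => ψ (-(t / 2) * b x x)) := by
  intro d
  refine LinearMap.ext fun f => funext fun x => ?_
  rw [Module.End.mul_apply, Module.End.mul_apply, mulOp_apply, schr_apply, schr_apply,
    mulOp_apply, sl2Act_apply, ← mul_assoc, ← mul_assoc, ← AddChar.map_add_eq_mul,
    ← AddChar.map_add_eq_mul]
  simp only [low_zero_zero, low_zero_one, low_one_zero, low_one_one, one_smul, zero_smul, add_zero]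
  congr 2
  simp only [map_add, map_smul, LinearMap.add_apply, LinearMap.smul_apply, smul_eq_mul, hb x d.1]
  field_simp
  ring

variable [Fintype U]

/-- The normalised oscillator representation of `SL₂` on the functions on `U`. -/
structure IsWeil (b : LinearMap.BilinForm F U) (ψ : AddChar F ℂ)
    (ω : Representation ℂ (SL2 F) (U → ℂ)) : Prop where
  egorov : ∀ g, IsEgorov b ψ (sl2Act g) (ω g)
  parity : ∀ g, parityDet (ω g) = 1

variable [Fintype F] {ω : Representation ℂ (SL2 F) (U → ℂ)}

theorem exists_isWeil (h : IsSchrodingerDatum b ψ) :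
    ∃ ω : Representation ℂ (SL2 F) (U → ℂ), IsWeil b ψ ω := by
  obtain ⟨ω, h1, h2⟩ := exists_weil (act := sl2Act) h (sympPair_sl2Act b h.symm)
  refine ⟨ω, h1, fun g => ?_⟩
  -- Applied to `ω g` itself, the normalisation reads `ω g = parityDet (ω g) • ω g`, so the factor
  -- is `1`.
  have h3 := h2 g (ω g) (ω g⁻¹) (weil_mul_inv ω g) (h1 g)
  have h4 := congrArg (· * ω g⁻¹) h3
  simp only [smul_mul_assoc, weil_mul_inv] at h4
  have h5 := LinearMap.congr_fun h4 (fun _ => 1)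
  have h6 := congrFun h5 0
  simpa using h6.symm

theorem IsWeil.eq_of_isEgorov (hω : IsWeil b ψ ω) (h : IsSchrodingerDatum b ψ)
    {g : SL2 F} {A A' : Module.End ℂ (U → ℂ)} (hAA' : A * A' = 1)
    (hA : IsEgorov b ψ (sl2Act g) A) : ω g = parityDet A • A :=
  weil_eq_of_weilChar h hω.egorov (hω.parity g) hAA' hA

/-- Multiplication by the even function `ψ(-(t / 2) b x x)`, equal to `1` at the origin, implements
`low t`; its parity determinant is `1`, so no scalar is left. -/
theorem IsWeil.apply_low (hω : IsWeil b ψ ω) (h : IsSchrodingerDatum b ψ) (t : F) :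
    ω (low t) = mulOp fun x => ψ (-(t / 2) * b x x) := by
  have hinv : ∀ x, ψ (-(t / 2) * b x x) * ψ (t / 2 * b x x) = 1 := fun x => by
    rw [← AddChar.map_add_eq_mul, neg_mul, neg_add_cancel, AddChar.map_zero_eq_one]
  have h1 : (mulOp fun x => ψ (-(t / 2) * b x x)) * (mulOp fun x => ψ (t / 2 * b x x)) = 1 := by
    refine LinearMap.ext fun f => funext fun x => ?_
    rw [Module.End.mul_apply, mulOp_apply, mulOp_apply, ← mul_assoc, hinv, one_mul]
    rfl
  rw [hω.eq_of_isEgorov h h1 (mulOp_isEgorov h.symm h.two_ne t),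
    parityDet_mulOp h.neg_eq (fun x => left_ne_zero_of_mul_eq_one (hinv x)) ?_ ?_, one_smul]
  · intro x
    simp
  · simp

/-- The sum of the products of character values at `g` and `g⁻¹` is the order of `SL₂` times the
dimension of the commutant; these products are fixed point numbers on `U × U`. -/
theorem IsWeil.finrank_end [DecidableEq F] (hω : IsWeil b ψ ω) (h : IsSchrodingerDatum b ψ) :
    ((Fintype.card F : ℂ) ^ 3 - Fintype.card F)
        * Module.finrank ℂ (IntertwiningMap ω ω)
      = (Fintype.card U : ℂ) ^ 2 + (Fintype.card F ^ 2 - 1) * Fintype.card U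
        + (Fintype.card F ^ 3 - Fintype.card F - Fintype.card F ^ 2) := by
  classical
  have h1 := sum_char_mul_char ω ω
  have h3 := sum_card_fixed (F := F) (U := U)
  simp only [char_mul_char_inv h hω.egorov] at h1
  have h4 := congrArg (Int.cast : ℤ → ℂ) h3
  push_cast at h4
  rw [h4, card_SL2_cast] at h1
  exact h1.symm

theorem IsWeil.flip_comm (hω : IsWeil b ψ ω) (h : IsSchrodingerDatum b ψ) (g : SL2 F) :
    ω g * flip = flip * ω g :=
  weil_flip h hω.egorov g

end Weil

variable {F : Type u} [Field F] {ε : F} {ψ : AddChar F ℂ}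

/-- The permutation operator attached to an isometry. -/
def permOp (a : Ortho ε) : Module.End ℂ ((Fin 2 → F) → ℂ) :=
  LinearMap.funLeft ℂ ℂ ((a⁻¹ : Ortho ε).1)

theorem permOp_apply (a : Ortho ε) (f : (Fin 2 → F) → ℂ) (x : Fin 2 → F) :
    permOp a f x = f ((a⁻¹ : Ortho ε).1 x) := rfl

theorem permOp_mul (a b : Ortho ε) : permOp (a * b) = permOp a * permOp b := by
  refine LinearMap.ext fun f => funext fun x => ?_
  rw [Module.End.mul_apply, permOp_apply, permOp_apply, permOp_apply, mul_inv_rev]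
  rfl

theorem permOp_one : permOp (1 : Ortho ε) = 1 := by
  refine LinearMap.ext fun f => funext fun x => ?_
  rw [permOp_apply, inv_one]
  rfl

theorem inv_apply_self (a : Ortho ε) (x : Fin 2 → F) : (a⁻¹ : Ortho ε).1 (a.1 x) = x := by
  change (a⁻¹ * a : Ortho ε).1 x = x
  rw [inv_mul_cancel]
  rfl

theorem self_apply_inv (a : Ortho ε) (x : Fin 2 → F) : a.1 ((a⁻¹ : Ortho ε).1 x) = x := by
  change (a * a⁻¹ : Ortho ε).1 x = x
  rw [mul_inv_cancel]
  rfl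

theorem permOp_isEgorov (a : Ortho ε) :
    IsEgorov (betaForm ε) ψ (orthoPair ε a).1 (permOp a) := by
  intro d
  refine LinearMap.ext fun f => funext fun x => ?_
  rw [Module.End.mul_apply, Module.End.mul_apply, permOp_apply, schr_apply, schr_apply,
    permOp_apply, orthoPair_apply]
  simp only
  obtain ⟨y, rfl⟩ : ∃ y, x = a.1 y := ⟨_, (self_apply_inv a x).symm⟩
  rw [a.2, a.2, map_add (a⁻¹ : Ortho ε).1, inv_apply_self, inv_apply_self]

theorem permOp_flip (a : Ortho ε) : permOp a * flip = flip * permOp a := by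
  refine LinearMap.ext fun f => funext fun x => ?_
  rw [Module.End.mul_apply, Module.End.mul_apply, permOp_apply, flip_apply, flip_apply,
    permOp_apply, map_neg]

/-- The dilation operators. -/
def dilOp (s : Fˣ) : Module.End ℂ ((Fin 2 → F) → ℂ) :=
  LinearMap.funLeft ℂ ℂ fun x => s⁻¹ • x

theorem dilOp_apply (s : Fˣ) (f : (Fin 2 → F) → ℂ) (x : Fin 2 → F) :
    dilOp s f x = f (s⁻¹ • x) := rfl

theorem dilOp_mul (s t : Fˣ) : dilOp (s * t) = dilOp s * dilOp t := by
  refine LinearMap.ext fun f => funext fun x => ?_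
  rw [Module.End.mul_apply, dilOp_apply, dilOp_apply, dilOp_apply, mul_inv_rev, mul_smul]

theorem dilOp_one : dilOp (1 : Fˣ) = 1 := by
  refine LinearMap.ext fun f => funext fun x => ?_
  rw [dilOp_apply, inv_one, one_smul]
  rfl

theorem dilOp_isEgorov (s : Fˣ) :
    IsEgorov (betaForm ε) ψ (sl2Act (dg s)) (dilOp s) := by
  intro d
  refine LinearMap.ext fun f => funext fun x => ?_
  have e1 : sl2Act (dg s) d = (s • d.1, s⁻¹ • d.2) := by
    rw [sl2Act_apply]
    simp [dg, Units.smul_def]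
  rw [Module.End.mul_apply, Module.End.mul_apply, dilOp_apply, schr_apply, schr_apply,
    dilOp_apply, e1, smul_add, inv_smul_smul]
  congr 2
  simp only [Units.smul_def, map_smul, LinearMap.smul_apply, smul_eq_mul]
  rw [Units.inv_mul_cancel_left]

variable [Fintype F]

/-- The characteristic properties of the restriction of the oscillator representation to the dual
pair, in the Schrödinger model. -/
structure IsModel (ε : F) (ψ : AddChar F ℂ)
    (R : Representation ℂ (Ortho ε × SL2 F) ((Fin 2 → F) → ℂ)) : Prop where
  perm : ∀ a, R (a, 1) = permOp a
  weil : IsWeil (betaForm ε) ψ (resSnd R)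

variable [DecidableEq F]

/-- The `-1`-eigenspace has dimension `(q² - q) / 2`. For `q = 2m + 1` this is `m(2m + 1)`, of the
same parity as `m`, and `(-1)^m` is the Legendre symbol of `-1`. -/
theorem det_permOp_refl (hε : ¬ IsSquare ε) (hF : ringChar F ≠ 2) (h2 : (2 : F) ≠ 0) {r : Ortho ε}
    (hr : r ∉ SOrtho ε) : LinearMap.det (permOp r) = ((quadraticChar F (-1) : ℤ) : ℂ) := by
  have hrr : r * r = 1 := mul_self_notMem hε hr
  have hri : r⁻¹ = r := inv_eq_of_mul_eq_one_right hrr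
  have hPP : permOp r * permOp r = 1 := by rw [← permOp_mul, hrr, permOp_one]
  let Q : Module.End ℂ ((Fin 2 → F) → ℂ) := (1 / 2 : ℂ) • (1 - permOp r)
  have hQ : Q * Q = Q := by
    simp only [Q, smul_mul_smul_comm, sub_mul, mul_sub, one_mul, mul_one, hPP]
    module
  obtain ⟨h3, h4⟩ := det_one_add_smul_of_idem hQ
  have h5 : permOp r = 1 + (-2 : ℂ) • Q := by
    simp only [Q]
    module
  have htr : LinearMap.trace ℂ _ (permOp r) = (Fintype.card F : ℂ) := by
    rw [permOp, trace_funLeft, hri]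
    exact_mod_cast card_fixed_refl hε h2 hr
  have h6 : 2 * Module.finrank ℂ (LinearMap.range Q) + Fintype.card F = Fintype.card F ^ 2 := by
    have h7 : LinearMap.trace ℂ ((Fin 2 → F) → ℂ) Q
        = (1 / 2 : ℂ) * ((Fintype.card F : ℂ) ^ 2 - Fintype.card F) := by
      simp only [Q, map_smul, map_sub, htr, LinearMap.trace_one, smul_eq_mul]
      simp
    rw [h7] at h3
    have h8 : (2 * (Module.finrank ℂ (LinearMap.range Q) : ℂ) + Fintype.card F)
        = (Fintype.card F : ℂ) ^ 2 := by
      rw [h3]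
      ring
    exact_mod_cast h8
  rw [h5, h4, quadraticChar_neg_one hF,
    ZMod.χ₄_eq_neg_one_pow (FiniteField.odd_card_of_char_ne_two hF)]
  have hodd := card_odd h2
  obtain ⟨m, hm⟩ : ∃ m, Fintype.card F = 2 * m + 1 := ⟨Fintype.card F / 2, by omega⟩
  have h9 : Module.finrank ℂ (LinearMap.range Q) = m * (2 * m) + m := by
    rw [hm] at h6
    nlinarith
  have h10 : Fintype.card F / 2 = m := by omega
  rw [h9, h10]
  push_cast
  rw [show (1 + -2 : ℂ) = -1 by norm_num, pow_add, mul_left_comm, pow_mul, neg_one_sq, one_pow,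
    one_mul]

/-- On a reflection the oscillator representation equals `parityDet (permOp r) • permOp r`, and the
scalar is the Legendre symbol of `-1 = det r`. The factor in `oscRes` cancels it exactly. -/
theorem exists_isModel (hF : ringChar F ≠ 2) (hε : ¬ IsSquare ε) (h2 : (2 : F) ≠ 0) (hψ : ψ ≠ 1)
    {E : Type*} [AddCommGroup E] [Module ℂ E] {π : Representation ℂ (Heis (tensorForm ε)) E}
    {ω : Representation ℂ (isometryGroup (tensorForm ε)) E}
    (hω : IsOscillator (tensorForm ε) ψ π ω) :
    ∃ R, IsModel ε ψ R ∧ Nonempty (Representation.Equiv (oscRes ε ω) R) := by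
  have h := isSchrodingerDatum_plane hε h2 hψ
  obtain ⟨A, hA⟩ := exists_schr_equiv h hω
  let ω₀ : Representation ℂ (PairGroup ε) ((Fin 2 → F) → ℂ) := (conjRep A ω).comp (pairIso ε)
  have hω₀ : ∀ g, IsEgorov (betaForm ε) ψ
      ((isometryGroup (sympPair (betaForm ε))).subtype g) (ω₀ g) := hA
  let R := conjRep A (oscRes ε ω)
  have hfst : ∀ a, R (a, 1) = ((quadraticChar F (detO ε a : F) : ℤ) : ℂ) • ω₀ (orthoPair ε a) := by
    intro a
    refine LinearMap.ext fun f => ?_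
    change A (((quadraticChar F (detO ε a : F) : ℤ) : ℂ) • ω (dualPairHom ε (a, 1)) (A.symm f)) = _
    rw [map_smul, dualPairHom_fst]
    rfl
  have hsnd : ∀ g, R (1, g) = ω₀ (sl2Pair ε g) := by
    intro a
    refine LinearMap.ext fun f => ?_
    change A (((quadraticChar F (detO ε 1 : F) : ℤ) : ℂ) • ω (dualPairHom ε (1, a)) (A.symm f)) = _
    rw [map_smul, dualPairHom_snd]
    simp only [map_one, Units.val_one, Int.cast_one, one_smul]
    rfl
  have hrefl : ∀ r, r ∉ SOrtho ε → R (r, 1) = permOp r := by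
    intro r hr
    have hrr : r * r = 1 := mul_self_notMem hε hr
    have hPP : permOp r * permOp r = 1 := by rw [← permOp_mul, hrr, permOp_one]
    rw [hfst, weil_eq_of_weilChar h hω₀
      (hom_orthoPair_refl (weilChar h hω₀) hε h2 hr) hPP (permOp_isEgorov r),
      parityDet_of_mul_self (permOp_flip r) hPP, det_permOp_refl hε hF h2 hr, det_notMem hε hr,
      smul_smul, ← Int.cast_mul, ← sq, quadraticChar_sq_one (neg_ne_zero.2 one_ne_zero),
      Int.cast_one, one_smul]
  refine ⟨R, ⟨fun a => ?_, fun g => ?_, fun g => ?_⟩, ⟨conjRepEquiv A _⟩⟩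
  · by_cases ha : a ∈ SOrtho ε
    · have hc := conjO_notMem (ε := ε) h2
      have hca : conjO ε * a ∉ SOrtho ε := fun h => hc (((SOrtho ε).mul_mem_cancel_right ha).1 h)
      -- A rotation is a product of two reflections, for which the formula is known.
      have h1 : (a, (1 : SL2 F)) = (conjO ε, 1) * (conjO ε * a, 1) := by
        rw [Prod.mk_mul_mk, ← mul_assoc, mul_self_notMem hε hc, one_mul, one_mul]
      rw [h1, map_mul, hrefl _ hc, hrefl _ hca, ← permOp_mul, ← mul_assoc, mul_self_notMem hε hc,
        one_mul]
    · exact hrefl a ha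
  · change IsEgorov _ _ _ (R (1, g))
    rw [hsnd]
    exact hA (sl2Pair ε g)
  · change parityDet (R (1, g)) = 1
    rw [hsnd]
    exact hom_sl2Pair (weilChar h hω₀) hε h2 g

end Model

/-! ### Characters, commutant and multiplicities in the model -/

section ModelFacts

variable {F : Type u} [Field F] [Fintype F] [DecidableEq F] {ε : F} {ψ : AddChar F ℂ}
  {R : Representation ℂ (Ortho ε × SL2 F) ((Fin 2 → F) → ℂ)}

omit [DecidableEq F] in
theorem IsModel.apply_low (hR : IsModel ε ψ R) (h : IsSchrodingerDatum (betaForm ε) ψ) (t : F) :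
    R (1, low t) = mulOp fun x => ψ (-(t / 2) * nrm ε x) := by
  simp only [← betaForm_self]
  exact hR.weil.apply_low h t

theorem IsModel.character_low (hR : IsModel ε ψ R) (h : IsSchrodingerDatum (betaForm ε) ψ)
    (hε : ¬ IsSquare ε) {t : F} (ht : t ≠ 0) :
    (resSnd R).character (low t) = -(Fintype.card F : ℂ) := by
  have h1 : (resSnd R).character (low t)
      = LinearMap.trace ℂ _ (R (1, low t)) := rfl
  rw [h1, hR.apply_low h, trace_mulOp, sum_psi_nrm hε h.two_ne h.psi_ne]
  exact neg_ne_zero.2 (div_ne_zero ht h.two_ne)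

theorem IsModel.character_mul_star (hR : IsModel ε ψ R) (h : IsSchrodingerDatum (betaForm ε) ψ)
    {g : SL2 F} (hg : g 0 0 + g 1 1 ≠ 2) :
    (resSnd R).character g * star ((resSnd R).character g) = 1 := by
  rw [← char_inv_eq_conj, char_mul_char_inv h (ω := resSnd R) hR.weil.egorov, card_fixed_of_trace hg,
    Nat.cast_one]

theorem IsModel.finrank_end (hR : IsModel ε ψ R) (h : IsSchrodingerDatum (betaForm ε) ψ) :
    Module.finrank ℂ (IntertwiningMap (resSnd R) (resSnd R)) = 2 * Fintype.card F + 1 := by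
  have h1 := hR.weil.finrank_end h
  simp only [Fintype.card_fun, Fintype.card_fin, Nat.cast_pow] at h1
  have hne : (Fintype.card F : ℂ) ^ 3 - Fintype.card F ≠ 0 := by
    rw [← card_SL2_cast]
    exact Nat.cast_ne_zero.2 Fintype.card_ne_zero
  have h5 : (Module.finrank ℂ (IntertwiningMap (resSnd R) (resSnd R)) : ℂ)
      = ((2 * Fintype.card F + 1 : ℕ) : ℂ) := by
    apply mul_left_cancel₀ hne
    rw [h1]
    push_cast
    ring
  exact_mod_cast h5

omit [Fintype F] [DecidableEq F] in
-- `a⁻¹ * s` is multiplication by some `z` with `(z - 1) x = 0`, and anisotropy forces `z = 1`.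
theorem eq_of_apply_eq (hε : ¬ IsSquare ε) {a s : Ortho ε} (h : a⁻¹ * s ∈ SOrtho ε)
    {x : Fin 2 → F} (hx : x ≠ 0) (has : a.1 x = s.1 x) : a = s := by
  obtain ⟨z, hz, hzz⟩ := exists_orthoOf hε h
  have h1 : mulU ε z x = x := by
    rw [← orthoOf_apply hε z hz, ← hzz]
    change (a⁻¹ : Ortho ε).1 (s.1 x) = x
    rw [← has, inv_apply_self]
  have h3 : mulU ε (z - ![1, 0]) x = 0 := by
    have e0 : z 0 * x 0 + ε * z 1 * x 1 = x 0 := congrFun h1 0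
    have e1 : z 1 * x 0 + z 0 * x 1 = x 1 := congrFun h1 1
    refine plane_ext ?_ ?_
    · change (z 0 - 1) * x 0 + ε * (z 1 - 0) * x 1 = 0
      linear_combination e0
    · change (z 1 - 0) * x 0 + (z 0 - 1) * x 1 = 0
      linear_combination e1
  have h4 := nrm_mulU (ε := ε) (z - ![1, 0]) x
  rw [h3, show nrm ε (0 : Fin 2 → F) = 0 by simp [nrm]] at h4
  have h5 := (mul_eq_zero.1 h4.symm).resolve_right fun h => hx (nrm_eq_zero hε h)
  have h6 := sub_eq_zero.1 (nrm_eq_zero hε h5)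
  have h7 : a⁻¹ * s = 1 := by
    rw [hzz]
    refine ortho_ext fun u => ?_
    rw [orthoOf_apply, h6]
    exact plane_ext (by simp) (by simp)
  rw [← mul_inv_cancel_left a s, h7, mul_one]

/-- The reflection `s⁻¹ * r` fixes some `x ≠ 0`, so `r x = s x`; no other isometry takes this value
at `x`. Applying the relation to the delta function at `x` and evaluating at `s x` leaves `c s + c
r`. -/
theorem add_eq_zero_of_sum_permOp (hε : ¬ IsSquare ε) (h2 : (2 : F) ≠ 0) {c : Ortho ε → ℂ}
    (hc : ∑ a, c a • permOp a = 0) {s r : Ortho ε} (hs : s ∈ SOrtho ε) (hr : r ∉ SOrtho ε) :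
    c s + c r = 0 := by
  classical
  have hsr : s⁻¹ * r ∉ SOrtho ε := fun h =>
    hr (((SOrtho ε).mul_mem_cancel_left ((SOrtho ε).inv_mem hs)).1 h)
  obtain ⟨x, hx, hx0⟩ : ∃ x ∈ Finset.univ.filter fun u => (s⁻¹ * r).1 u = u, x ≠ 0 := by
    refine Finset.exists_mem_ne ?_ 0
    rw [card_fixed_refl hε h2 hsr]
    exact Fintype.one_lt_card
  have hxe : r.1 x = s.1 x := by
    have h3 : (s⁻¹ : Ortho ε).1 (r.1 x) = x := (Finset.mem_filter.1 hx).2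
    rw [← self_apply_inv s (r.1 x), h3]
  have h4 := congrFun (LinearMap.congr_fun hc (Pi.single x 1)) (s.1 x)
  simp only [LinearMap.sum_apply, LinearMap.smul_apply, Finset.sum_apply, Pi.smul_apply,
    permOp_apply, Pi.single_apply, smul_eq_mul, mul_ite, mul_one, mul_zero] at h4
  rw [← Finset.sum_filter] at h4
  have h5 : (Finset.univ.filter fun a : Ortho ε => (a⁻¹ : Ortho ε).1 (s.1 x) = x) = {s, r} := by
    ext a
    simp only [Finset.mem_filter, Finset.mem_univ, true_and, Finset.mem_insert,
      Finset.mem_singleton]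
    constructor
    · intro ha
      have ha' : a.1 x = s.1 x := by rw [← self_apply_inv a (s.1 x), ha]
      by_cases haS : a ∈ SOrtho ε
      · exact Or.inl (eq_of_apply_eq hε
          ((SOrtho ε).mul_mem ((SOrtho ε).inv_mem haS) hs) hx0 ha')
      · refine Or.inr (eq_of_apply_eq hε (mul_mem_of_notMem hε (fun h => haS ?_) hr) hx0
          (ha'.trans hxe.symm))
        exact (SOrtho ε).inv_mem_iff.1 h
    · rintro (rfl | rfl)
      · exact inv_apply_self _ _
      · rw [← hxe, inv_apply_self]
  have hne : s ≠ r := by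
    rintro rfl
    exact hr hs
  rw [h5, Finset.sum_pair hne] at h4
  exact h4

/-- The operators commuting with `SL₂` are spanned by the orthogonal group. -/
theorem IsModel.commutantSpanned (hR : IsModel ε ψ R) (h : IsSchrodingerDatum (betaForm ε) ψ)
    (hε : ¬ IsSquare ε) : CommutantSpanned R := by
  classical
  have h2 := h.two_ne
  let I : IntertwiningMap (resSnd R) (resSnd R) →ₗ[ℂ] Module.End ℂ ((Fin 2 → F) → ℂ) :=
    { toFun := fun f => f.toLinearMap
      map_add' := fun _ _ => rfl
      map_smul' := fun _ _ => rfl }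
  have hI : Function.Injective I := fun f f' hff' => by
    exact IntertwiningMap.ext hff'
  have hperm : ∀ a, resFst R a = permOp a := hR.perm
  have hle : Submodule.span ℂ (Set.range (resFst R)) ≤ LinearMap.range I := by
    rw [Submodule.span_le]
    rintro _ ⟨a, rfl⟩
    exact ⟨fstIntertwining R a, rfl⟩
  let Φ := Fintype.linearCombination ℂ (resFst R : Ortho ε → Module.End ℂ ((Fin 2 → F) → ℂ))
  have hΦ : LinearMap.range Φ = Submodule.span ℂ (Set.range (resFst R)) :=
    Fintype.range_linearCombination ℂ _
  -- A relation is constant on rotations and opposite on reflections, so its value at `1` determines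
  -- it. The span then has dimension at least `2(q + 1) - 1`, which is the dimension of the
  -- commutant.
  have hker : Module.finrank ℂ (LinearMap.ker Φ) ≤ 1 := by
    let e : LinearMap.ker Φ →ₗ[ℂ] ℂ := (LinearMap.proj 1).comp (LinearMap.ker Φ).subtype
    have he : Function.Injective e := by
      rw [← LinearMap.ker_eq_bot, LinearMap.ker_eq_bot']
      intro c hc1
      have hc0 : ∑ a, c.1 a • permOp a = 0 := by
        have h4 : Φ c.1 = 0 := c.2
        rw [Fintype.linearCombination_apply] at h4
        rw [← h4]
        exact Finset.sum_congr rfl fun a _ => by rw [hperm]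
      have hc1' : c.1 1 = 0 := hc1
      have hrefl : ∀ r, r ∉ SOrtho ε → c.1 r = 0 := fun r hr => by
        have h5 := add_eq_zero_of_sum_permOp hε h2 hc0 (SOrtho ε).one_mem hr
        rwa [hc1', zero_add] at h5
      refine Subtype.ext (funext fun a => ?_)
      by_cases ha : a ∈ SOrtho ε
      · have h5 := add_eq_zero_of_sum_permOp hε h2 hc0 ha (conjO_notMem h2)
        rwa [hrefl _ (conjO_notMem h2), add_zero] at h5
      · exact hrefl a ha
    have := LinearMap.finrank_le_finrank_of_injective he
    rwa [Module.finrank_self] at this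
  have hrank := Φ.finrank_range_add_finrank_ker
  rw [hΦ, Module.finrank_fintype_fun_eq_card, card_Ortho hε h2] at hrank
  have hIr : Module.finrank ℂ (LinearMap.range I) = 2 * Fintype.card F + 1 := by
    rw [LinearMap.finrank_range_of_inj hI, hR.finrank_end h]
  have heq := Submodule.eq_of_le_of_finrank_le hle (hIr.le.trans (by omega))
  intro f
  rw [heq]
  exact ⟨f, rfl⟩

/-- The restriction of a representation of the orthogonal group to the special orthogonal group. -/
abbrev resSO {T : Type*} [AddCommGroup T] [Module ℂ T] (τ : Representation ℂ (Ortho ε) T) :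
    Representation ℂ (SOrtho ε) T := τ.comp (SOrtho ε).subtype

/-- The permutation character is `q²` at the identity, `1` at other rotations and `q` at
reflections. Pairing it with the character of `τ` expresses the multiplicity through `dim τ` and the
invariants of the two groups; a common factor `q + 1` cancels. -/
theorem IsModel.finrank_theta (hR : IsModel ε ψ R) (hε : ¬ IsSquare ε) (h2 : (2 : F) ≠ 0)
    {T : Type*} [AddCommGroup T] [Module ℂ T] [FiniteDimensional ℂ T]
    (τ : Representation ℂ (Ortho ε) T) :
    2 * Module.finrank ℂ (ThetaSpace R τ)
        + (Fintype.card F - 1) * Module.finrank ℂ (invariants (resSO τ))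
      = (Fintype.card F - 1) * Module.finrank ℂ T
        + 2 * Fintype.card F * Module.finrank ℂ (invariants τ) := by
  classical
  have h1 := sum_char_mul_char τ (resFst R)
  have hch : ∀ a : Ortho ε, (resFst R).character a
      = (Finset.univ.filter fun u => (a⁻¹ : Ortho ε).1 u = u).card := fun a => by
    have : (resFst R).character a = LinearMap.trace ℂ _ (R (a, 1)) := rfl
    rw [this, hR.perm, permOp, trace_funLeft]
  have hall : ∑ a : Ortho ε, τ.character a⁻¹
      = 2 * ((Fintype.card F : ℂ) + 1) * Module.finrank ℂ (invariants τ) := by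
    have := sum_char τ
    rw [card_Ortho hε h2] at this
    rw [← Equiv.sum_comp (Equiv.inv (Ortho ε)) τ.character] at this
    push_cast at this
    exact this
  have hso : ∑ a ∈ Finset.univ.filter (fun a : Ortho ε => a ∈ SOrtho ε), τ.character a⁻¹
      = ((Fintype.card F : ℂ) + 1) * Module.finrank ℂ (invariants (resSO τ)) := by
    have h3 := sum_char (resSO τ)
    rw [card_SOrtho hε h2] at h3
    rw [← Equiv.sum_comp (Equiv.inv (SOrtho ε)) (resSO τ).character] at h3
    push_cast at h3
    rw [← h3, Finset.sum_subtype (p := fun a => a ∈ SOrtho ε) _ (by simp)]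
    rfl
  have hdiag : ∑ a ∈ Finset.univ.filter (fun a : Ortho ε => a ∈ SOrtho ε),
      (resFst R).character a * τ.character a⁻¹
      = ((Fintype.card F : ℂ) ^ 2 - 1) * Module.finrank ℂ T
        + ∑ a ∈ Finset.univ.filter (fun a : Ortho ε => a ∈ SOrtho ε), τ.character a⁻¹ := by
    have hmem : (1 : Ortho ε) ∈ Finset.univ.filter (fun a : Ortho ε => a ∈ SOrtho ε) := by
      simp [(SOrtho ε).one_mem]
    rw [← Finset.add_sum_erase _ _ hmem, ← Finset.add_sum_erase _ (fun a => τ.character a⁻¹) hmem]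
    have h4 : ∀ a ∈ (Finset.univ.filter (fun a : Ortho ε => a ∈ SOrtho ε)).erase 1,
        (resFst R).character a * τ.character a⁻¹ = τ.character a⁻¹ := fun a ha => by
      have ha1 := Finset.ne_of_mem_erase ha
      have ha2 := (Finset.mem_filter.1 (Finset.mem_of_mem_erase ha)).2
      rw [hch, card_fixed_rot hε ((SOrtho ε).inv_mem ha2) (inv_ne_one.2 ha1), Nat.cast_one, one_mul]
    rw [Finset.sum_congr rfl h4, hch, inv_one, char_one]
    have h5 : (Finset.univ.filter fun u => (1 : Ortho ε).1 u = u).card = Fintype.card F ^ 2 := by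
      have : ∀ u, (1 : Ortho ε).1 u = u := fun u => rfl
      simp [this]
    rw [h5]
    push_cast
    ring
  have hoff : ∑ a ∈ Finset.univ.filter (fun a : Ortho ε => ¬ a ∈ SOrtho ε),
      (resFst R).character a * τ.character a⁻¹
      = (Fintype.card F : ℂ) *
        ∑ a ∈ Finset.univ.filter (fun a : Ortho ε => ¬ a ∈ SOrtho ε), τ.character a⁻¹ := by
    rw [Finset.mul_sum]
    refine Finset.sum_congr rfl fun a ha => ?_
    have ha2 := (Finset.mem_filter.1 ha).2
    rw [hch, card_fixed_refl hε h2 fun h => ha2 ((SOrtho ε).inv_mem_iff.1 h)]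
  have hsplit := Finset.sum_filter_add_sum_filter_not Finset.univ
    (fun a : Ortho ε => a ∈ SOrtho ε) (fun a => τ.character a⁻¹)
  rw [← Finset.sum_filter_add_sum_filter_not Finset.univ (fun a : Ortho ε => a ∈ SOrtho ε), hdiag,
    hoff, card_Ortho hε h2] at h1
  rw [hall, hso] at hsplit
  rw [hso] at h1
  have hq : (Fintype.card F : ℂ) + 1 ≠ 0 := by
    exact_mod_cast Nat.succ_ne_zero (Fintype.card F)
  have hq1 : 1 ≤ Fintype.card F := Fintype.card_pos
  have key : ((2 * Module.finrank ℂ (ThetaSpace R τ)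
        + (Fintype.card F - 1) * Module.finrank ℂ (invariants (resSO τ)) : ℕ) : ℂ)
      = (((Fintype.card F - 1) * Module.finrank ℂ T
        + 2 * Fintype.card F * Module.finrank ℂ (invariants τ) : ℕ) : ℂ) := by
    apply mul_left_cancel₀ hq
    push_cast [hq1] at h1 ⊢
    linear_combination -h1 + (Fintype.card F : ℂ) * hsplit
  exact_mod_cast key

end ModelFacts

/-! ### Tensor rank -/

section Rank

/-- A finite-dimensional representation is equivalent to one in the lowest universe. -/
theorem exists_small_equiv {Γ : Type*} [Group Γ] {E : Type*} [AddCommGroup E] [Module ℂ E]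
    [FiniteDimensional ℂ E] (ρ : Representation ℂ Γ E) :
    ∃ (n : ℕ) (σ : Representation ℂ Γ (Fin n → ℂ)), Nonempty (Representation.Equiv ρ σ) :=
  ⟨_, _, ⟨conjRepEquiv (Module.finBasis ℂ E).equivFun ρ⟩⟩

/-- Pulling back an equivalence along a homomorphism. -/
def equivComp {Γ Γ' : Type*} [Group Γ] [Group Γ'] {E E' : Type*} [AddCommGroup E] [Module ℂ E]
    [AddCommGroup E'] [Module ℂ E'] {ρ : Representation ℂ Γ E} {ρ' : Representation ℂ Γ E'}
    (e : Representation.Equiv ρ ρ') (φ : Γ' →* Γ) :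
    Representation.Equiv (ρ.comp φ) (ρ'.comp φ) :=
  Representation.Equiv.mk e.toLinearEquiv fun g => LinearMap.ext fun x => Equiv.map_rep e (φ g) x

variable {F : Type u} [Field F] {E E' : Type*} [AddCommGroup E] [Module ℂ E] [AddCommGroup E']
  [Module ℂ E'] {ρ : Representation ℂ (SL2 F) E} {ρ' : Representation ℂ (SL2 F) E'}

theorem IsGLInvariant.congr (e : Representation.Equiv ρ ρ') (h : IsGLInvariant ρ) :
    IsGLInvariant ρ' := by
  intro x φ hφ
  obtain ⟨f⟩ := h x φ hφ
  exact ⟨(e.symm.trans f).trans (equivComp e φ.toMonoidHom)⟩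

variable [Fintype F]

theorem IsDegenerate.congr (e : Representation.Equiv ρ ρ') (h : IsDegenerate ρ) :
    IsDegenerate ρ' := by
  refine ⟨IsIrred.congr e h.1, ?_, fun h3 h4 => h.2.2 h3 (h4.congr e.symm)⟩
  rw [← e.toLinearEquiv.finrank_eq]
  exact h.2.1

theorem InFiltration.of_injective {k : ℕ} (f : IntertwiningMap ρ ρ') (hf : Function.Injective f)
    (h : InFiltration k ρ') : InFiltration k ρ := by
  obtain ⟨m, D, i1, i2, σ, hσ, g, hg⟩ := h
  exact ⟨m, D, i1, i2, σ, hσ, g.comp f, hg.comp hf⟩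

theorem InFiltration.mono {k l : ℕ} (hkl : k ≤ l) (h : InFiltration k ρ) : InFiltration l ρ := by
  obtain ⟨m, D, i1, i2, σ, hσ, g, hg⟩ := h
  refine ⟨m, D, i1, i2, σ, fun i => ?_, g, hg⟩
  obtain ⟨ℓ, hℓ, h⟩ := hσ i
  exact ⟨ℓ, hℓ.trans hkl, h⟩

theorem HasTensorRank.congr {k : ℕ} (e : Representation.Equiv ρ ρ') (h : HasTensorRank k ρ) :
    HasTensorRank k ρ' :=
  ⟨h.1.of_injective e.symm.toIntertwiningMap e.symm.toLinearEquiv.injective, fun j hj h' =>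
    h.2 j hj (h'.of_injective e.toIntertwiningMap e.toLinearEquiv.injective)⟩

theorem IsFoldProduct.inFiltration {k : ℕ} {D : Type} [AddCommGroup D] [Module ℂ D]
    {σ : Representation ℂ (SL2 F) D} (hσ : IsFoldProduct k D σ) (hρ : ρ.IsIrreducible)
    (f : IntertwiningMap ρ σ) (hf : f ≠ 0) : InFiltration k ρ := by
  refine ⟨1, fun _ => D, fun _ => inferInstance, fun _ => inferInstance, fun _ => σ,
    fun _ => ⟨k, le_rfl, hσ⟩,
    ⟨DirectSum.lof ℂ (Fin 1) (fun _ => D) 0 ∘ₗ f.toLinearMap, fun g => ?_⟩, ?_⟩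
  · refine LinearMap.ext fun x => ?_
    have h1 : f (ρ g x) = σ g (f x) := map_rep f g x
    rw [LinearMap.comp_apply, LinearMap.comp_apply, LinearMap.comp_apply, directSum_apply,
      LinearMap.comp_apply, DirectSum.lmap_lof]
    exact congrArg _ h1
  · intro x y hxy
    exact IsIrred.injective hρ f hf (DirectSum.of_injective (β := fun _ : Fin 1 => D) 0 hxy)

/-- Some component of the embedding into the direct sum is nonzero on a chosen nonzero vector. -/
theorem InFiltration.exists_isFoldProduct {k : ℕ} (hρ : ρ.IsIrreducible) (h : InFiltration k ρ) :
    ∃ ℓ ≤ k, ∃ (D : Type) (_ : AddCommGroup D) (_ : Module ℂ D)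
      (σ : Representation ℂ (SL2 F) D), IsFoldProduct ℓ D σ ∧ ∃ f : IntertwiningMap ρ σ, f ≠ 0 := by
  obtain ⟨m, D, i1, i2, σ, hσ, g, hg⟩ := h
  obtain ⟨v, hv⟩ := IsIrred.exists_ne hρ
  have hgv : g v ≠ 0 := fun h0 => hv (hg (h0.trans (map_zero g).symm))
  obtain ⟨i, hi⟩ : ∃ i, g v i ≠ 0 := by
    by_contra hcon
    push Not at hcon
    exact hgv (DFinsupp.ext hcon)
  obtain ⟨ℓ, hℓ, hfold⟩ := hσ i
  refine ⟨ℓ, hℓ, D i, inferInstance, inferInstance, σ i, hfold,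
    ⟨DirectSum.component ℂ (Fin m) D i ∘ₗ g.toLinearMap, fun x => LinearMap.ext fun w => ?_⟩, ?_⟩
  · have h1 : g (ρ x w) = directSum σ x (g w) := map_rep g x w
    change (g (ρ x w)) i = σ i x (g w i)
    rw [h1, directSum_apply]
    rfl
  · intro h0
    exact hi (congrArg (fun f => f v) h0)

/-- The irreducible representations in `F¹` are the degenerate ones and the trivial one. -/
theorem InFiltration.one_cases (hρ : ρ.IsIrreducible) (h : InFiltration 1 ρ) :
    (Module.finrank ℂ E = 1 ∧ ∀ g x, ρ g x = x) ∨ IsDegenerate ρ := by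
  obtain ⟨ℓ, hℓ, D, i1, i2, σ, hσ, f, hf⟩ := h.exists_isFoldProduct hρ
  cases hσ with
  | zero =>
    left
    have hirr : (Representation.trivial ℂ (SL2 F) ℂ).IsIrreducible :=
      isIrreducible_of_finrank_eq_one (Module.finrank_self ℂ)
    obtain ⟨e⟩ := IsIrred.nonempty_equiv hρ hirr f hf
    refine ⟨by rw [e.toLinearEquiv.finrank_eq, Module.finrank_self], fun g x => ?_⟩
    apply e.toLinearEquiv.injective
    exact Equiv.map_rep e g x
  | succ ℓ' D₁ D₂ ρ₁ σ₁ h₁ hdeg =>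
    obtain rfl : ℓ' = 0 := by omega
    cases h₁ with
    | zero =>
      right
      have hl := Representation.TensorProduct.lid ℂ σ₁
      have hne : hl.toIntertwiningMap.comp f ≠ 0 := by
        intro h0
        apply hf
        ext x
        apply hl.toLinearEquiv.injective
        have := congrArg (fun f => f x) h0
        exact this.trans (map_zero hl.toLinearEquiv).symm
      obtain ⟨e⟩ := IsIrred.nonempty_equiv hρ hdeg.1 _ hne
      exact hdeg.congr e.symm

theorem InFiltration.zero_cases (hρ : ρ.IsIrreducible) (h : InFiltration 0 ρ) :
    Module.finrank ℂ E = 1 ∧ ∀ g x, ρ g x = x := by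
  obtain ⟨ℓ, hℓ, D, i1, i2, σ, hσ, f, hf⟩ := h.exists_isFoldProduct hρ
  cases hσ with
  | zero =>
    have hirr : (Representation.trivial ℂ (SL2 F) ℂ).IsIrreducible :=
      isIrreducible_of_finrank_eq_one (Module.finrank_self ℂ)
    obtain ⟨e⟩ := IsIrred.nonempty_equiv hρ hirr f hf
    refine ⟨by rw [e.toLinearEquiv.finrank_eq, Module.finrank_self], fun g x => ?_⟩
    apply e.toLinearEquiv.injective
    exact Equiv.map_rep e g x
  | succ => omega

theorem isFoldProduct_one {D : Type} [AddCommGroup D] [Module ℂ D]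
    {σ : Representation ℂ (SL2 F) D} (h : IsDegenerate σ) :
    IsFoldProduct 1 (ℂ ⊗[ℂ] D) ((Representation.trivial ℂ (SL2 F) ℂ).tprod σ) :=
  IsFoldProduct.succ 0 ℂ D _ σ IsFoldProduct.zero h

/-- Fold products live in the lowest universe, hence the passage to coordinates; a one-fold product
carries a leading trivial factor, removed by the left unit isomorphism. -/
theorem IsDegenerate.inFiltration_one (h : IsDegenerate ρ) : InFiltration 1 ρ := by
  have := IsIrred.finiteDimensional h.1
  obtain ⟨n, σ, ⟨e⟩⟩ := exists_small_equiv ρ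
  have e' := e.trans (Representation.TensorProduct.lid ℂ σ).symm
  refine (isFoldProduct_one (h.congr e)).inFiltration h.1 e'.toIntertwiningMap fun h0 => ?_
  obtain ⟨v, hv⟩ := IsIrred.exists_ne h.1
  apply hv
  apply e'.toLinearEquiv.injective
  exact (congrArg (fun f => f v) h0).trans (map_zero e'.toLinearEquiv).symm

/-- An irreducible representation which maps to a product of two degenerate ones is in `F²`. -/
theorem inFiltration_two {n m : ℕ} {σ : Representation ℂ (SL2 F) (Fin n → ℂ)}
    {σ' : Representation ℂ (SL2 F) (Fin m → ℂ)} (h : IsDegenerate σ) (h' : IsDegenerate σ')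
    (hρ : ρ.IsIrreducible) (f : IntertwiningMap ρ (σ.tprod σ')) (hf : f ≠ 0) :
    InFiltration 2 ρ := by
  let e : Representation.Equiv (((Representation.trivial ℂ (SL2 F) ℂ).tprod σ).tprod σ')
      ((Representation.trivial ℂ (SL2 F) ℂ).tprod (σ.tprod σ')) :=
    Representation.TensorProduct.assoc _ _ _
  let e' := (Representation.TensorProduct.lid ℂ (σ.tprod σ')).symm.trans e.symm
  refine (IsFoldProduct.succ 1 _ _ _ σ' (isFoldProduct_one h) h').inFiltration hρ
    (e'.toIntertwiningMap.comp f) fun h0 => hf ?_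
  refine IntertwiningMap.ext (LinearMap.ext fun x => ?_)
  apply e'.toLinearEquiv.injective
  exact (congrArg (fun f => f x) h0).trans (map_zero e'.toLinearEquiv).symm

end Rank

/-! ### The Weil representations of `SL₂` on functions on the line -/

section Conj

variable {F : Type u} [Field F]

/-- Conjugation by an element of `GL₂`. -/
def glConj (h : GL (Fin 2) F) : SL2 F ≃* SL2 F where
  toFun g := ⟨(h : Matrix (Fin 2) (Fin 2) F) * g.1 * ((h⁻¹ : GL (Fin 2) F) : Matrix _ _ F), by
    rw [Matrix.det_mul, Matrix.det_mul, g.2, mul_one, ← Matrix.det_mul, ← Units.val_mul,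
      mul_inv_cancel, Units.val_one, Matrix.det_one]⟩
  invFun g := ⟨((h⁻¹ : GL (Fin 2) F) : Matrix _ _ F) * g.1 * (h : Matrix (Fin 2) (Fin 2) F), by
    rw [Matrix.det_mul, Matrix.det_mul, g.2, mul_one, ← Matrix.det_mul, ← Units.val_mul,
      inv_mul_cancel, Units.val_one, Matrix.det_one]⟩
  left_inv g := Subtype.ext (by simp [mul_assoc])
  right_inv g := Subtype.ext (by simp [mul_assoc])
  map_mul' g g' := Subtype.ext (by
    change (h : Matrix (Fin 2) (Fin 2) F) * (g.1 * g'.1) * ((h⁻¹ : GL (Fin 2) F) : Matrix _ _ F)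
      = ((h : Matrix (Fin 2) (Fin 2) F) * g.1 * ((h⁻¹ : GL (Fin 2) F) : Matrix _ _ F))
        * ((h : Matrix (Fin 2) (Fin 2) F) * g'.1 * ((h⁻¹ : GL (Fin 2) F) : Matrix _ _ F))
    simp [mul_assoc])

theorem glConj_coe (h : GL (Fin 2) F) (g : SL2 F) :
    (glConj h g : Matrix (Fin 2) (Fin 2) F)
      = (h : Matrix (Fin 2) (Fin 2) F) * g.1 * ((h⁻¹ : GL (Fin 2) F) : Matrix _ _ F) := rfl

/-- The diagonal matrix with entries `1, s`. -/
def glDiag (s : Fˣ) : GL (Fin 2) F :=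
  Matrix.GeneralLinearGroup.mkOfDetNeZero !![1, 0; 0, (s : F)] (by simp [Matrix.det_fin_two])

theorem glConj_glDiag_low (s : Fˣ) (t : F) : glConj (glDiag s) (low t) = low (s * t) := by
  apply Subtype.ext
  have h1 : (glDiag s : Matrix (Fin 2) (Fin 2) F) * (low t).1
      = (low (s * t)).1 * (glDiag s : Matrix (Fin 2) (Fin 2) F) := by
    change !![1, 0; 0, (s : F)] * !![1, 0; t, 1] = !![1, 0; s * t, 1] * !![1, 0; 0, (s : F)]
    simp
  change _ * _ * _ = _
  rw [h1, mul_assoc, ← Units.val_mul, mul_inv_cancel, Units.val_one, mul_one]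

end Conj

section Line

variable {F : Type u} [Field F] {ψ : AddChar F ℂ}

/-- The form `c x y` on the line. -/
def lineForm (c : F) : LinearMap.BilinForm F F := c • LinearMap.mul F F

theorem lineForm_apply (c x y : F) : lineForm c x y = c * (x * y) := rfl

theorem isSchrodingerDatum_line (h2 : (2 : F) ≠ 0) (hψ : ψ ≠ 1) {c : F} (hc : c ≠ 0) :
    IsSchrodingerDatum (lineForm c) ψ :=
  ⟨h2, fun x y => by rw [lineForm_apply, lineForm_apply, mul_comm x], fun x hx => by
    have := hx 1
    rw [lineForm_apply, mul_one] at this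
    exact (mul_eq_zero.1 this).resolve_left hc, hψ⟩

theorem exists_char_ne_one (hψ : ψ ≠ 1) : ∃ t, ψ t ≠ 1 := by
  by_contra hcon
  push Not at hcon
  exact hψ (DFunLike.ext _ _ hcon)

theorem eq_zero_of_forall_char (hψ : ψ ≠ 1) {a : F} (h : ∀ t, ψ (t * a) = 1) : a = 0 := by
  by_contra ha
  obtain ⟨t, ht⟩ := exists_char_ne_one hψ
  apply ht
  have := h (t / a)
  rwa [div_mul_cancel₀ t ha] at this

/-- The image of an equivariant operator. -/
def rangeSub {Γ E : Type*} [Group Γ] [AddCommGroup E] [Module ℂ E] {ρ : Representation ℂ Γ E}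
    (P : IntertwiningMap ρ ρ) : Subrepresentation ρ where
  toSubmodule := LinearMap.range P.toLinearMap
  apply_mem_toSubmodule g v hv := by
    obtain ⟨x, rfl⟩ := hv
    exact ⟨ρ g x, map_rep P g x⟩

/-- The projection onto the image of an equivariant operator. -/
def rangeProj {Γ E : Type*} [Group Γ] [AddCommGroup E] [Module ℂ E] {ρ : Representation ℂ Γ E}
    (P : IntertwiningMap ρ ρ) : IntertwiningMap ρ (subRep (rangeSub P)) :=
  ⟨P.toLinearMap.rangeRestrict, fun g => LinearMap.ext fun x => Subtype.ext (map_rep P g x)⟩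

variable [Fintype F] [DecidableEq F] {c : F} {ω : Representation ℂ (SL2 F) (F → ℂ)}

/-- For `|U| = q` the fixed point count is twice the order of `SL₂`, so the commutant is
two-dimensional; the identity and `flip` span it. -/
theorem IsWeil.exists_end_eq (hω : IsWeil (lineForm c) ψ ω)
    (h : IsSchrodingerDatum (lineForm c) ψ) (T : IntertwiningMap ω ω) :
    ∃ a b : ℂ, ∀ f, T f = a • f + b • flip f := by
  have hrank : Module.finrank ℂ (IntertwiningMap ω ω) = 2 := by
    have h1 := hω.finrank_end h
    have hne : (Fintype.card F : ℂ) ^ 3 - Fintype.card F ≠ 0 := by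
      rw [← card_SL2_cast]
      exact Nat.cast_ne_zero.2 Fintype.card_ne_zero
    have h3 : (Module.finrank ℂ (IntertwiningMap ω ω) : ℂ) = (2 : ℕ) := by
      apply mul_left_cancel₀ hne
      rw [h1]
      push_cast
      ring
    exact_mod_cast h3
  let J : IntertwiningMap ω ω := ⟨flip, fun g => (hω.flip_comm h g).symm⟩
  have hne : (1 : F) ≠ -1 := fun h1 => h.two_ne (by linear_combination h1)
  have hli : LinearIndependent ℂ ![IntertwiningMap.id ω, J] := by
    rw [LinearIndependent.pair_iff]
    intro s t hst
    have h1 : ∀ x, s * (Pi.single (1 : F) (1 : ℂ) : F → ℂ) x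
        + t * (Pi.single (1 : F) (1 : ℂ) : F → ℂ) (-x) = 0 := fun x =>
      congrFun (congrArg (fun f : IntertwiningMap ω ω => f (Pi.single (1 : F) (1 : ℂ))) hst) x
    have e1 := h1 1
    have e2 := h1 (-1)
    rw [neg_neg] at e2
    rw [Pi.single_eq_same, Pi.single_eq_of_ne hne.symm] at e1 e2
    simp at e1 e2
    exact ⟨e1, e2⟩
  have hspan := hli.span_eq_top_of_card_eq_finrank' (by simp [hrank])
  have hT : T ∈ Submodule.span ℂ (Set.range ![IntertwiningMap.id ω, J]) := by
    rw [hspan]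
    exact Submodule.mem_top
  simp only [Matrix.range_cons, Matrix.range_empty, Set.union_empty, Set.singleton_union,
    Submodule.mem_span_pair] at hT
  obtain ⟨a, b, rfl⟩ := hT
  exact ⟨a, b, fun f => rfl⟩

/-- The part of given parity of the Weil representation is irreducible, and not isomorphic to its
conjugate under a matrix of non-square determinant. -/
theorem IsWeil.part (hω : IsWeil (lineForm c) ψ ω) (h : IsSchrodingerDatum (lineForm c) ψ)
    (hc : c ≠ 0) {s : F} (hs : ¬ IsSquare s)
    (P : IntertwiningMap ω ω) {η : ℂ} (hPP : ∀ f, P (P f) = P f)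
    (hη : ∀ f, flip (P f) = η • P f) (hP1 : P (Pi.single 1 1) ≠ 0) :
    (subRep (rangeSub P)).IsIrreducible ∧ ¬ IsGLInvariant (subRep (rangeSub P)) := by
  have hX : ∀ v : (rangeSub P).toSubmodule, P v.1 = v.1 := by
    rintro ⟨_, f, rfl⟩
    exact hPP f
  have hf0 : rangeProj P (Pi.single 1 1) ≠ 0 := fun h0 => hP1 (congrArg Subtype.val h0)
  constructor
  · have : Nontrivial (rangeSub P).toSubmodule := ⟨_, _, hf0⟩
    refine isIrreducible_of_forall_scalar fun f => ?_
    let i : IntertwiningMap (subRep (rangeSub P)) ω :=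
      ⟨(rangeSub P).toSubmodule.subtype, fun g => rfl⟩
    -- Extended to all functions by the projection, an endomorphism of the part is a combination of
    -- the identity and `flip`, and `flip` is the scalar `η` there.
    obtain ⟨a, b, hab⟩ := hω.exists_end_eq h (i.comp (f.comp (rangeProj P)))
    refine ⟨a + b * η, fun v => Subtype.ext ?_⟩
    have h1 : rangeProj P v.1 = v := Subtype.ext (hX v)
    have h3 := hab v.1
    have h4 : flip v.1 = η • v.1 := by
      conv_lhs => rw [← hX v, hη, hX v]
    change (f (rangeProj P v.1)).1 = _ at h3
    rw [h1, h4, smul_smul, ← add_smul] at h3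
    exact h3
  · intro hinv
    have hs0 : s ≠ 0 := by
      rintro rfl
      exact hs ⟨0, by simp⟩
    obtain ⟨e⟩ := hinv (glDiag (Units.mk0 s hs0)) (glConj (glDiag (Units.mk0 s hs0)))
      (glConj_coe _)
    set u := e (rangeProj P (Pi.single 1 1)) with hu
    have hu0 : u ≠ 0 := fun h0 => hf0 (e.toLinearEquiv.injective (h0.trans
      (map_zero e.toLinearEquiv).symm))
    obtain ⟨y, hy⟩ : ∃ y, u.1 y ≠ 0 := by
      by_contra hcon
      push Not at hcon
      exact hu0 (Subtype.ext (funext hcon))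
    -- The parity projection of the delta function at `1` is an eigenvector of every `low t`. Its
    -- image under the equivalence is an eigenvector of `low (s * t)` with the same eigenvalue; at a
    -- point `y` of its support this gives `s y² = 1`, against `s` being a non-square.
    have h1 : ∀ t, ψ (t * (c / 2 * (s * y * y - 1))) = 1 := by
      intro t
      have e1 : ω (low t) (Pi.single 1 1) = ψ (-(t / 2) * c) • (Pi.single 1 1 : F → ℂ) := by
        rw [hω.apply_low h]
        ext x
        rw [mulOp_apply, Pi.smul_apply, lineForm_apply]
        by_cases hx : x = 1
        · rw [hx, mul_one, mul_one]
          rfl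
        · rw [Pi.single_eq_of_ne hx, mul_zero, smul_zero]
      have e2 : subRep (rangeSub P) (low t) (rangeProj P (Pi.single 1 1))
          = ψ (-(t / 2) * c) • rangeProj P (Pi.single 1 1) := by
        rw [← map_rep, e1, map_smul]
      have e3 := Equiv.map_rep e (low t) (rangeProj P (Pi.single 1 1))
      rw [e2, map_smul, ← hu] at e3
      have e4 : ((subRep (rangeSub P)).comp (glConj (glDiag (Units.mk0 s hs0))).toMonoidHom)
          (low t) u = subRep (rangeSub P) (low (s * t)) u := by
        change subRep (rangeSub P) (glConj (glDiag (Units.mk0 s hs0)) (low t)) u = _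
        rw [glConj_glDiag_low]
        rfl
      rw [e4] at e3
      have e5 : ψ (-(t / 2) * c) * u.1 y = ω (low (s * t)) u.1 y :=
        congrFun (congrArg Subtype.val e3) y
      rw [hω.apply_low h, mulOp_apply, lineForm_apply] at e5
      have e6 := mul_right_cancel₀ hy e5
      have e7 : t * (c / 2 * (s * y * y - 1)) = -(t / 2) * c - -(s * t / 2) * (c * (y * y)) := by
        ring
      have hne : ψ (-(s * t / 2) * (c * (y * y))) ≠ 0 := by
        intro h0
        have h3 := AddChar.map_add_eq_mul ψ (-(s * t / 2) * (c * (y * y)))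
          (-(-(s * t / 2) * (c * (y * y))))
        rw [h0, zero_mul, add_neg_cancel, AddChar.map_zero_eq_one] at h3
        exact one_ne_zero h3
      have e8 := AddChar.map_add_eq_mul ψ (t * (c / 2 * (s * y * y - 1)))
        (-(s * t / 2) * (c * (y * y)))
      rw [e7, sub_add_cancel, e6] at e8
      rw [e7]
      exact (mul_eq_right₀ hne).1 e8.symm
    have h3 := eq_zero_of_forall_char h.psi_ne h1
    have h4 : s * y * y - 1 = 0 :=
      (mul_eq_zero.1 h3).resolve_left (div_ne_zero hc h.two_ne)
    have hy0 : y ≠ 0 := by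
      rintro rfl
      simp at h4
    apply hs
    refine ⟨y⁻¹, ?_⟩
    field_simp
    linear_combination h4

/-- The Weil representation on the line is the sum of two degenerate representations. -/
theorem IsWeil.exists_parts (hω : IsWeil (lineForm c) ψ ω)
    (h : IsSchrodingerDatum (lineForm c) ψ) (hc : c ≠ 0) {s : F} (hs : ¬ IsSquare s) :
    ∃ (n m : ℕ) (σ : Representation ℂ (SL2 F) (Fin n → ℂ))
      (σ' : Representation ℂ (SL2 F) (Fin m → ℂ)) (p : IntertwiningMap ω σ)
      (p' : IntertwiningMap ω σ') (i : (Fin n → ℂ) →ₗ[ℂ] (F → ℂ)) (i' : (Fin m → ℂ) →ₗ[ℂ] (F → ℂ)),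
      IsDegenerate σ ∧ IsDegenerate σ' ∧
        i ∘ₗ p.toLinearMap + i' ∘ₗ p'.toLinearMap = LinearMap.id := by
  have hne : (1 : F) ≠ -1 := fun h1 => h.two_ne (by linear_combination h1)
  let P : IntertwiningMap ω ω := ⟨evenProj, fun g => (mul_evenProj_comm (hω.flip_comm h g)).symm⟩
  let Q : IntertwiningMap ω ω := ⟨oddProj, fun g => (mul_oddProj_comm (hω.flip_comm h g)).symm⟩
  have hP := hω.part h hc hs P (η := 1)
    (fun f => LinearMap.congr_fun (evenProj_mul_evenProj (U := F)) f)
    (fun f => by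
      change flip (evenProj f) = (1 : ℂ) • evenProj f
      rw [← Module.End.mul_apply, evenProj, mul_smul_comm, mul_add, mul_one, flip_mul_flip,
        one_smul, add_comm])
    (fun h0 => by
      have h1 : (1 / 2 : ℂ) * ((Pi.single (1 : F) (1 : ℂ) : F → ℂ) 1
        + (Pi.single (1 : F) (1 : ℂ) : F → ℂ) (-1)) = 0 := congrFun h0 1
      rw [Pi.single_eq_same, Pi.single_eq_of_ne hne.symm] at h1
      norm_num at h1)
  have hQ := hω.part h hc hs Q (η := -1)
    (fun f => LinearMap.congr_fun (oddProj_mul_oddProj (U := F)) f)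
    (fun f => by
      change flip (oddProj f) = (-1 : ℂ) • oddProj f
      rw [← Module.End.mul_apply, oddProj, mul_smul_comm, mul_sub, mul_one, flip_mul_flip,
        neg_one_smul, ← LinearMap.neg_apply, ← neg_sub, smul_neg])
    (fun h0 => by
      have h1 : (1 / 2 : ℂ) * ((Pi.single (1 : F) (1 : ℂ) : F → ℂ) 1
        - (Pi.single (1 : F) (1 : ℂ) : F → ℂ) (-1)) = 0 := congrFun h0 1
      rw [Pi.single_eq_same, Pi.single_eq_of_ne hne.symm] at h1
      norm_num at h1)
  have hPd : IsDegenerate (subRep (rangeSub P)) := by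
    refine ⟨hP.1, Or.inr ?_, fun _ => hP.2⟩
    exact finrank_even h.neg_eq
  have hQd : IsDegenerate (subRep (rangeSub Q)) := by
    refine ⟨hQ.1, Or.inl ?_, fun _ => hQ.2⟩
    exact Nat.eq_sub_of_add_eq (finrank_odd h.neg_eq)
  obtain ⟨n, σ, ⟨e⟩⟩ := exists_small_equiv (subRep (rangeSub P))
  obtain ⟨m, σ', ⟨e'⟩⟩ := exists_small_equiv (subRep (rangeSub Q))
  refine ⟨n, m, σ, σ', e.toIntertwiningMap.comp (rangeProj P),
    e'.toIntertwiningMap.comp (rangeProj Q),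
    (rangeSub P).toSubmodule.subtype ∘ₗ e.symm.toLinearMap,
    (rangeSub Q).toSubmodule.subtype ∘ₗ e'.symm.toLinearMap,
    hPd.congr e, hQd.congr e', LinearMap.ext fun f => ?_⟩
  change (e.symm (e (rangeProj P f))).1 + (e'.symm (e' (rangeProj Q f))).1 = f
  rw [Representation.Equiv.symm_apply_apply, Representation.Equiv.symm_apply_apply]
  exact LinearMap.congr_fun (evenProj_add_oddProj (U := F)) f

end Line

/-! ### The Weil representation of the plane as a product of two lines -/

section Plane

variable {F : Type u} [Field F] {ε : F} {ψ : AddChar F ℂ}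

/-- The map `f ⊗ f' ↦ (x ↦ f(x₀) f'(x₁))`. -/
def mulMap (F : Type u) : (F → ℂ) ⊗[ℂ] (F → ℂ) →ₗ[ℂ] ((Fin 2 → F) → ℂ) :=
  TensorProduct.lift (LinearMap.mk₂ ℂ (fun f f' x => f (x 0) * f' (x 1))
    (fun f f' g => funext fun x => add_mul _ _ _)
    (fun c f g => funext fun x => mul_assoc _ _ _)
    (fun f g g' => funext fun x => mul_add _ _ _)
    (fun c f g => funext fun x => mul_left_comm _ _ _))

theorem mulMap_tmul (f f' : F → ℂ) (x : Fin 2 → F) :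
    mulMap F (f ⊗ₜ f') x = f (x 0) * f' (x 1) := rfl

theorem mulMap_bijective [Fintype F] : Function.Bijective (mulMap F) := by
  classical
  have hsurj : LinearMap.range (mulMap F) = ⊤ := by
    rw [eq_top_iff]
    intro g _
    have h : g = ∑ x, g x • mulMap F (Pi.single (x 0) 1 ⊗ₜ Pi.single (x 1) 1) := by
      ext y
      rw [Finset.sum_apply, Finset.sum_eq_single y]
      · rw [Pi.smul_apply, mulMap_tmul, Pi.single_eq_same, Pi.single_eq_same, mul_one, smul_eq_mul,
          mul_one]
      · intro x _ hxy
        rw [Pi.smul_apply, mulMap_tmul]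
        by_cases h0 : y 0 = x 0
        · have h1 : y 1 ≠ x 1 := fun h1 => hxy (plane_ext h0.symm h1.symm)
          rw [Pi.single_eq_of_ne h1, mul_zero, smul_zero]
        · rw [Pi.single_eq_of_ne h0, zero_mul, smul_zero]
      · simp
    rw [h]
    exact Submodule.sum_mem _ fun x _ => Submodule.smul_mem _ _ ⟨_, rfl⟩
  refine ⟨?_, LinearMap.range_eq_top.1 hsurj⟩
  refine (LinearMap.injective_iff_surjective_of_finrank_eq_finrank ?_).2
    (LinearMap.range_eq_top.1 hsurj)
  simp [sq]

theorem schr_mulMap (d : (Fin 2 → F) × (Fin 2 → F)) (t : (F → ℂ) ⊗[ℂ] (F → ℂ)) :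
    schr (betaForm ε) ψ d (mulMap F t)
      = mulMap F (TensorProduct.map (schr (lineForm 1) ψ (d.1 0, d.2 0))
          (schr (lineForm (-ε)) ψ (d.1 1, d.2 1)) t) := by
  induction t using TensorProduct.induction_on with
  | zero => simp
  | add x y hx hy => rw [map_add, map_add, hx, hy, map_add, map_add]
  | tmul f f' =>
    ext x
    rw [TensorProduct.map_tmul, mulMap_tmul, schr_apply, schr_apply, schr_apply, mulMap_tmul,
      mul_mul_mul_comm, ← AddChar.map_add_eq_mul]
    congr 2
    simp only [betaForm_apply, lineForm_apply]
    ring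

variable [Fintype F] [DecidableEq F] {ω : Representation ℂ (SL2 F) ((Fin 2 → F) → ℂ)}
  {ω₁ ω₂ : Representation ℂ (SL2 F) (F → ℂ)}

/-- The Weil representation on the plane is a product of Weil representations on lines. -/
theorem IsWeil.equiv_tprod (hω : IsWeil (betaForm ε) ψ ω) (h₁ : IsWeil (lineForm 1) ψ ω₁)
    (h₂ : IsWeil (lineForm (-ε)) ψ ω₂) (h : IsSchrodingerDatum (betaForm ε) ψ) (hε : ε ≠ 0) :
    Nonempty (Representation.Equiv ω (ω₁.tprod ω₂)) := by
  have d₁ : IsSchrodingerDatum (lineForm (1 : F)) ψ :=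
    isSchrodingerDatum_line h.two_ne h.psi_ne one_ne_zero
  have d₂ : IsSchrodingerDatum (lineForm (-ε)) ψ :=
    isSchrodingerDatum_line h.two_ne h.psi_ne (neg_ne_zero.2 hε)
  let M := LinearEquiv.ofBijective (mulMap F) mulMap_bijective
  let S := conjRep M (ω₁.tprod ω₂)
  have hS : ∀ g t, S g (mulMap F t) = mulMap F (TensorProduct.map (ω₁ g) (ω₂ g) t) := fun g t =>
    congrArg (fun x => mulMap F (TensorProduct.map (ω₁ g) (ω₂ g) x)) (M.symm_apply_apply t)
  have hSe : ∀ g, IsEgorov (betaForm ε) ψ (sl2Act g) (S g) := by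
    intro g d
    refine LinearMap.ext fun f => ?_
    obtain ⟨t, rfl⟩ := mulMap_bijective.2 f
    rw [Module.End.mul_apply, Module.End.mul_apply, schr_mulMap, hS, hS, schr_mulMap]
    congr 1
    rw [← LinearMap.comp_apply, ← LinearMap.comp_apply, ← TensorProduct.map_comp,
      ← TensorProduct.map_comp, ← Module.End.mul_eq_comp, ← Module.End.mul_eq_comp,
      ← Module.End.mul_eq_comp, ← Module.End.mul_eq_comp, h₁.egorov, h₂.egorov]
    rfl
  have hne : ∀ g, S g ≠ 0 := fun g h0 => by
    have h3 := weil_mul_inv S g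
    rw [h0, zero_mul] at h3
    exact zero_ne_one h3
  choose δ hδ using fun g => IsEgorov.exists_smul h (weil_mul_inv S g) (hSe g) (hω.egorov g)
  have hcancel : ∀ g (a b : ℂ), a • S g = b • S g → a = b := fun g a b hab =>
    smul_left_injective ℂ (hne g) hab
  -- Both representations implement the same maps, so they differ by a character of `SL₂`; it is `1`
  -- on lower unipotent elements, where both are explicit multiplications, hence everywhere.
  let Δ : SL2 F →* ℂ :=
    { toFun := δ
      map_one' := hcancel 1 _ _ (by rw [← hδ, map_one, map_one, one_smul])
      map_mul' := fun g g' => hcancel (g * g') _ _ (by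
        rw [← hδ, map_mul, hδ, hδ g', smul_mul_smul_comm, ← map_mul]) }
  have hlow : ∀ t, Δ (low t) = 1 := fun t => hcancel (low t) _ _ (by
    change δ (low t) • S (low t) = _
    rw [← hδ, one_smul]
    refine LinearMap.ext fun f => ?_
    obtain ⟨x, rfl⟩ := mulMap_bijective.2 f
    rw [hS, hω.apply_low h, h₁.apply_low d₁, h₂.apply_low d₂]
    induction x using TensorProduct.induction_on with
    | zero => simp
    | add x y hx hy => rw [map_add, map_add, hx, hy, map_add, map_add]
    | tmul f f' =>
      ext x
      rw [TensorProduct.map_tmul, mulMap_tmul, mulOp_apply, mulOp_apply, mulOp_apply, mulMap_tmul,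
        mul_mul_mul_comm, ← AddChar.map_add_eq_mul]
      congr 2
      simp only [betaForm_apply, lineForm_apply]
      ring)
  have hone : ∀ g, ω g = S g := fun g => by
    rw [hδ g]
    change Δ g • S g = S g
    rw [sl2_hom_eq_one Δ hlow g, one_smul]
  have hωS : ω = S := MonoidHom.ext hone
  rw [hωS]
  exact ⟨(conjRepEquiv M (ω₁.tprod ω₂)).symm⟩

/-- Each line factor is the sum of its even and odd parts, both degenerate. If all four component
maps vanished on the image of `f`, then `f` would be zero. -/
theorem IsWeil.inFiltration_two (hω : IsWeil (betaForm ε) ψ ω)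
    (h : IsSchrodingerDatum (betaForm ε) ψ) (hε : ¬ IsSquare ε) {E : Type*} [AddCommGroup E]
    [Module ℂ E] {ρ : Representation ℂ (SL2 F) E} (hρ : ρ.IsIrreducible)
    (f : IntertwiningMap ρ ω) (hf : f ≠ 0) : InFiltration 2 ρ := by
  have hε0 := eps_ne_zero hε
  have d₁ : IsSchrodingerDatum (lineForm (1 : F)) ψ :=
    isSchrodingerDatum_line h.two_ne h.psi_ne one_ne_zero
  have d₂ : IsSchrodingerDatum (lineForm (-ε)) ψ :=
    isSchrodingerDatum_line h.two_ne h.psi_ne (neg_ne_zero.2 hε0)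
  obtain ⟨ω₁, h₁⟩ := exists_isWeil d₁
  obtain ⟨ω₂, h₂⟩ := exists_isWeil d₂
  obtain ⟨e⟩ := hω.equiv_tprod h₁ h₂ h hε0
  obtain ⟨n, m, σ, σ', p, p', i, i', hσ, hσ', hi⟩ := h₁.exists_parts d₁ one_ne_zero hε
  obtain ⟨k, l, τ, τ', r, r', j, j', hτ, hτ', hj⟩ :=
    h₂.exists_parts d₂ (neg_ne_zero.2 hε0) hε
  let g := e.toIntertwiningMap.comp f
  by_contra hcon
  have hzero : ∀ {a b : ℕ} {α : Representation ℂ (SL2 F) (Fin a → ℂ)}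
      {β : Representation ℂ (SL2 F) (Fin b → ℂ)} (x : IntertwiningMap ω₁ α)
      (y : IntertwiningMap ω₂ β), IsDegenerate α → IsDegenerate β → ∀ v,
      TensorProduct.map x.toLinearMap y.toLinearMap (g v) = 0 := by
    intro a b α β x y hα hβ v
    by_contra hv
    exact hcon (EtaCorr.inFiltration_two hα hβ hρ ((x.tensor y).comp g)
      fun h0 => hv (congrArg (fun f => f v) h0))
  apply hf
  refine IntertwiningMap.ext (LinearMap.ext fun v => ?_)
  apply e.toLinearEquiv.injective
  refine Eq.trans ?_ (map_zero e.toLinearEquiv).symm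
  change g v = 0
  have h3 : g v = TensorProduct.map (i ∘ₗ p.toLinearMap + i' ∘ₗ p'.toLinearMap)
      (j ∘ₗ r.toLinearMap + j' ∘ₗ r'.toLinearMap) (g v) := by
    rw [hi, hj, TensorProduct.map_id, LinearMap.id_apply]
  rw [h3]
  simp only [TensorProduct.map_add_left, TensorProduct.map_add_right, TensorProduct.map_comp,
    LinearMap.add_apply, LinearMap.comp_apply]
  rw [hzero p r hσ hτ, hzero p r' hσ hτ', hzero p' r hσ' hτ, hzero p' r' hσ' hτ']
  simp

end Plane

/-! ### Representations of the orthogonal group of the plane -/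

section OrthoReps

variable {F : Type u} [Field F] {ε : F}

section Tau

variable {μ : SOrtho ε →* ℂˣ}

theorem tau_mul_apply (f : tauSpace μ) (s : SOrtho ε) (h : Ortho ε) :
    f.1 ((s : Ortho ε) * h) = (μ s : ℂ) * f.1 h := f.2 s h

theorem tauInd_apply (a : Ortho ε) (f : tauSpace μ) (h : Ortho ε) :
    (tauInd μ a f).1 h = f.1 (h * a) := rfl

theorem tau_apply_so (f : tauSpace μ) (s : SOrtho ε) : f.1 s = (μ s : ℂ) * f.1 1 := by
  rw [← tau_mul_apply, mul_one]

variable (hε : ¬ IsSquare ε)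
include hε

omit hε in
theorem tauInd_so_one (f : tauSpace μ) (s : SOrtho ε) :
    (tauInd μ (s : Ortho ε) f).1 1 = (μ s : ℂ) * f.1 1 := by
  rw [tauInd_apply, one_mul, tau_apply_so]

theorem tauInd_so_refl {r : Ortho ε} (hr : r ∉ SOrtho ε) (f : tauSpace μ) (s : SOrtho ε) :
    (tauInd μ (s : Ortho ε) f).1 r = ((μ s)⁻¹ : ℂˣ) * f.1 r := by
  rw [tauInd_apply, refl_conj hε s.2 hr, ← map_inv, ← tau_mul_apply]
  rfl

omit hε in
theorem tauInd_refl_one {r : Ortho ε} (f : tauSpace μ) : (tauInd μ r f).1 1 = f.1 r := by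
  rw [tauInd_apply, one_mul]

theorem tauInd_refl_refl {r : Ortho ε} (hr : r ∉ SOrtho ε) (f : tauSpace μ) :
    (tauInd μ r f).1 r = f.1 1 := by
  rw [tauInd_apply, mul_self_notMem hε hr]

theorem exists_so_mul {r : Ortho ε} (hr : r ∉ SOrtho ε) {a : Ortho ε} (ha : a ∉ SOrtho ε) :
    ∃ s : SOrtho ε, a = s * r :=
  ⟨⟨a * r, mul_mem_of_notMem hε ha hr⟩, by
    change a = a * r * r
    rw [mul_assoc, mul_self_notMem hε hr, mul_one]⟩

/-- The orthogonal group is the union of the rotations and their products with `r`, so the values at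
`1` and `r` are coordinates. -/
theorem tau_ext {r : Ortho ε} (hr : r ∉ SOrtho ε) {f f' : tauSpace μ} (h1 : f.1 1 = f'.1 1)
    (h2 : f.1 r = f'.1 r) : f = f' := by
  refine Subtype.ext (funext fun a => ?_)
  by_cases ha : a ∈ SOrtho ε
  · rw [show a = ((⟨a, ha⟩ : SOrtho ε) : Ortho ε) from rfl, tau_apply_so, tau_apply_so, h1]
  · obtain ⟨s, rfl⟩ := exists_so_mul hε hr ha
    rw [tau_mul_apply, tau_mul_apply, h2]

open Classical in
omit hε in
/-- The function supported on the special orthogonal group. -/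
def tauBase (μ : SOrtho ε →* ℂˣ) : tauSpace μ :=
  ⟨fun a => if ha : a ∈ SOrtho ε then (μ ⟨a, ha⟩ : ℂ) else 0, fun s h => by
    beta_reduce
    by_cases hh : h ∈ SOrtho ε
    · rw [dif_pos hh, dif_pos ((SOrtho ε).mul_mem s.2 hh), ← Units.val_mul, ← map_mul]
      rfl
    · rw [dif_neg hh, dif_neg fun h1 => hh (((SOrtho ε).mul_mem_cancel_left s.2).1 h1), mul_zero]⟩

omit hε in
theorem tauBase_one : (tauBase μ).1 1 = 1 := by
  exact (dif_pos (SOrtho ε).one_mem).trans (congrArg Units.val (map_one μ))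

omit hε in
theorem tauBase_refl {r : Ortho ε} (hr : r ∉ SOrtho ε) : (tauBase μ).1 r = 0 := dif_neg hr

theorem tau_eq {r : Ortho ε} (hr : r ∉ SOrtho ε) (f : tauSpace μ) :
    f = f.1 1 • tauBase μ + f.1 r • tauInd μ r (tauBase μ) := by
  refine tau_ext hε hr ?_ ?_
  · change _ = f.1 1 * (tauBase μ).1 1 + f.1 r * (tauInd μ r (tauBase μ)).1 1
    rw [tauInd_refl_one, tauBase_one, tauBase_refl hr, mul_one, mul_zero, add_zero]
  · change _ = f.1 1 * (tauBase μ).1 r + f.1 r * (tauInd μ r (tauBase μ)).1 r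
    rw [tauInd_refl_refl hε hr, tauBase_one, tauBase_refl hr, mul_one, mul_zero, zero_add]

omit hε in
theorem tauBase_ne_zero : tauBase μ ≠ 0 := fun h => by
  have h1 := tauBase_one (μ := μ)
  rw [h] at h1
  exact zero_ne_one h1

theorem finrank_tauSpace (h2 : (2 : F) ≠ 0) : Module.finrank ℂ (tauSpace μ) = 2 := by
  have hr := conjO_notMem (ε := ε) h2
  let e : tauSpace μ ≃ₗ[ℂ] ℂ × ℂ := LinearEquiv.ofBijective
    { toFun := fun f => (f.1 1, f.1 (conjO ε))
      map_add' := fun _ _ => rfl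
      map_smul' := fun _ _ => rfl }
    ⟨fun f f' h => tau_ext hε hr (congrArg Prod.fst h) (congrArg Prod.snd h), fun p => by
      refine ⟨p.1 • tauBase μ + p.2 • tauInd μ (conjO ε) (tauBase μ), Prod.ext ?_ ?_⟩
      · change p.1 * (tauBase μ).1 1 + p.2 * (tauInd μ (conjO ε) (tauBase μ)).1 1 = p.1
        rw [tauInd_refl_one, tauBase_one, tauBase_refl hr, mul_one, mul_zero, add_zero]
      · change p.1 * (tauBase μ).1 (conjO ε) + p.2 * (tauInd μ (conjO ε) (tauBase μ)).1 (conjO ε) = p.2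
        rw [tauInd_refl_refl hε hr, tauBase_one, tauBase_refl hr, mul_one, mul_zero, zero_add]⟩
  rw [e.finrank_eq, Module.finrank_prod, Module.finrank_self]

/-- Rotations act on the coordinates at `1` and at a reflection by `μ` and `μ⁻¹`. A rotation on
which these differ separates the coordinates, and a reflection exchanges them. -/
theorem tauInd_isIrreducible (h2 : (2 : F) ≠ 0) (hμ : μ ≠ μ⁻¹) : (tauInd μ).IsIrreducible := by
  have hr := conjO_notMem (ε := ε) h2
  obtain ⟨s, hs⟩ : ∃ s, μ s ≠ (μ s)⁻¹ := by
    by_contra hcon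
    push Not at hcon
    exact hμ (MonoidHom.ext hcon)
  have : Nontrivial (tauSpace μ) := ⟨_, _, tauBase_ne_zero⟩
  refine isIrreducible_of_forall fun X f hf hf0 f' => ?_
  have key : ∀ f ∈ X, f.1 1 ≠ 0 → f' ∈ X := by
    intro f hf hf1
    have hb : tauBase μ ∈ X := by
      have h3 : ((μ s : ℂ) - ((μ s)⁻¹ : ℂˣ)) * f.1 1 ≠ 0 :=
        mul_ne_zero (sub_ne_zero.2 fun h => hs (Units.ext h)) hf1
      -- Subtracting `μ(s)⁻¹ f` removes the coordinate at the reflection and leaves a nonzero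
      -- multiple of the base vector.
      have h4 : tauInd μ (s : Ortho ε) f - (((μ s)⁻¹ : ℂˣ) : ℂ) • f
          = (((μ s : ℂ) - ((μ s)⁻¹ : ℂˣ)) * f.1 1) • tauBase μ := by
        refine tau_ext hε hr ?_ ?_
        · change (tauInd μ (s : Ortho ε) f).1 1 - _ * f.1 1 = _ * (tauBase μ).1 1
          rw [tauInd_so_one, tauBase_one]
          ring
        · change (tauInd μ (s : Ortho ε) f).1 (conjO ε) - _ * f.1 (conjO ε)
            = _ * (tauBase μ).1 (conjO ε)
          rw [tauInd_so_refl hε hr, tauBase_refl hr]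
          ring
      have h5 : (((μ s : ℂ) - ((μ s)⁻¹ : ℂˣ)) * f.1 1) • tauBase μ ∈ X.toSubmodule := by
        rw [← h4]
        exact X.toSubmodule.sub_mem (X.apply_mem_toSubmodule _ hf) (X.toSubmodule.smul_mem _ hf)
      have h6 := X.toSubmodule.smul_mem (((μ s : ℂ) - ((μ s)⁻¹ : ℂˣ)) * f.1 1)⁻¹ h5
      rwa [smul_smul, inv_mul_cancel₀ h3, one_smul] at h6
    rw [tau_eq hε hr f']
    exact X.toSubmodule.add_mem (X.toSubmodule.smul_mem _ hb)
      (X.toSubmodule.smul_mem _ (X.apply_mem_toSubmodule _ hb))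
  by_cases hf1 : f.1 1 = 0
  · refine key _ (X.apply_mem_toSubmodule (conjO ε) hf) ?_
    rw [tauInd_refl_one]
    intro h3
    exact hf0 (tau_ext hε hr hf1 h3)
  · exact key f hf hf1

theorem invariants_tauInd (h2 : (2 : F) ≠ 0) (hμ : μ ≠ 1) :
    invariants (resSO (tauInd μ)) = ⊥ := by
  have hr := conjO_notMem (ε := ε) h2
  obtain ⟨s, hs⟩ : ∃ s, μ s ≠ 1 := by
    by_contra hcon
    push Not at hcon
    exact hμ (MonoidHom.ext hcon)
  rw [eq_bot_iff]
  intro f hf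
  have h3 : tauInd μ (s : Ortho ε) f = f := (mem_invariants _ f).1 hf s
  have e1 := tauInd_so_one f s
  have e2 := tauInd_so_refl hε hr f s
  rw [h3] at e1 e2
  refine (Submodule.mem_bot ℂ).2 (tau_ext hε hr ?_ ?_)
  · by_contra h0
    exact hs (Units.ext ((mul_eq_right₀ h0).1 e1.symm))
  · by_contra h0
    exact hs (inv_eq_one.1 (Units.ext ((mul_eq_right₀ h0).1 e2.symm)))

/-- For `μ² = 1` the special orthogonal group acts by scalars. -/
theorem tauInd_so_of_sq (h2 : (2 : F) ≠ 0) (hμ : μ ^ 2 = 1) (s : SOrtho ε) (f : tauSpace μ) :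
    tauInd μ (s : Ortho ε) f = (μ s : ℂ) • f := by
  have h3 : (μ s)⁻¹ = μ s := by
    have h4 : μ s ^ 2 = 1 := DFunLike.congr_fun hμ s
    rw [sq] at h4
    exact inv_eq_of_mul_eq_one_left h4
  have hr := conjO_notMem (ε := ε) h2
  refine tau_ext hε hr ?_ ?_
  · exact tauInd_so_one f s
  · exact (tauInd_so_refl hε hr f s).trans (by rw [h3]; rfl)

/-- The eigenspaces of a reflection on `τ_μ`, `μ² = 1`. -/
def tauEigen (h2 : (2 : F) ≠ 0) (hμ : μ ^ 2 = 1) {r : Ortho ε} (hr : r ∉ SOrtho ε) (η : ℂ) :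
    Subrepresentation (tauInd μ) where
  toSubmodule := LinearMap.ker (tauInd μ r - η • LinearMap.id)
  apply_mem_toSubmodule a f hf := by
    have hf' : tauInd μ r f = η • f := sub_eq_zero.1 hf
    have hso : ∀ s : SOrtho ε, tauInd μ s f ∈ LinearMap.ker (tauInd μ r - η • LinearMap.id) := by
      intro s
      rw [tauInd_so_of_sq hε h2 hμ]
      exact Submodule.smul_mem _ _ hf
    by_cases ha : a ∈ SOrtho ε
    · exact hso ⟨a, ha⟩
    · obtain ⟨s, rfl⟩ := exists_so_mul hε hr ha
      rw [map_mul, Module.End.mul_apply, hf', map_smul]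
      exact Submodule.smul_mem _ _ (hso s)

theorem mem_tauEigen (h2 : (2 : F) ≠ 0) (hμ : μ ^ 2 = 1) {r : Ortho ε} (hr : r ∉ SOrtho ε) (η : ℂ)
    (f : tauSpace μ) : f ∈ tauEigen hε h2 hμ hr η ↔ tauInd μ r f = η • f := by
  change tauInd μ r f - η • f = 0 ↔ _
  rw [sub_eq_zero]

theorem finrank_tauEigen (h2 : (2 : F) ≠ 0) (hμ : μ ^ 2 = 1) {r : Ortho ε} (hr : r ∉ SOrtho ε)
    {η : ℂ} (hη : η * η = 1) : Module.finrank ℂ (tauEigen hε h2 hμ hr η).toSubmodule = 1 := by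
  -- The vector with coordinates `1` at the identity and `η` at `r`; it is an eigenvector because
  -- `η² = 1`.
  let v : tauSpace μ := tauBase μ + η • tauInd μ r (tauBase μ)
  have hv1 : v.1 1 = 1 := by
    change (tauBase μ).1 1 + η * (tauInd μ r (tauBase μ)).1 1 = 1
    rw [tauInd_refl_one, tauBase_one, tauBase_refl hr, mul_zero, add_zero]
  have hvr : v.1 r = η := by
    change (tauBase μ).1 r + η * (tauInd μ r (tauBase μ)).1 r = η
    rw [tauInd_refl_refl hε hr, tauBase_one, tauBase_refl hr, mul_one, zero_add]
  have hv : v ∈ tauEigen hε h2 hμ hr η := by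
    rw [mem_tauEigen]
    refine tau_ext hε hr ?_ ?_
    · change _ = η * v.1 1
      rw [tauInd_refl_one, hvr, hv1, mul_one]
    · change _ = η * v.1 r
      rw [tauInd_refl_refl hε hr, hvr, hv1, hη]
  refine _root_.finrank_eq_one (⟨v, hv⟩ : (tauEigen hε h2 hμ hr η).toSubmodule) ?_ ?_
  · intro h0
    have h3 : v = 0 := congrArg Subtype.val h0
    rw [h3] at hv1
    exact zero_ne_one hv1
  · rintro ⟨w, hw⟩
    have hw' := (mem_tauEigen hε h2 hμ hr η w).1 hw
    refine ⟨w.1 1, Subtype.ext (tau_ext hε hr ?_ ?_)⟩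
    · change w.1 1 * v.1 1 = w.1 1
      rw [hv1, mul_one]
    · change w.1 1 * v.1 r = w.1 r
      have h3 := tauInd_refl_one (r := r) w
      rw [hw'] at h3
      rw [hvr, ← h3]
      exact mul_comm _ _

end Tau

end OrthoReps

/-! ### Quadratic characters of the rotation group -/

section OrthoReps

variable {F : Type u} [Field F] {ε : F}

/-- Squaring in the special orthogonal group. -/
def soSq (hε : ¬ IsSquare ε) : SOrtho ε →* SOrtho ε where
  toFun s := s * s
  map_one' := mul_one 1
  map_mul' s t := by
    have h : s * t = t * s := Subtype.ext (so_comm hε s.2 t.2)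
    rw [mul_assoc, ← mul_assoc t, ← h, mul_assoc, mul_assoc]

theorem eq_one_or_of_soSq (hε : ¬ IsSquare ε) (h2 : (2 : F) ≠ 0) {s : SOrtho ε}
    (hs : soSq hε s = 1) {z : Fin 2 → F} {hz : nrm ε z = 1} (hsz : (s : Ortho ε) = orthoOf hε z hz) :
    z 1 = 0 ∧ (z 0 = 1 ∨ z 0 = -1) := by
  have hε0 := eps_ne_zero hε
  have h1 : (orthoOf hε z hz * orthoOf hε z hz : Ortho ε) = 1 := by
    rw [← hsz]
    exact congrArg Subtype.val hs
  have h3 : mulU ε z (mulU ε z ![1, 0]) = ![1, 0] :=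
    LinearEquiv.congr_fun (congrArg Subtype.val h1) ![1, 0]
  have h4 := congrFun h3 0
  have h5 := congrFun h3 1
  rw [mulU_e0] at h4 h5
  rw [mulU_zero] at h4
  rw [mulU_one] at h5
  rw [nrm] at hz
  simp only [Matrix.cons_val_zero, Matrix.cons_val_one] at h4 h5
  have h6 : z 1 = 0 := by
    have h7 : 2 * ε * (z 1 * z 1) = 0 := by linear_combination h4 - hz
    rcases mul_eq_zero.1 h7 with h8 | h8
    · exact absurd h8 (mul_ne_zero h2 hε0)
    · exact mul_self_eq_zero.1 h8
  refine ⟨h6, mul_self_eq_one_iff.1 ?_⟩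
  rw [h6] at hz
  linear_combination hz

variable [Fintype F]

/-- The index of the subgroup of squares is the order of the kernel of squaring, and only
multiplication by `1` or `-1` lies in that kernel. -/
theorem index_range_soSq (hε : ¬ IsSquare ε) (h2 : (2 : F) ≠ 0) :
    (soSq hε).range.index = 1 ∨ (soSq hε).range.index = 2 := by
  classical
  have h1 := (soSq hε).range.card_mul_index
  have h3 := (soSq hε).ker.card_mul_index
  rw [Subgroup.index_ker] at h3
  have hpos : 0 < Nat.card (soSq hε).range := Nat.card_pos
  have h4 : (soSq hε).range.index = Nat.card (soSq hε).ker := by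
    apply Nat.eq_of_mul_eq_mul_left hpos
    rw [h1, ← h3, mul_comm]
  have h5 : Nat.card (soSq hε).ker ≤ 2 := by
    have hz : ∀ s : (soSq hε).ker, ∃ z hz, ((s : SOrtho ε) : Ortho ε) = orthoOf hε z hz :=
      fun s => exists_orthoOf hε s.1.2
    choose z hz hsz using hz
    have hk := fun s : (soSq hε).ker => eq_one_or_of_soSq hε h2 s.2 (hsz s)
    have hinj : Function.Injective fun s : (soSq hε).ker => decide (z s 0 = 1) := by
      intro s t hst
      have h6 : z s 0 = z t 0 := by
        have hst' : (z s 0 = 1) ↔ (z t 0 = 1) := decide_eq_decide.1 hst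
        rcases (hk s).2 with h | h <;> rcases (hk t).2 with h' | h'
        · rw [h, h']
        · rw [h, hst'.1 h]
        · rw [h', hst'.2 h']
        · rw [h, h']
      have h7 : z s = z t := plane_ext h6 ((hk s).1.trans (hk t).1.symm)
      refine Subtype.ext (Subtype.ext ?_)
      rw [hsz s, hsz t]
      congr 1
    simpa using Nat.card_le_card_of_injective _ hinj
  have h6 : 0 < Nat.card (soSq hε).ker := Nat.card_pos
  omega

/-- The character of order two of the special orthogonal group is unique. -/
theorem char_eq_of_sq_eq_one (hε : ¬ IsSquare ε) (h2 : (2 : F) ≠ 0) {μ χ : SOrtho ε →* ℂˣ}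
    (hμ : μ ≠ 1) (hμ2 : μ ^ 2 = 1) (hχ : χ ≠ 1) (hχ2 : χ ^ 2 = 1) : χ = μ := by
  -- A non-trivial character with square `1` is trivial on squares, so the squares have index two
  -- and the character is `-1` off them; this determines it.
  have key : ∀ ν : SOrtho ε →* ℂˣ, ν ≠ 1 → ν ^ 2 = 1 →
      (soSq hε).range.index = 2 ∧
      ∀ s, (s ∈ (soSq hε).range → ν s = 1) ∧ (s ∉ (soSq hε).range → ν s = -1) := by
    intro ν hν hν2
    have h1 : ∀ s ∈ (soSq hε).range, ν s = 1 := by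
      rintro _ ⟨t, rfl⟩
      change ν (t * t) = 1
      rw [map_mul, ← sq]
      exact DFunLike.congr_fun hν2 t
    have h3 : (soSq hε).range.index = 2 := by
      rcases index_range_soSq hε h2 with h | h
      · exfalso
        rw [Subgroup.index_eq_one] at h
        exact hν (MonoidHom.ext fun s => h1 s (h ▸ Subgroup.mem_top s))
      · exact h
    refine ⟨h3, fun s => ⟨h1 s, fun hs => ?_⟩⟩
    have h4 : ν s = 1 ∨ ν s = -1 := by
      have h5 : ν s ^ 2 = 1 := DFunLike.congr_fun hν2 s
      rw [Units.ext_iff, Units.val_pow_eq_pow_val] at h5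
      exact (sq_eq_one_iff.1 h5).imp Units.ext Units.ext
    refine h4.resolve_left fun h5 => hν (MonoidHom.ext fun t => ?_)
    by_cases ht : t ∈ (soSq hε).range
    · exact h1 t ht
    · have h6 : t * s ∈ (soSq hε).range := by
        rw [Subgroup.mul_mem_iff_of_index_two h3]
        exact iff_of_false ht hs
      have h7 := h1 _ h6
      rwa [map_mul, h5, mul_one] at h7
  ext s
  by_cases hs : s ∈ (soSq hε).range
  · rw [((key μ hμ hμ2).2 s).1 hs, ((key χ hχ hχ2).2 s).1 hs]
  · rw [((key μ hμ hμ2).2 s).2 hs, ((key χ hχ hχ2).2 s).2 hs]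

end OrthoReps

/-! ### Irreducible representations of the orthogonal group -/

section Irreducible

variable {F : Type u} [Field F] {ε : F} {T : Type*} [AddCommGroup T] [Module ℂ T]
  {τ : Representation ℂ (Ortho ε) T}

/-- The invariants of the special orthogonal group are stable under the orthogonal group. -/
def soInvariants (τ : Representation ℂ (Ortho ε) T) :
    Subrepresentation τ where
  toSubmodule := invariants (resSO τ)
  apply_mem_toSubmodule a v hv := by
    have hv' : ∀ s ∈ SOrtho ε, τ s v = v := fun s hs => (mem_invariants _ v).1 hv ⟨s, hs⟩
    rw [mem_invariants]
    rintro ⟨s, hs⟩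
    change τ s (τ a v) = τ a v
    have h1 : s * a = a * (a⁻¹ * s * a) := by group
    rw [← Module.End.mul_apply, ← map_mul, h1, map_mul, Module.End.mul_apply, hv']
    have h3 : (SOrtho ε).Normal := MonoidHom.normal_ker _
    simpa using h3.conj_mem s hs a⁻¹

/-- The rotations form a normal subgroup, so their invariants are a subrepresentation. -/
theorem invariants_eq_bot_or_top (hτ : τ.IsIrreducible) :
    invariants (resSO τ) = ⊥ ∨ ∀ s ∈ SOrtho ε, τ s = LinearMap.id := by
  by_cases h : ∃ v ∈ invariants (resSO τ), v ≠ 0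
  · obtain ⟨v, hv, hv0⟩ := h
    refine Or.inr fun s hs => LinearMap.ext fun w => ?_
    have h1 : w ∈ invariants (resSO τ) := IsIrred.mem hτ (soInvariants τ) hv hv0 w
    exact (mem_invariants _ w).1 h1 ⟨s, hs⟩
  · push Not at h
    exact Or.inl ((Submodule.eq_bot_iff _).2 h)

/-- The representation factors through the quotient of order two: all reflections act by one
operator, a scalar by Schur's lemma, and its square is `1`. -/
theorem trivial_or_isSgn [Fintype F] [DecidableEq F] (hε : ¬ IsSquare ε) (h2 : (2 : F) ≠ 0)
    (hτ : τ.IsIrreducible)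
    (hso : ∀ s ∈ SOrtho ε, τ s = LinearMap.id) :
    Module.finrank ℂ T = 1 ∧ ((∀ a, τ a = LinearMap.id) ∨ IsSgn τ) := by
  have hr := conjO_notMem (ε := ε) h2
  have hout : ∀ a ∉ SOrtho ε, τ a = τ (conjO ε) := by
    intro a ha
    obtain ⟨s, rfl⟩ := exists_so_mul hε hr ha
    rw [map_mul, hso _ s.2]
    rfl
  obtain ⟨c, hc⟩ := IsIrred.exists_scalar hτ ⟨τ (conjO ε), fun a => by
    by_cases ha : a ∈ SOrtho ε
    · rw [hso a ha]; rfl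
    · rw [hout a ha]⟩
  have hc' : ∀ v, τ (conjO ε) v = c • v := hc
  have hfin : Module.finrank ℂ T = 1 := IsIrred.finrank_eq_one hτ fun a => by
    by_cases ha : a ∈ SOrtho ε
    · exact ⟨1, fun v => by rw [hso a ha, one_smul]; rfl⟩
    · exact ⟨c, fun v => by rw [hout a ha, hc']⟩
  refine ⟨hfin, ?_⟩
  obtain ⟨v, hv⟩ := IsIrred.exists_ne hτ
  have h3 : c * c = 1 := by
    have h4 : τ (conjO ε * conjO ε) v = v := by rw [mul_self_notMem hε hr, map_one]; rfl
    rw [map_mul, Module.End.mul_apply, hc', hc', smul_smul] at h4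
    exact smul_left_injective ℂ hv (h4.trans (one_smul ℂ v).symm)
  rcases mul_self_eq_one_iff.1 h3 with h4 | h4
  · left
    intro a
    by_cases ha : a ∈ SOrtho ε
    · exact hso a ha
    · rw [hout a ha]
      exact LinearMap.ext fun w => by rw [hc', h4, one_smul]; rfl
  · right
    refine ⟨hfin, fun a => ⟨fun ha => hso a ha, fun ha => ?_⟩⟩
    rw [hout a ha]
    exact LinearMap.ext fun w => by rw [hc', h4, neg_one_smul]; rfl

/-- A one-dimensional representation on which the special orthogonal group acts through `μ`,
`μ² = 1`, is an eigenspace of a reflection in the induced representation. -/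
theorem equiv_tauEigen (hε : ¬ IsSquare ε) (h2 : (2 : F) ≠ 0) {μ : SOrtho ε →* ℂˣ}
    (hμ : μ ^ 2 = 1) {r : Ortho ε} (hr : r ∉ SOrtho ε) (hT : Module.finrank ℂ T = 1)
    (hso : ∀ (s : SOrtho ε) (v : T), τ s v = (μ s : ℂ) • v) :
    Nonempty (Representation.Equiv τ (subRep (tauEigen hε h2 hμ hr 1))) ∨
    Nonempty (Representation.Equiv τ (subRep (tauEigen hε h2 hμ hr (-1)))) := by
  have hτ := isIrreducible_of_finrank_eq_one (ρ := τ) hT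
  obtain ⟨v, hv⟩ := IsIrred.exists_ne hτ
  have hex := (finrank_eq_one_iff_of_nonzero' v hv).1 hT
  obtain ⟨l, hl⟩ := Module.Projective.exists_dual_ne_zero ℂ hv
  obtain ⟨c, hc⟩ := hex (τ r v)
  have hc' : ∀ w, τ r w = c • w := by
    intro w
    obtain ⟨d, rfl⟩ := hex w
    rw [map_smul, ← hc, smul_comm]
  have hcc : c * c = 1 := by
    have h4 : τ (r * r) v = v := by rw [mul_self_notMem hε hr, map_one]; rfl
    rw [map_mul, Module.End.mul_apply, hc', hc', smul_smul] at h4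
    exact smul_left_injective ℂ hv (h4.trans (one_smul ℂ v).symm)
  have key : ∀ η : ℂ, c = η → η * η = 1 →
      Nonempty (Representation.Equiv τ (subRep (tauEigen hε h2 hμ hr η))) := by
    rintro η rfl hη
    -- Frobenius reciprocity: a linear functional `l` turns a vector into its matrix coefficient `a
    -- ↦ l (τ a x)`.
    let f : T →ₗ[ℂ] (tauEigen hε h2 hμ hr c).toSubmodule :=
      { toFun := fun x => ⟨⟨fun a => l (τ a x), fun s h => by
          beta_reduce
          rw [map_mul, Module.End.mul_apply, hso, map_smul, smul_eq_mul]⟩, by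
          refine (mem_tauEigen hε h2 hμ hr c _).2 (Subtype.ext (funext fun a => ?_))
          change l (τ (a * r) x) = c * l (τ a x)
          rw [map_mul, Module.End.mul_apply, hc', map_smul, map_smul, smul_eq_mul]⟩
        map_add' := fun x y => Subtype.ext (Subtype.ext (funext fun a => by
          change l (τ a (x + y)) = l (τ a x) + l (τ a y)
          rw [map_add, map_add]))
        map_smul' := fun d x => Subtype.ext (Subtype.ext (funext fun a => by
          change l (τ a (d • x)) = d * l (τ a x)
          rw [map_smul, map_smul, smul_eq_mul])) }
    let φ : IntertwiningMap τ (subRep (tauEigen hε h2 hμ hr c)) :=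
      ⟨f, fun b => LinearMap.ext fun x => Subtype.ext (Subtype.ext (funext fun a => by
        change l (τ a (τ b x)) = l (τ (a * b) x)
        rw [map_mul, Module.End.mul_apply]))⟩
    have hirr : Representation.IsIrreducible
        (V := (tauEigen hε h2 hμ hr c).toSubmodule) (subRep (tauEigen hε h2 hμ hr c)) := by
      apply isIrreducible_of_finrank_eq_one
      exact finrank_tauEigen hε h2 hμ hr hη
    refine IsIrred.nonempty_equiv hτ hirr φ ?_
    intro h0
    apply hl
    have h5 : (φ v).1.1 1 = 0 := by
      have h6 : φ v = 0 := DFunLike.congr_fun h0 v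
      rw [h6]
      rfl
    have h7 : l (τ 1 v) = 0 := h5
    rwa [map_one] at h7
  rcases mul_self_eq_one_iff.1 hcc with h4 | h4
  · exact Or.inl (key 1 h4 (one_mul 1))
  · exact Or.inr (key (-1) h4 (by ring))

end Irreducible

/-! ### The correspondence in the Schrödinger model -/

section Correspondence

variable {F : Type u} [Field F] [Fintype F] [DecidableEq F] {ε : F} {ψ : AddChar F ℂ}
  {R : Representation ℂ (Ortho ε × SL2 F) ((Fin 2 → F) → ℂ)}
  {T : Type*} [AddCommGroup T] [Module ℂ T] {τ : Representation ℂ (Ortho ε) T}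

theorem IsModel.finrank_theta_of_trivial (hR : IsModel ε ψ R) (hε : ¬ IsSquare ε)
    (h2 : (2 : F) ≠ 0) (hT : Module.finrank ℂ T = 1) (hτ : ∀ a, τ a = LinearMap.id) :
    Module.finrank ℂ (ThetaSpace R τ) = Fintype.card F := by
  have : FiniteDimensional ℂ T := Module.finite_of_finrank_eq_succ hT
  have h1 := hR.finrank_theta hε h2 τ
  have e1 : invariants τ = ⊤ :=
    eq_top_iff.2 fun v _ => (mem_invariants _ v).2 fun a => by rw [hτ]; rfl
  have e2 : invariants (resSO τ) = ⊤ :=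
    eq_top_iff.2 fun v _ => (mem_invariants _ v).2 fun a => by
      change τ a v = v
      rw [hτ]; rfl
  rw [e1, e2, finrank_top, hT] at h1
  omega

theorem IsModel.two_mul_finrank_theta (hR : IsModel ε ψ R) (hε : ¬ IsSquare ε)
    (h2 : (2 : F) ≠ 0) [FiniteDimensional ℂ T] (hτ : invariants (resSO τ) = ⊥) :
    2 * Module.finrank ℂ (ThetaSpace R τ) = (Fintype.card F - 1) * Module.finrank ℂ T := by
  have h1 := hR.finrank_theta hε h2 τ
  have e1 : invariants τ = ⊥ := by
    rw [eq_bot_iff, ← hτ]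
    exact fun v hv => (mem_invariants _ v).2 fun a => (mem_invariants _ v).1 hv a
  rw [e1, hτ, finrank_bot] at h1
  omega

/-- Without rotation invariants the dimension formula is positive; with them `τ` is trivial or
`sgn`, and the trivial representation gives dimension `q`. -/
theorem IsModel.theta_nontrivial (hR : IsModel ε ψ R) (hε : ¬ IsSquare ε)
    (h2 : (2 : F) ≠ 0) (hτ : τ.IsIrreducible) (hsgn : ¬ IsSgn τ) :
    Nontrivial (ThetaSpace R τ) := by
  have := IsIrred.finiteDimensional hτ
  have := IsIrred.nontrivial hτ
  have h3 := three_le_card h2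
  apply Module.nontrivial_of_finrank_pos (R := ℂ)
  rcases invariants_eq_bot_or_top hτ with h | h
  · have h1 := hR.two_mul_finrank_theta hε h2 h
    have h4 : 0 < (Fintype.card F - 1) * Module.finrank ℂ T :=
      Nat.mul_pos (by omega) Module.finrank_pos
    omega
  · obtain ⟨h4, h5 | h5⟩ := trivial_or_isSgn hε h2 hτ h
    · rw [hR.finrank_theta_of_trivial hε h2 h4 h5]
      omega
    · exact absurd h5 hsgn

theorem IsModel.theta_isIrreducible (hR : IsModel ε ψ R) (h : IsSchrodingerDatum (betaForm ε) ψ)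
    (hε : ¬ IsSquare ε) (hτ : τ.IsIrreducible) (hsgn : ¬ IsSgn τ) :
    (Theta R τ).IsIrreducible :=
  have := hR.theta_nontrivial hε h.two_ne hτ hsgn
  EtaCorr.theta_isIrreducible (hR.commutantSpanned h hε) hτ

/-- At a point of the support the character `t ↦ ψ(t N(x))` is trivial, so `N(x) = 0`, and the form
is anisotropic. -/
theorem eq_zero_of_low_fixed (hR : IsModel ε ψ R) (h : IsSchrodingerDatum (betaForm ε) ψ)
    (hε : ¬ IsSquare ε) {φ : (Fin 2 → F) → ℂ} (hφ : ∀ t, R (1, low t) φ = φ) {x : Fin 2 → F}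
    (hx : x ≠ 0) : φ x = 0 := by
  by_contra h0
  refine hx (nrm_eq_zero hε (eq_zero_of_forall_char h.psi_ne fun t => ?_))
  have h1 := congrFun (hφ (-(2 * t))) x
  rw [hR.apply_low h] at h1
  have h3 : ψ (-(-(2 * t) / 2) * nrm ε x) * φ x = φ x := h1
  have h4 := (mul_eq_right₀ h0).1 h3
  rwa [show -(-(2 * t) / 2) = t by have := h.two_ne; field_simp] at h4

/-- If `Θ(τ)` has vectors fixed by the unipotent elements, then `τ` is trivial. -/
theorem IsModel.trivial_of_low_fixed (hR : IsModel ε ψ R)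
    (h : IsSchrodingerDatum (betaForm ε) ψ) (hε : ¬ IsSquare ε) (hτ : τ.IsIrreducible)
    {f : ThetaSpace R τ} (hf : f ≠ 0) (hlow : ∀ t, Theta R τ (low t) f = f) (a : Ortho ε) :
    τ a = LinearMap.id := by
  refine LinearMap.ext fun v => IsIrred.injective hτ f hf ?_
  -- The values of `f` are supported at the origin, which every isometry fixes; so the orthogonal
  -- group acts trivially on them.
  have h0 : ∀ x : Fin 2 → F, x ≠ 0 → f v x = 0 := fun x hx =>
    eq_zero_of_low_fixed hR h hε (fun t => DFunLike.congr_fun (hlow t) v) hx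
  rw [map_rep]
  change R (a, 1) (f v) = f v
  rw [hR.perm]
  funext x
  rw [permOp_apply]
  by_cases hx : x = 0
  · rw [hx, map_zero]
  · rw [h0 x hx, h0]
    intro h1
    exact hx (by rw [← self_apply_inv a x, h1, map_zero])

theorem IsModel.theta_inFiltration_two (hR : IsModel ε ψ R)
    (h : IsSchrodingerDatum (betaForm ε) ψ) (hε : ¬ IsSquare ε) (hτ : τ.IsIrreducible)
    (hsgn : ¬ IsSgn τ) : InFiltration 2 (Theta R τ) := by
  have := hR.theta_nontrivial hε h.two_ne hτ hsgn
  obtain ⟨v, hv⟩ := IsIrred.exists_ne hτ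
  refine hR.weil.inFiltration_two h hε (hR.theta_isIrreducible h hε hτ hsgn) (thetaEval R τ v) ?_
  intro h0
  obtain ⟨f, hf⟩ := exists_ne (0 : ThetaSpace R τ)
  refine hf (thetaEval_injective R hτ hv ?_)
  rw [h0]
  rfl

/-- An irreducible representation of lower rank is one-dimensional or degenerate. -/
theorem hasTensorRank_two {E : Type*} [AddCommGroup E] [Module ℂ E]
    {σ : Representation ℂ (SL2 F) E} (hσ : σ.IsIrreducible) (h : InFiltration 2 σ)
    (h1 : Module.finrank ℂ E ≠ 1) (hd : ¬ IsDegenerate σ) : HasTensorRank 2 σ := by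
  refine ⟨h, fun j hj hj' => ?_⟩
  rcases InFiltration.one_cases hσ (InFiltration.mono (show j ≤ 1 by omega) hj') with h3 | h3
  · exact h1 h3.1
  · exact hd h3

/-- One-dimensional representations of the orthogonal group that are not trivial on the special
orthogonal group correspond to representations of tensor rank one. -/
theorem IsModel.hasTensorRank_one (hR : IsModel ε ψ R)
    (h : IsSchrodingerDatum (betaForm ε) ψ) (hε : ¬ IsSquare ε) (hT : Module.finrank ℂ T = 1)
    (hso : ¬ ∀ s ∈ SOrtho ε, τ s = LinearMap.id) :
    2 * Module.finrank ℂ (ThetaSpace R τ) = Fintype.card F - 1 ∧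
      HasTensorRank 1 (Theta R τ) := by
  have h2 := h.two_ne
  have hτ : τ.IsIrreducible := isIrreducible_of_finrank_eq_one hT
  have := IsIrred.finiteDimensional hτ
  have hsgn : ¬ IsSgn τ := fun hs => hso fun s hs' => (hs.2 s).1 hs'
  have hdim := hR.two_mul_finrank_theta hε h2
    ((invariants_eq_bot_or_top hτ).resolve_right hso)
  rw [hT, mul_one] at hdim
  have hirr := hR.theta_isIrreducible h hε hτ hsgn
  have hnt := hR.theta_nontrivial hε h2 hτ hsgn
  have hlow : ∀ f : ThetaSpace R τ, f ≠ 0 → ¬ ∀ t, Theta R τ (low t) f = f := fun f hf hl =>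
    hso fun s _ => hR.trivial_of_low_fixed h hε hτ hf hl s
  obtain ⟨f, hf⟩ := exists_ne (0 : ThetaSpace R τ)
  refine ⟨hdim, IsDegenerate.inFiltration_one ⟨hirr, Or.inl hdim, fun h3 hgl => ?_⟩, ?_⟩
  -- For `q = 3` the representation is one-dimensional. Invariance under conjugation by `diag(1,
  -- -1)` makes `low (t / 2)` and its inverse act by one scalar `c`, so `low t` acts by `c² = 1`;
  -- but there are no vectors fixed by the unipotent elements.
  · obtain ⟨e⟩ := hgl (glDiag (-1)) (glConj (glDiag (-1))) fun g => rfl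
    have hone : Module.finrank ℂ (ThetaSpace R τ) = 1 := by omega
    have hex := (finrank_eq_one_iff_of_nonzero' f hf).1 hone
    refine hlow f hf fun t => ?_
    obtain ⟨c, hc⟩ := hex (Theta R τ (low (t / 2)) f)
    obtain ⟨d, hd⟩ := hex (e f)
    have h4 := Equiv.map_rep e (low (t / 2)) f
    have h5 : Theta R τ (glConj (glDiag (-1)) (low (t / 2))) (e f) = e (c • f) := by
      rw [hc]; exact h4.symm
    rw [glConj_glDiag_low, map_smul] at h5
    have h6 : e f ≠ 0 := fun h0 => hf (e.toLinearEquiv.map_eq_zero_iff.1 h0)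
    have hd0 : d ≠ 0 := by
      rintro rfl
      exact h6 (by rw [← hd, zero_smul])
    have h7 : Theta R τ (low (-(t / 2))) f = c • f := by
      rw [← hd, map_smul, smul_comm] at h5
      have h8 := smul_right_injective _ hd0 h5
      simpa using h8
    have h8 : t = t / 2 + t / 2 := by field_simp; norm_num
    have h9 : Theta R τ (low (t / 2)) (Theta R τ (low (-(t / 2))) f) = f := by
      rw [← Module.End.mul_apply, ← map_mul, ← low_add, add_neg_cancel, low_zero, map_one]
      rfl
    rw [h7, map_smul, ← hc, smul_smul] at h9
    rw [h8, low_add, map_mul, Module.End.mul_apply, ← hc, map_smul, ← hc, smul_smul]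
    exact h9
  · intro j hj hj'
    obtain rfl : j = 0 := by omega
    exact hlow f hf fun t => (InFiltration.zero_cases hirr hj').2 _ f

end Correspondence

/-! ### Maps out of the induced representation -/

section Frobenius

variable {F : Type u} [Field F] {ε : F} {μ : SOrtho ε →* ℂˣ} {E : Type*} [AddCommGroup E]
  [Module ℂ E]

theorem tauInd_so_tauBase (hε : ¬ IsSquare ε) (h2 : (2 : F) ≠ 0) (s : SOrtho ε) :
    tauInd μ (s : Ortho ε) (tauBase μ) = (μ s : ℂ) • tauBase μ := by
  have hr := conjO_notMem (ε := ε) h2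
  refine tau_ext hε hr (tauInd_so_one _ s) ?_
  rw [tauInd_so_refl hε hr, tauBase_refl hr, mul_zero]
  change 0 = _ * (tauBase μ).1 _
  rw [tauBase_refl hr, mul_zero]

/-- Frobenius reciprocity for `τ_μ`. -/
theorem exists_frobenius (hε : ¬ IsSquare ε) (h2 : (2 : F) ≠ 0) (ρ : Representation ℂ (Ortho ε) E)
    {φ : E} (hφ : ∀ s : SOrtho ε, ρ s φ = (μ s : ℂ) • φ) :
    ∃ f : IntertwiningMap (tauInd μ) ρ, f (tauBase μ) = φ := by
  have hr := conjO_notMem (ε := ε) h2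
  have hso : ∀ (s : SOrtho ε) (v : tauSpace μ),
      (tauInd μ (s : Ortho ε) v).1 1 • φ + (tauInd μ (s : Ortho ε) v).1 (conjO ε) • ρ (conjO ε) φ
        = ρ s (v.1 1 • φ + v.1 (conjO ε) • ρ (conjO ε) φ) := by
    intro s v
    have h3 : ρ s (ρ (conjO ε) φ) = (((μ s)⁻¹ : ℂˣ) : ℂ) • ρ (conjO ε) φ := by
      have h4 : (s : Ortho ε) * conjO ε = conjO ε * ((s⁻¹ : SOrtho ε) : Ortho ε) := by
        rw [refl_conj hε (s⁻¹).2 hr]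
        simp
      rw [← Module.End.mul_apply, ← map_mul, h4, map_mul, Module.End.mul_apply, hφ, map_smul,
        map_inv]
    rw [tauInd_so_one, tauInd_so_refl hε hr, map_add, map_smul, map_smul, hφ, h3, smul_smul,
      smul_smul, mul_comm (v.1 1), mul_comm (v.1 _)]
  have hrefl : ∀ v : tauSpace μ,
      (tauInd μ (conjO ε) v).1 1 • φ + (tauInd μ (conjO ε) v).1 (conjO ε) • ρ (conjO ε) φ
        = ρ (conjO ε) (v.1 1 • φ + v.1 (conjO ε) • ρ (conjO ε) φ) := by
    intro v
    have h3 : ρ (conjO ε) (ρ (conjO ε) φ) = φ := by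
      rw [← Module.End.mul_apply, ← map_mul, mul_self_notMem hε hr, map_one]
      rfl
    rw [tauInd_refl_one, tauInd_refl_refl hε hr, map_add, map_smul, map_smul, h3, add_comm]
  refine ⟨⟨{ toFun := fun v => v.1 1 • φ + v.1 (conjO ε) • ρ (conjO ε) φ
             map_add' := fun v w => ?_
             map_smul' := fun c v => ?_ }, fun a => LinearMap.ext fun v => ?_⟩, ?_⟩
  · change (v.1 1 + w.1 1) • φ + (v.1 (conjO ε) + w.1 (conjO ε)) • ρ (conjO ε) φ = _
    module
  · change (c * v.1 1) • φ + (c * v.1 (conjO ε)) • ρ (conjO ε) φ = c • _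
    module
  · change (tauInd μ a v).1 1 • φ + (tauInd μ a v).1 (conjO ε) • ρ (conjO ε) φ
        = ρ a (v.1 1 • φ + v.1 (conjO ε) • ρ (conjO ε) φ)
    by_cases ha : a ∈ SOrtho ε
    · exact hso ⟨a, ha⟩ v
    · obtain ⟨s, rfl⟩ := exists_so_mul hε hr ha
      rw [map_mul, map_mul, Module.End.mul_apply, Module.End.mul_apply, hso, hrefl]
  · change (tauBase μ).1 1 • φ + (tauBase μ).1 (conjO ε) • ρ (conjO ε) φ = φ
    rw [tauBase_one, tauBase_refl hr, one_smul, zero_smul, add_zero]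

end Frobenius

/-! ### Similitudes of the plane combined with `GL₂` -/

section Similitude

variable {F : Type u} [Field F] {U : Type*} [AddCommGroup U] [Module F U]

/-- The action of two by two matrices on pairs. -/
def pairFun (M : Matrix (Fin 2) (Fin 2) F) : U × U →ₗ[F] U × U :=
  (M 0 0 • LinearMap.fst F U U + M 0 1 • LinearMap.snd F U U).prod
    (M 1 0 • LinearMap.fst F U U + M 1 1 • LinearMap.snd F U U)

theorem pairFun_apply (M : Matrix (Fin 2) (Fin 2) F) (d : U × U) :
    pairFun M d = (M 0 0 • d.1 + M 0 1 • d.2, M 1 0 • d.1 + M 1 1 • d.2) := rfl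

theorem pairFun_mul (M N : Matrix (Fin 2) (Fin 2) F) (d : U × U) :
    pairFun (M * N) d = pairFun M (pairFun N d) := by
  simp only [pairFun_apply, Matrix.mul_apply, Fin.sum_univ_two]
  ext <;> simp only <;> module

theorem pairFun_one (d : U × U) : pairFun (1 : Matrix (Fin 2) (Fin 2) F) d = d := by
  simp [pairFun_apply]

theorem sl2Act_eq_pairFun (g : SL2 F) (d : U × U) : sl2Act g d = pairFun g.1 d := rfl

variable {ε : F}

/-- The action of an element of `GL₂` on pairs. -/
def pairEquiv (h : GL (Fin 2) F) : (U × U) ≃ₗ[F] (U × U) :=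
  LinearEquiv.ofLinearMap (pairFun h.1) (pairFun (h⁻¹ : GL (Fin 2) F).1)
    (LinearMap.ext fun d => by
      change pairFun h.1 (pairFun (h⁻¹ : GL (Fin 2) F).1 d) = d
      rw [← pairFun_mul, ← Units.val_mul, mul_inv_cancel, Units.val_one, pairFun_one])
    (LinearMap.ext fun d => by
      change pairFun (h⁻¹ : GL (Fin 2) F).1 (pairFun h.1 d) = d
      rw [← pairFun_mul, ← Units.val_mul, inv_mul_cancel, Units.val_one, pairFun_one])

/-- The map `d ↦ z ⊗ h`. -/
def simEquiv (hε : ¬ IsSquare ε) (z : Fin 2 → F) (hz : z ≠ 0) (h : GL (Fin 2) F) :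
    ((Fin 2 → F) × (Fin 2 → F)) ≃ₗ[F] ((Fin 2 → F) × (Fin 2 → F)) :=
  ((mulEquiv hε z hz).prodCongr (mulEquiv hε z hz)).trans (pairEquiv h)

theorem simEquiv_apply (hε : ¬ IsSquare ε) (z : Fin 2 → F) (hz : z ≠ 0) (h : GL (Fin 2) F)
    (d : (Fin 2 → F) × (Fin 2 → F)) :
    simEquiv hε z hz h d = pairFun h.1 (mulU ε z d.1, mulU ε z d.2) := rfl

/-- Multiplication by `z` scales the form on `U` by its norm and `h` scales the form on `V` by its
determinant; the two factors cancel. -/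
theorem sympPair_simEquiv (hε : ¬ IsSquare ε) (z : Fin 2 → F) (hz : z ≠ 0) (h : GL (Fin 2) F)
    (hzh : nrm ε z * h.1.det = 1) (d e : (Fin 2 → F) × (Fin 2 → F)) :
    sympPair (betaForm ε) (simEquiv hε z hz h d) (simEquiv hε z hz h e)
      = sympPair (betaForm ε) d e := by
  rw [Matrix.det_fin_two] at hzh
  simp only [sympPair_apply, simEquiv_apply, pairFun_apply, map_add, map_smul,
    LinearMap.add_apply, LinearMap.smul_apply, smul_eq_mul, betaForm_mulU]
  rw [betaForm_symm ε e.1 d.1, betaForm_symm ε e.2 d.1, betaForm_symm ε e.1 d.2,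
    betaForm_symm ε e.2 d.2]
  linear_combination (betaForm ε d.1 e.2 - betaForm ε d.2 e.1) * hzh

theorem simEquiv_sl2Act (hε : ¬ IsSquare ε) (z : Fin 2 → F) (hz : z ≠ 0) (h : GL (Fin 2) F)
    (g : SL2 F) (d : (Fin 2 → F) × (Fin 2 → F)) :
    simEquiv hε z hz h (sl2Act g d) = sl2Act (glConj h g) (simEquiv hε z hz h d) := by
  have h1 : (mulU ε z (sl2Act g d).1, mulU ε z (sl2Act g d).2)
      = pairFun g.1 (mulU ε z d.1, mulU ε z d.2) := by
    simp only [sl2Act_eq_pairFun, pairFun_apply, map_add, map_smul]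
  rw [simEquiv_apply, simEquiv_apply, h1, sl2Act_eq_pairFun, glConj_coe, ← pairFun_mul,
    ← pairFun_mul, mul_assoc, mul_assoc, ← Units.val_mul, inv_mul_cancel, Units.val_one, mul_one]

theorem simEquiv_orthoPair (hε : ¬ IsSquare ε) (z : Fin 2 → F) (hz : z ≠ 0) (h : GL (Fin 2) F)
    {s : Ortho ε} (hs : s ∈ SOrtho ε) (d : (Fin 2 → F) × (Fin 2 → F)) :
    simEquiv hε z hz h ((orthoPair ε s).1 d) = (orthoPair ε s).1 (simEquiv hε z hz h d) := by
  obtain ⟨w, hw, rfl⟩ := exists_orthoOf hε hs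
  have hc : ∀ u, mulU ε z (mulU ε w u) = mulU ε w (mulU ε z u) := fun u => by
    refine plane_ext ?_ ?_ <;> simp <;> ring
  change pairFun h.1 (mulU ε z (mulU ε w d.1), mulU ε z (mulU ε w d.2))
    = (mulU ε w (pairFun h.1 (mulU ε z d.1, mulU ε z d.2)).1,
      mulU ε w (pairFun h.1 (mulU ε z d.1, mulU ε z d.2)).2)
  rw [hc, hc]
  simp only [pairFun_apply, map_add, map_smul]

end Similitude

/-! ### Invariance of `Θ(τ_μ)` under `GL₂` -/

section GLInvariance

variable {F : Type u} [Field F] [Fintype F] [DecidableEq F] {ε : F} {ψ : AddChar F ℂ}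
  {R : Representation ℂ (Ortho ε × SL2 F) ((Fin 2 → F) → ℂ)}

omit [Fintype F] [DecidableEq F] in
theorem IsEgorov.conj {U : Type*} [AddCommGroup U] [Module F U] {b : LinearMap.BilinForm F U}
    {g k k' : U × U → U × U} {C C' A : Module.End ℂ (U → ℂ)} (hCC : C * C' = 1) (hCC' : C' * C = 1)
    (hC : IsEgorov b ψ g C) (hA : IsEgorov b ψ k A) (hg : Function.Surjective g)
    (hk : ∀ d, g (k d) = k' (g d)) : IsEgorov b ψ k' (C * A * C') := by
  intro d
  obtain ⟨d, rfl⟩ := hg d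
  have h1 := hC d
  have h3 := hA d
  have h4 := hC (k d)
  rw [hk] at h4
  calc C * A * C' * schr b ψ (g d) = C * A * C' * (schr b ψ (g d) * C) * C' := by
        rw [mul_assoc (C * A * C'), mul_assoc (schr b ψ (g d)), hCC, mul_one]
    _ = C * (A * schr b ψ d) * C' := by
        rw [← h1]
        simp only [mul_assoc]
        rw [← mul_assoc C' C, hCC', one_mul]
    _ = schr b ψ (k' (g d)) * (C * A * C') := by
        rw [h3, ← mul_assoc C, h4]
        simp only [mul_assoc]

/-- The operator of a similitude conjugates `R` on `SL₂` and commutes with the rotations. -/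
theorem IsModel.exists_similitude (hR : IsModel ε ψ R) (hd : IsSchrodingerDatum (betaForm ε) ψ)
    (hε : ¬ IsSquare ε) (h : GL (Fin 2) F) :
    ∃ C C' : Module.End ℂ ((Fin 2 → F) → ℂ), C * C' = 1 ∧ C' * C = 1 ∧
      (∀ g, R (1, glConj h g) = C * R (1, g) * C') ∧
      ∀ s ∈ SOrtho ε, R (s, 1) = C * R (s, 1) * C' := by
  -- The norm is surjective, so every determinant can be compensated by a similitude of `U`.
  obtain ⟨z, hz⟩ := exists_nrm_eq hε hd.two_ne (h.1.det)⁻¹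
  have hdet : h.1.det ≠ 0 := (h.isUnit.map Matrix.detMonoidHom).ne_zero
  have hz0 : z ≠ 0 := ne_zero_of_nrm (inv_ne_zero hdet) hz
  obtain ⟨C, C', hCC, hC⟩ := exists_isEgorov hd (simEquiv hε z hz0 h)
    (sympPair_simEquiv hε z hz0 h (by rw [hz, inv_mul_cancel₀ hdet]))
  have hCC' : C' * C = 1 := mul_eq_one_comm.1 hCC
  have hCf : C * flip = flip * C := hC.mul_flip hd hCC
  have hCf' : C' * flip = flip * C' := by
    calc C' * flip = C' * (flip * C) * C' := by rw [mul_assoc, mul_assoc, hCC, mul_one]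
      _ = flip * C' := by rw [← hCf, ← mul_assoc, hCC', one_mul]
  refine ⟨C, C', hCC, hCC', fun g => ?_, fun s hs => ?_⟩
  · have h1 : IsEgorov (betaForm ε) ψ (sl2Act (glConj h g)) (C * R (1, g) * C') :=
      IsEgorov.conj hCC hCC' hC (hR.weil.egorov g) (simEquiv hε z hz0 h).surjective
        (simEquiv_sl2Act hε z hz0 h g)
    have h3 : C * R (1, g) * C' * (C * R (1, g⁻¹) * C') = 1 := by
      have h4 : R (1, g) * R (1, g⁻¹) = 1 := weil_mul_inv (resSnd R) g
      calc _ = C * R (1, g) * (C' * C) * R (1, g⁻¹) * C' := by simp only [mul_assoc]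
        _ = C * (R (1, g) * R (1, g⁻¹)) * C' := by rw [hCC', mul_one]; simp only [mul_assoc]
        _ = 1 := by rw [h4, mul_one, hCC]
    have h5 : R (1, glConj h g) = _ := hR.weil.eq_of_isEgorov hd h3 h1
    have h6 : parityDet (R (1, g)) = 1 := hR.weil.parity g
    have h8 : R (1, g) * flip = flip * R (1, g) := hR.weil.flip_comm hd g
    -- The parity determinant is invariant under conjugation, so no scalar appears on `G`.
    have h7 : parityDet (C * R (1, g) * C') = 1 := by
      rw [parityDet_mul hCf', parityDet_mul h8, h6, mul_one,
        ← parityDet_mul hCf', hCC, parityDet_one]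
    rw [h5, h7, one_smul]
  · rw [hR.perm]
    have h1 : IsEgorov (betaForm ε) ψ (orthoPair ε s).1 (C * permOp s * C') :=
      IsEgorov.conj hCC hCC' hC (permOp_isEgorov s) (simEquiv hε z hz0 h).surjective
        (simEquiv_orthoPair hε z hz0 h hs)
    obtain ⟨c, hc⟩ := IsEgorov.exists_smul hd (A' := permOp s⁻¹)
      (by rw [← permOp_mul, mul_inv_cancel, permOp_one]) (permOp_isEgorov s) h1
    -- On rotations the scalar is found by comparing traces: a permutation operator fixing the
    -- origin has nonzero trace.
    have h3 : LinearMap.trace ℂ _ (C * permOp s * C') = LinearMap.trace ℂ _ (permOp s) := by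
      rw [LinearMap.trace_mul_comm, ← mul_assoc, hCC', one_mul]
    have h4 : LinearMap.trace ℂ _ (permOp s) ≠ 0 := by
      rw [permOp, trace_funLeft, Nat.cast_ne_zero, Finset.card_ne_zero]
      exact ⟨0, Finset.mem_filter.2 ⟨Finset.mem_univ _, map_zero _⟩⟩
    rw [hc, map_smul, smul_eq_mul, mul_eq_right₀ h4] at h3
    rw [hc, h3, one_smul]

/-- The operator of a similitude commutes with the rotations, so it preserves the `μ`-eigenvectors.
These are the values `f (tauBase μ)`, by Frobenius reciprocity, and on them it intertwines the
action of `G` with its conjugate. -/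
theorem IsModel.isGLInvariant_theta (hR : IsModel ε ψ R)
    (hd : IsSchrodingerDatum (betaForm ε) ψ) (hε : ¬ IsSquare ε) {μ : SOrtho ε →* ℂˣ}
    (hμ : μ ≠ μ⁻¹) : IsGLInvariant (Theta R (tauInd μ)) := by
  intro h φ hφ
  have h2 := hd.two_ne
  have hτ := tauInd_isIrreducible hε h2 hμ
  obtain ⟨C, C', hCC, hCC', hg, hs⟩ := hR.exists_similitude hd hε h
  have hφ' : ∀ g, φ g = glConj h g := fun g => Subtype.ext (hφ g)
  have hinj := thetaEval_injective R hτ (tauBase_ne_zero (μ := μ))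
  have hex : ∀ f : ThetaSpace R (tauInd μ), ∃ f' : ThetaSpace R (tauInd μ),
      f' (tauBase μ) = C (f (tauBase μ)) := by
    intro f
    refine exists_frobenius hε h2 (resFst R) fun s => ?_
    change R (s, 1) (C (f (tauBase μ))) = _
    have h3 : R (s.1, 1) * C = C * R (s.1, 1) := by
      conv_lhs => rw [hs s s.2]
      rw [mul_assoc, hCC', mul_one]
    rw [← Module.End.mul_apply, h3, Module.End.mul_apply]
    have h4 : R (s.1, 1) (f (tauBase μ)) = f (tauInd μ s (tauBase μ)) := (map_rep f s.1 _).symm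
    rw [h4, tauInd_so_tauBase hε h2, map_smul, map_smul]
  choose J hJ using hex
  let L : ThetaSpace R (tauInd μ) →ₗ[ℂ] ThetaSpace R (tauInd μ) :=
    { toFun := J
      map_add' := fun f f' => hinj (by
        rw [map_add]
        change J (f + f') (tauBase μ) = J f (tauBase μ) + J f' (tauBase μ)
        rw [hJ, hJ, hJ, ← map_add]
        rfl)
      map_smul' := fun c f => hinj (by
        rw [map_smul]
        change J (c • f) (tauBase μ) = c • J f (tauBase μ)
        rw [hJ, hJ, ← map_smul]
        rfl) }
  have hL : Function.Injective L := fun f f' hff => hinj (by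
    change f (tauBase μ) = f' (tauBase μ)
    have h3 : J f (tauBase μ) = J f' (tauBase μ) := DFunLike.congr_fun hff _
    rw [hJ, hJ] at h3
    have h4 := congrArg C' h3
    rwa [← Module.End.mul_apply, ← Module.End.mul_apply, hCC', Module.End.one_apply,
      Module.End.one_apply] at h4)
  have hfd : FiniteDimensional ℂ (ThetaSpace R (tauInd μ)) :=
    Module.Finite.of_injective (thetaEval R (tauInd μ) (tauBase μ)).toLinearMap hinj
  refine ⟨IntertwiningMap.ofBijective (⟨L, fun g => LinearMap.ext fun f => hinj ?_⟩ :
    IntertwiningMap (Theta R (tauInd μ)) ((Theta R (tauInd μ)).comp φ.toMonoidHom))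
    ⟨hL, LinearMap.injective_iff_surjective.1 hL⟩⟩
  change J (Theta R (tauInd μ) g f) (tauBase μ) = R (1, φ g) (J f (tauBase μ))
  rw [hJ, hJ, hφ', hg]
  change (C * R (1, g)) (f (tauBase μ)) = (C * R (1, g) * C' * C) (f (tauBase μ))
  rw [mul_assoc _ C', hCC', mul_one]

end GLInvariance

/-! ### The representations of tensor rank two -/

section Rank

variable {F : Type u} [Field F] [Fintype F] [DecidableEq F] {ε : F} {ψ : AddChar F ℂ}
  {R : Representation ℂ (Ortho ε × SL2 F) ((Fin 2 → F) → ℂ)}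

omit [Fintype F] [DecidableEq F] in
theorem not_isSgn_trivial (h2 : (2 : F) ≠ 0) :
    ¬ IsSgn (Representation.trivial ℂ (Ortho ε) ℂ) := by
  intro hs
  have h3 := (hs.2 (conjO ε)).2 fun h => conjO_notMem h2 h
  have h4 : (1 : ℂ) = -1 := LinearMap.congr_fun h3 1
  norm_num at h4

omit [Fintype F] [DecidableEq F] in
theorem trivial_isIrreducible : (Representation.trivial ℂ (Ortho ε) ℂ).IsIrreducible :=
  isIrreducible_of_finrank_eq_one (Module.finrank_self ℂ)

theorem IsModel.hasTensorRank_trivial (hR : IsModel ε ψ R)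
    (hd : IsSchrodingerDatum (betaForm ε) ψ) (hε : ¬ IsSquare ε) :
    HasTensorRank 2 (Theta R (Representation.trivial ℂ (Ortho ε) ℂ)) := by
  have h2 := hd.two_ne
  have h3 := three_le_card h2
  have hsgn := not_isSgn_trivial (ε := ε) h2
  have hdim := hR.finrank_theta_of_trivial hε h2 (τ := Representation.trivial ℂ (Ortho ε) ℂ)
    (Module.finrank_self ℂ) fun _ => rfl
  refine hasTensorRank_two (hR.theta_isIrreducible hd hε trivial_isIrreducible hsgn)
    (hR.theta_inFiltration_two hd hε trivial_isIrreducible hsgn) (by omega) ?_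
  rintro ⟨-, h4, -⟩
  omega

/-- Dimension `q - 1` is that of a degenerate representation only for `q = 3`, where it equals `(q +
1) / 2`; invariance under `GL₂` excludes this case. -/
theorem IsModel.hasTensorRank_tauInd (hR : IsModel ε ψ R)
    (hd : IsSchrodingerDatum (betaForm ε) ψ) (hε : ¬ IsSquare ε) {μ : SOrtho ε →* ℂˣ}
    (hμ : μ ≠ μ⁻¹) : HasTensorRank 2 (Theta R (tauInd μ)) ∧
      Module.finrank ℂ (ThetaSpace R (tauInd μ)) = Fintype.card F - 1 := by
  have h2 := hd.two_ne
  have h3 := three_le_card h2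
  have hirr := tauInd_isIrreducible hε h2 hμ
  have hsgn : ¬ IsSgn (tauInd μ) := fun hs => by
    have h4 := hs.1
    rw [finrank_tauSpace hε h2] at h4
    omega
  have := IsIrred.finiteDimensional hirr
  have hdim := hR.two_mul_finrank_theta hε h2 (invariants_tauInd hε h2 (μ := μ) (by
    rintro rfl
    exact hμ (MonoidHom.ext fun _ => inv_one.symm)))
  rw [finrank_tauSpace hε h2] at hdim
  have hdim' : Module.finrank ℂ (ThetaSpace R (tauInd μ)) = Fintype.card F - 1 := by omega
  refine ⟨hasTensorRank_two (hR.theta_isIrreducible hd hε hirr hsgn)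
    (hR.theta_inFiltration_two hd hε hirr hsgn) (by omega) ?_, hdim'⟩
  rintro ⟨-, h4, h5⟩
  exact h5 (by omega) (hR.isGLInvariant_theta hd hε hμ)

end Rank

/-! ### The diagonal torus in the model -/

section Dilation

variable {F : Type u} [Field F] {ε : F} {ψ : AddChar F ℂ}

theorem dilOp_flip (s : Fˣ) : dilOp s * flip = flip * dilOp s := by
  refine LinearMap.ext fun f => funext fun x => ?_
  change f (-(s⁻¹ • x)) = f (s⁻¹ • -x)
  rw [smul_neg]

theorem low_pow (t : F) (n : ℕ) : low t ^ n = low (n * t) := by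
  induction n with
  | zero => rw [pow_zero, Nat.cast_zero, zero_mul, low_zero]
  | succ n ih => rw [pow_succ, ih, ← low_add]; congr 1; push_cast; ring

variable [Fintype F] [DecidableEq F]

/-- Every nonzero element of `F` is a square in the quadratic extension, so the dilation is the
square of the permutation `u ↦ z u` and has determinant `1`. -/
theorem det_dilOp (hε : ¬ IsSquare ε) (s : Fˣ) :
    LinearMap.det (dilOp s) = 1 := by
  obtain ⟨z, hz, hzz⟩ : ∃ z : Fin 2 → F, z ≠ 0 ∧ ∀ u, mulU ε z (mulU ε z u) = s⁻¹ • u := by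
    have hs0 : ((s⁻¹ : Fˣ) : F) ≠ 0 := (s⁻¹).ne_zero
    have hsm : ∀ u : Fin 2 → F, s⁻¹ • u = ((s⁻¹ : Fˣ) : F) • u := fun u => rfl
    by_cases hs : IsSquare ((s⁻¹ : Fˣ) : F)
    · obtain ⟨t, ht⟩ := hs
      have ht0 : t ≠ 0 := by
        rintro rfl
        exact hs0 (by rw [ht, mul_zero])
      refine ⟨![t, 0], fun h0 => ht0 (congrFun h0 0), fun u => ?_⟩
      rw [hsm, ht]
      refine plane_ext ?_ ?_ <;> simp <;> ring
    · have hε0 := eps_ne_zero hε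
      have h3 : IsSquare (((s⁻¹ : Fˣ) : F) * ε) := by
        have h4 := (quadraticChar_neg_one_iff_not_isSquare (F := F)).2 hs
        have h5 := (quadraticChar_neg_one_iff_not_isSquare (F := F)).2 hε
        have h6 : quadraticChar F (((s⁻¹ : Fˣ) : F) * ε) = 1 := by
          rw [map_mul, h4, h5]; rfl
        exact (quadraticChar_one_iff_isSquare (mul_ne_zero hs0 hε0)).1 h6
      obtain ⟨t, ht⟩ := h3
      have ht0 : t ≠ 0 := by
        rintro rfl
        rw [mul_zero] at ht
        exact mul_ne_zero hs0 hε0 ht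
      have h7 : ((s⁻¹ : Fˣ) : F) = ε * (t / ε) * (t / ε) := by
        field_simp
        linear_combination ht
      refine ⟨![0, t / ε], fun h0 => div_ne_zero ht0 hε0 (congrFun h0 1), fun u => ?_⟩
      rw [hsm, h7]
      refine plane_ext ?_ ?_ <;> simp <;> ring
  have h3 : dilOp s = LinearMap.funLeft ℂ ℂ (mulEquiv hε z hz).toEquiv
      * LinearMap.funLeft ℂ ℂ (mulEquiv hε z hz).toEquiv := by
    refine LinearMap.ext fun f => funext fun x => ?_
    change f (s⁻¹ • x) = f (mulU ε z (mulU ε z x))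
    rw [hzz]
  rw [h3, map_mul, ← sq]
  exact det_funLeft_sq _

/-- Diagonal elements act by dilations. -/
theorem IsModel.apply_dg {R : Representation ℂ (Ortho ε × SL2 F) ((Fin 2 → F) → ℂ)}
    (hR : IsModel ε ψ R) (hd : IsSchrodingerDatum (betaForm ε) ψ)
    (hε : ¬ IsSquare ε) (s : Fˣ) : R (1, dg s) = dilOp s := by
  set q := Fintype.card F with hq
  let l : Fˣ →* ℂ :=
    { toFun := fun s => parityDet (dilOp s)
      map_one' := by rw [dilOp_one, parityDet_one]
      map_mul' := fun s t => by rw [dilOp_mul, parityDet_mul (dilOp_flip t)] }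
  have h1 : R (1, dg s) = l s • dilOp s :=
    hR.weil.eq_of_isEgorov hd (A' := dilOp s⁻¹)
      (by rw [← dilOp_mul, mul_inv_cancel, dilOp_one]) (dilOp_isEgorov s)
  -- The determinant of the representation is a character of `SL₂` with `q`-th power `1`, because
  -- lower unipotent elements have order dividing `q`.
  let D : SL2 F →* ℂ := (LinearMap.det : Module.End ℂ ((Fin 2 → F) → ℂ) →* ℂ).comp (resSnd R)
  have h3 : ∀ g, D g ^ q = 1 := by
    intro g
    refine sl2_hom_eq_one ((powMonoidHom q).comp D) (fun t => ?_) g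
    change D (low t) ^ q = 1
    rw [← map_pow, low_pow, hq, FiniteField.cast_card_eq_zero, zero_mul, low_zero, map_one]
  have h4 := h3 (dg s)
  have h5 : D (dg s) = l s ^ (q ^ 2) := by
    change LinearMap.det (R (1, dg s)) = _
    rw [h1, LinearMap.det_smul, det_dilOp hε, mul_one, Module.finrank_fintype_fun_eq_card,
      Fintype.card_fun, Fintype.card_fin]
  have h6 : l s ^ (q - 1) = 1 := by
    rw [← map_pow, hq, ← Fintype.card_units, pow_card_eq_one, map_one]
  -- The scalar `l s` has order dividing `q - 1`, while `D (dg s) = l s ^ (q ^ 2)` has order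
  -- dividing `q`; together they give `l s = 1`.
  have h7 : l s ^ q = l s := by
    have h8 : q = q - 1 + 1 := by have := Fintype.card_pos (α := F); omega
    rw [h8, pow_succ, h6, one_mul]
  rw [h5, sq, pow_mul, h7, h7, h7] at h4
  rw [h1, h4, one_smul]

end Dilation

/-! ### Eigenvectors of the unipotent subgroup -/

section Unipotent

variable {F : Type u} [Field F] [Fintype F] [DecidableEq F] {ψ : AddChar F ℂ}
  {D : Type*} [AddCommGroup D] [Module ℂ D] {σ : Representation ℂ (SL2 F) D}

theorem sum_char_mul (hψ : ψ ≠ 1) (b : F) :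
    ∑ t, ψ (b * t) = if b = 0 then (Fintype.card F : ℂ) else 0 := by
  have h := AddChar.sum_mulShift b (AddChar.IsPrimitive.of_ne_one hψ)
  simp only [mul_comm b]
  rw [h]
  split_ifs <;> simp

/-- The projection, up to the factor `q`, to the eigenspace of the lower unipotent elements with
eigencharacter `t ↦ ψ(b t)`. -/
def lowProj (ψ : AddChar F ℂ) (σ : Representation ℂ (SL2 F) D) (b : F) : Module.End ℂ D :=
  ∑ t, ψ (-(b * t)) • σ (low t)

omit [DecidableEq F] in
theorem low_mul_lowProj (b u : F) : σ (low u) * lowProj ψ σ b = ψ (b * u) • lowProj ψ σ b := by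
  rw [lowProj, Finset.mul_sum, Finset.smul_sum, ← Equiv.sum_comp (Equiv.addLeft u)
    fun t => ψ (b * u) • ψ (-(b * t)) • σ (low t)]
  refine Finset.sum_congr rfl fun t _ => ?_
  rw [mul_smul_comm, ← map_mul, ← low_add, smul_smul, ← AddChar.map_add_eq_mul]
  congr 2
  change -(b * t) = b * u + -(b * (u + t))
  ring

/-- Fourier inversion on `F`: only `t = 0` survives the summation over all characters. -/
theorem sum_lowProj (hψ : ψ ≠ 1) : ∑ b, lowProj ψ σ b = (Fintype.card F : ℂ) • 1 := by
  simp only [lowProj]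
  rw [Finset.sum_comm, Finset.sum_eq_single 0]
  · simp [low_zero, ← Nat.cast_smul_eq_nsmul ℂ]
  · intro t _ ht
    rw [← Finset.sum_smul]
    have h : ∑ b, ψ (-(b * t)) = ∑ b, ψ (-t * b) :=
      Finset.sum_congr rfl fun b _ => by congr 1; ring
    rw [h, sum_char_mul hψ, if_neg (neg_ne_zero.2 ht), zero_smul]
  · simp

theorem lowProj_apply (hψ : ψ ≠ 1) {b c : F} {v : D} (hv : ∀ t, σ (low t) v = ψ (c * t) • v) :
    lowProj ψ σ b v = if c = b then (Fintype.card F : ℂ) • v else 0 := by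
  rw [lowProj, LinearMap.sum_apply]
  simp only [LinearMap.smul_apply, hv, smul_smul, ← AddChar.map_add_eq_mul]
  rw [← Finset.sum_smul]
  have h : ∑ t, ψ (-(b * t) + c * t) = ∑ t, ψ ((c - b) * t) :=
    Finset.sum_congr rfl fun t _ => by congr 1; ring
  rw [h, sum_char_mul hψ]
  by_cases hcb : c = b
  · rw [if_pos hcb, if_pos (sub_eq_zero.2 hcb)]
  · rw [if_neg hcb, if_neg fun h => hcb (sub_eq_zero.1 h), zero_smul]

theorem linearIndependent_of_low (hψ : ψ ≠ 1) {s : Finset F} {v : s → D} (hv0 : ∀ b, v b ≠ 0)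
    (hv : ∀ (b : s) t, σ (low t) (v b) = ψ (b * t) • v b) : LinearIndependent ℂ v := by
  rw [Fintype.linearIndependent_iff]
  intro c hc b
  have h1 := congrArg (lowProj ψ σ (b : F)) hc
  rw [map_sum, map_zero, Finset.sum_eq_single b] at h1
  · rw [map_smul, lowProj_apply hψ (hv b), if_pos rfl, smul_smul] at h1
    rcases smul_eq_zero.1 h1 with h | h
    · exact (mul_eq_zero.1 h).resolve_right (Nat.cast_ne_zero.2 Fintype.card_ne_zero)
    · exact absurd h (hv0 b)
  · intro b' _ hb'
    rw [map_smul, lowProj_apply hψ (hv b'), if_neg fun h => hb' (Subtype.ext h), smul_zero]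
  · simp

/-- A representation of dimension less than `q / 2` with a nonzero vector fixed by the unipotent
elements is trivial. -/
theorem forall_eq_id_of_low_fixed [FiniteDimensional ℂ D] (hψ : ψ ≠ 1)
    (hd : 2 * Module.finrank ℂ D < Fintype.card F) {v : D} (hv0 : v ≠ 0)
    (hv : ∀ t, σ (low t) v = v) (g : SL2 F) : σ g = 1 := by
  -- If only the trivial character of the lower unipotent elements occurs, these act trivially, and
  -- they generate `SL₂` up to conjugacy.
  by_cases hb : ∀ b, b ≠ 0 → lowProj ψ σ b = 0
  · refine sl2_hom_eq_one σ (fun t => ?_) g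
    have h1 := sum_lowProj (σ := σ) hψ
    rw [Finset.sum_eq_single 0 (fun b _ => hb b) (by simp)] at h1
    have h3 := low_mul_lowProj (ψ := ψ) (σ := σ) 0 t
    rw [h1, zero_mul, AddChar.map_zero_eq_one, one_smul, mul_smul_comm, mul_one] at h3
    exact smul_right_injective _ (Nat.cast_ne_zero.2 (Fintype.card_ne_zero (α := F))) h3
  · exfalso
    push Not at hb
    obtain ⟨b, hb0, hb⟩ := hb
    obtain ⟨w, hw⟩ : ∃ w, lowProj ψ σ b w ≠ 0 := by
      by_contra hcon
      push Not at hcon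
      exact hb (LinearMap.ext hcon)
    have hw1 : ∀ t, σ (low t) (lowProj ψ σ b w) = ψ (b * t) • lowProj ψ σ b w := fun t =>
      LinearMap.congr_fun (low_mul_lowProj b t) w
    -- Diagonal elements move the eigencharacter `b` to `b s²` for `s ≠ 0`, and `s = 0` stands for
    -- the fixed vector `v`. The set has at least `q / 2` elements, giving too many independent
    -- eigenvectors.
    let I : Finset F := Finset.univ.image fun s => b * (s * s)
    have hex : ∀ c : I, ∃ x : D, x ≠ 0 ∧ ∀ t, σ (low t) x = ψ (c * t) • x := by
      rintro ⟨c, hc⟩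
      obtain ⟨s, -, rfl⟩ := Finset.mem_image.1 hc
      by_cases hs : s = 0
      · subst hs
        refine ⟨v, hv0, fun t => ?_⟩
        rw [hv]
        simp
      · refine ⟨σ (dg (Units.mk0 s hs)) (lowProj ψ σ b w), fun h0 => hw ?_, fun t => ?_⟩
        · have h1 := congrArg (σ (dg (Units.mk0 s hs))⁻¹) h0
          rwa [← Module.End.mul_apply, ← map_mul, inv_mul_cancel, map_one, map_zero] at h1
        · rw [← Module.End.mul_apply, ← map_mul, ← dg_mul_low, map_mul, Module.End.mul_apply, hw1,
            map_smul]
          congr 2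
          simp only [Units.val_mk0]
          ring
    choose x hx0 hx using hex
    have h1 := (linearIndependent_of_low hψ hx0 hx).fintype_card_le_finrank
    rw [Fintype.card_coe] at h1
    have h3 := FiniteField.card_image_polynomial_eval
      (p := Polynomial.C b * Polynomial.X ^ 2) (by rw [Polynomial.degree_C_mul_X_pow 2 hb0]; norm_num)
    rw [Polynomial.natDegree_C_mul_X_pow 2 b hb0] at h3
    have h4 : (Finset.univ.image fun x : F =>
        Polynomial.eval x (Polynomial.C b * Polynomial.X ^ 2)) = I := by
      refine Finset.image_congr fun s _ => ?_
      simp [sq]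
    rw [h4] at h3
    omega

/-- The operator `∑ σ (low t)` has image in the fixed vectors, so it is zero; its trace without the
term `t = 0` is minus the dimension. -/
theorem sum_character_low [FiniteDimensional ℂ D]
    (h : ∀ v : D, (∀ t, σ (low t) v = v) → v = 0) :
    ∑ t ∈ Finset.univ.erase (0 : F), σ.character (low t) = -(Module.finrank ℂ D : ℂ) := by
  have h1 : ∑ t : F, σ (low t) = 0 := by
    refine LinearMap.ext fun v => h _ fun u => ?_
    rw [LinearMap.sum_apply, map_sum, ← Equiv.sum_comp (Equiv.addLeft u) fun t => σ (low t) v]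
    refine Finset.sum_congr rfl fun t _ => ?_
    rw [← Module.End.mul_apply, ← map_mul, ← low_add]
    rfl
  have h3 : ∑ t : F, σ.character (low t) = 0 := by
    change ∑ t : F, LinearMap.trace ℂ D (σ (low t)) = 0
    rw [← map_sum, h1, map_zero]
  rw [← Finset.add_sum_erase _ _ (Finset.mem_univ (0 : F)), low_zero, char_one] at h3
  linear_combination h3

end Unipotent

/-! ### A character estimate forcing occurrence -/

section Occurrence

variable {F : Type u} [Field F] [Fintype F] [DecidableEq F] {ε : F} {ψ : AddChar F ℂ}
  {R : Representation ℂ (Ortho ε × SL2 F) ((Fin 2 → F) → ℂ)}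
  {D : Type*} [AddCommGroup D] [Module ℂ D] {σ : Representation ℂ (SL2 F) D}

omit [DecidableEq F] in
-- Orthogonality of characters together with Schur's lemma.
theorem IsIrred.sum_norm_sq_le [FiniteDimensional ℂ D] (hσ : σ.IsIrreducible) :
    ∑ g : SL2 F, ‖σ.character g‖ ^ 2 ≤ (Fintype.card F : ℝ) ^ 3 - Fintype.card F := by
  have h1 := sum_char_mul_char σ σ
  have h3 : Module.finrank ℂ (IntertwiningMap σ σ) ≤ 1 :=
    finrank_le_one (IntertwiningMap.id σ) fun f => by
      obtain ⟨c, hc⟩ := IsIrred.exists_scalar hσ f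
      exact ⟨c, IntertwiningMap.ext (LinearMap.ext fun v => (hc v).symm)⟩
  have h4 : ((∑ g : SL2 F, ‖σ.character g‖ ^ 2 : ℝ) : ℂ)
      = ((Fintype.card (SL2 F) * Module.finrank ℂ (IntertwiningMap σ σ) : ℝ) : ℂ) := by
    push_cast
    rw [← h1]
    refine Finset.sum_congr rfl fun g _ => ?_
    rw [char_inv_eq_conj]
    exact (Complex.mul_conj' _).symm
  have h5 : (Fintype.card (SL2 F) : ℝ) = (Fintype.card F : ℝ) ^ 3 - Fintype.card F := by
    have h6 := card_SL2_cast (F := F)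
    exact_mod_cast h6
  rw [Complex.ofReal_inj.1 h4, h5]
  refine mul_le_of_le_one_right ?_ (by exact_mod_cast h3)
  rw [← h5]
  positivity

/-- An irreducible representation of dimension `(q - 1) / 2` without vectors fixed by the unipotent
elements occurs in the oscillator representation. -/
theorem IsModel.exists_intertwining (hR : IsModel ε ψ R) (hd : IsSchrodingerDatum (betaForm ε) ψ)
    (hε : ¬ IsSquare ε) (hσ : σ.IsIrreducible)
    (hdim : 2 * Module.finrank ℂ D + 1 = Fintype.card F)
    (h : ∀ v : D, (∀ t, σ (low t) v = v) → v = 0) :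
    ∃ f : IntertwiningMap σ (resSnd R), f ≠ 0 := by
  have := IsIrred.finiteDimensional hσ
  by_contra hcon
  push Not at hcon
  have : Subsingleton (IntertwiningMap σ (resSnd R)) := ⟨fun f f' => (hcon f).trans (hcon f').symm⟩
  have h1 := sum_char_mul_char σ (resSnd R)
  rw [Module.finrank_zero_of_subsingleton, Nat.cast_zero, mul_zero,
    ← Finset.sum_filter_add_sum_filter_not _ (fun g : SL2 F => g 0 0 + g 1 1 = 2),
    sum_trace_two] at h1
  swap
  · intro g k
    rw [char_conj, mul_inv_rev, mul_inv_rev, inv_inv, ← mul_assoc, char_conj]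
  set q := Fintype.card F with hq
  set n := Module.finrank ℂ D with hn
  -- The oscillator character is `-q` at every `low t`, `t ≠ 0`, and the values of `σ` there add up
  -- to `-n`.
  have h3 : ∑ t ∈ Finset.univ.erase (0 : F),
      (resSnd R).character (low t) * σ.character (low t)⁻¹ = (q : ℂ) * n := by
    have h4 : ∀ t ∈ Finset.univ.erase (0 : F),
        (resSnd R).character (low t) * σ.character (low t)⁻¹
          = -(q : ℂ) * star (σ.character (low t)) := fun t ht => by
      rw [hR.character_low hd hε (Finset.ne_of_mem_erase ht), char_inv_eq_conj]
    rw [Finset.sum_congr rfl h4, ← Finset.mul_sum, ← star_sum, sum_character_low h, ← hn]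
    simp
  rw [h3, inv_one, char_one, char_one, Module.finrank_fintype_fun_eq_card, Fintype.card_fun,
    Fintype.card_fin, nsmul_eq_mul, ← hq, ← hn] at h1
  set S := ∑ g ∈ Finset.univ.filter (fun g : SL2 F => ¬ (g 0 0 + g 1 1 = 2)),
    (resSnd R).character g * σ.character g⁻¹ with hS
  set A := Finset.univ.filter (fun g : SL2 F => ¬ (g 0 0 + g 1 1 = 2)) with hA
  have h5 : S = -((q * n * (2 * q + 1) : ℝ) : ℂ) := by
    push_cast at h1 ⊢
    linear_combination h1
  -- Elements of trace `2` contribute `q² n + (q + 1) q n` to the inner product, which is assumed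
  -- zero. On all others the oscillator character has absolute value `1`, so the absolute values of
  -- the character of `σ` must balance this.
  have h6 : (q * n * (2 * q + 1) : ℝ) ≤ ∑ g ∈ A, ‖σ.character g‖ := by
    have h7 : ‖S‖ = (q * n * (2 * q + 1) : ℝ) := by
      rw [h5, norm_neg, Complex.norm_of_nonneg (by positivity)]
    rw [← h7]
    refine (norm_sum_le _ _).trans (Finset.sum_le_sum fun g hg => ?_)
    have h8 := hR.character_mul_star hd (Finset.mem_filter.1 hg).2
    have h9 : ‖(resSnd R).character g‖ = 1 := by
      have h10 := congrArg Norm.norm h8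
      rw [norm_mul, norm_star, norm_one] at h10
      nlinarith [norm_nonneg ((resSnd R).character g)]
    rw [norm_mul, h9, one_mul, char_inv_eq_conj, norm_star]
  have h7 : (∑ g ∈ A, ‖σ.character g‖) ^ 2
      ≤ ((q : ℝ) ^ 3 - q - q ^ 2) * ((q : ℝ) ^ 3 - q) := by
    refine sq_sum_le_card_mul_sum_sq.trans ?_
    have h8 : (A.card : ℝ) = (q : ℝ) ^ 3 - q - q ^ 2 := by
      have h9 := Finset.card_filter_add_card_filter_not (s := (Finset.univ : Finset (SL2 F)))
        (fun g : SL2 F => g 0 0 + g 1 1 = 2)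
      rw [card_trace_two, Finset.card_univ] at h9
      have h10 : (Fintype.card (SL2 F) : ℝ) = (q : ℝ) ^ 3 - q := by
        have h6 := card_SL2_cast (F := F)
        exact_mod_cast h6
      rw [← h10, ← h9]
      push_cast
      ring
    rw [← h8]
    refine mul_le_mul_of_nonneg_left ?_ (Nat.cast_nonneg _)
    exact (Finset.sum_le_sum_of_subset_of_nonneg (Finset.subset_univ _)
      fun _ _ _ => by positivity).trans (IsIrred.sum_norm_sq_le hσ)
  have h8 : (q : ℝ) = 2 * n + 1 := by rw [← hdim]; push_cast; ring
  have h9 : (0 : ℝ) < n := by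
    have := IsIrred.nontrivial hσ
    exact_mod_cast (Module.finrank_pos : 0 < Module.finrank ℂ D)
  have h10 := (pow_le_pow_left₀ (by positivity) h6 2).trans h7
  rw [h8] at h10
  -- With `n = (q - 1) / 2` the lower bound exceeds the Cauchy–Schwarz bound by `q² (q - 1)(5q + 3)
  -- / 4`, although their two leading terms agree.
  nlinarith [mul_pos h9 h9, mul_pos (mul_pos h9 h9) h9, pow_pos h9 4, pow_pos h9 5, pow_pos h9 6]

end Occurrence

/-! ### Constituents of the second factor as theta lifts -/

section Multiplicity

variable {A B : Type*} [Group A] [Group B] {E : Type*} [AddCommGroup E] [Module ℂ E]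

/-- The action of the first factor on the multiplicity space of a representation of the second. -/
def multRep {D : Type*} [AddCommGroup D] [Module ℂ D] (R : Representation ℂ (A × B) E)
    (σ : Representation ℂ B D) : Representation ℂ A (IntertwiningMap σ (resSnd R)) where
  toFun a :=
    { toFun := fun f => (fstIntertwining R a).comp f
      map_add' := fun f f' => by ext x; simp
      map_smul' := fun c f => by ext x; simp }
  map_one' := by
    ext f x
    change resFst R 1 (f x) = f x
    rw [map_one]; rfl
  map_mul' b b' := by
    ext f x
    change resFst R (b * b') (f x) = resFst R b (resFst R b' (f x))
    rw [map_mul]; rfl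

/-- Precomposition with an equivalence. -/
def thetaDomCongr {T T' : Type*} [AddCommMonoid T] [Module ℂ T] [AddCommMonoid T'] [Module ℂ T']
    {τ : Representation ℂ A T} {τ' : Representation ℂ A T'} (R : Representation ℂ (A × B) E)
    (e : Representation.Equiv τ τ') : Representation.Equiv (Theta R τ) (Theta R τ') :=
  Representation.Equiv.mk
    { toFun := fun f => f.comp e.symm.toIntertwiningMap
      invFun := fun f => f.comp e.toIntertwiningMap
      left_inv := fun f => by
        ext x
        change f (e.symm (e x)) = f x
        rw [Representation.Equiv.symm_apply_apply]
      right_inv := fun f => by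
        ext x
        change f (e (e.symm x)) = f x
        rw [Representation.Equiv.apply_symm_apply]
      map_add' := fun _ _ => rfl
      map_smul' := fun _ _ => rfl }
    fun _ => rfl

/-- An irreducible representation of the second factor that occurs in `R` is some `Θ(τ)`. -/
theorem exists_equiv_theta [Finite B] [FiniteDimensional ℂ E] {R : Representation ℂ (A × B) E}
    (hR : CommutantSpanned R) {D : Type*} [AddCommGroup D] [Module ℂ D]
    {σ : Representation ℂ B D} (hσ : σ.IsIrreducible) (f : IntertwiningMap σ (resSnd R))
    (hf : f ≠ 0) :
    ∃ X : Subrepresentation (multRep R σ), Representation.IsIrreducible (V := X.toSubmodule)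
      (subRep X) ∧ Nonempty (Representation.Equiv σ (Theta R (subRep X))) := by
  have := IsIrred.finiteDimensional hσ
  have : Nontrivial (IntertwiningMap σ (resSnd R)) := ⟨f, 0, hf⟩
  have : FiniteDimensional ℂ (IntertwiningMap σ (resSnd R)) := by
    let I : IntertwiningMap σ (resSnd R) →ₗ[ℂ] (D →ₗ[ℂ] E) :=
      { toFun := fun f => f.toLinearMap
        map_add' := fun _ _ => rfl
        map_smul' := fun _ _ => rfl }
    exact Module.Finite.of_injective I fun f f' h => IntertwiningMap.ext h
  obtain ⟨X, hX⟩ := exists_irreducible_sub (multRep R σ)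
  refine ⟨X, hX, ?_⟩
  -- Evaluation: a vector of `σ` sends each intertwiner in `X` to its value there.
  let j : D → ThetaSpace R (subRep X) := fun w =>
    ⟨{ toFun := fun x => x.1 w
       map_add' := fun _ _ => rfl
       map_smul' := fun _ _ => rfl }, fun a => rfl⟩
  let J : IntertwiningMap σ (Theta R (subRep X)) :=
    ⟨{ toFun := j
       map_add' := fun w w' => by
        ext x
        change x.1 (w + w') = x.1 w + x.1 w'
        rw [map_add]
       map_smul' := fun c w => by
        ext x
        change x.1 (c • w) = c • x.1 w
        rw [map_smul] }, fun b => LinearMap.ext fun w => by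
      ext x
      exact map_rep x.1 b w⟩
  obtain ⟨x, hx⟩ := IsIrred.exists_ne hX
  have hJ : J ≠ 0 := by
    intro h0
    apply hx
    apply Subtype.ext
    ext w
    have h1 : J w x = 0 := by
      rw [h0]
      rfl
    exact h1
  have : Nontrivial (ThetaSpace R (subRep X)) := by
    obtain ⟨w, hw⟩ : ∃ w, J w ≠ 0 := by
      by_contra hcon
      push Not at hcon
      exact hJ (IntertwiningMap.ext (LinearMap.ext hcon))
    exact ⟨_, _, hw⟩
  exact IsIrred.nonempty_equiv hσ (theta_isIrreducible hR hX) J hJ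

end Multiplicity

/-! ### Completeness of the list in dimension `(q - 1) / 2` -/

section Uniqueness

variable {F : Type u} [Field F] [Fintype F] [DecidableEq F] {ε : F} {ψ : AddChar F ℂ}
  {R : Representation ℂ (Ortho ε × SL2 F) ((Fin 2 → F) → ℂ)}

omit [DecidableEq F] in
-- If the action is trivial, a nonzero linear functional is an intertwiner to the empty product, so
-- the rank is zero.
theorem not_trivial_of_hasTensorRank_one {D : Type*} [AddCommGroup D] [Module ℂ D]
    {σ : Representation ℂ (SL2 F) D} (hσ : σ.IsIrreducible) (h : HasTensorRank 1 σ) :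
    ¬ ∀ g, σ g = 1 := by
  intro h1
  obtain ⟨v, hv⟩ := IsIrred.exists_ne hσ
  obtain ⟨l, hl⟩ := Module.Projective.exists_dual_ne_zero ℂ hv
  refine h.2 0 one_pos (IsFoldProduct.inFiltration IsFoldProduct.zero hσ
    ⟨l, fun g => LinearMap.ext fun w => ?_⟩ fun h0 => hl (DFunLike.congr_fun h0 v))
  change l (σ g w) = l w
  rw [h1]
  rfl

/-- If `Θ(τ)` has dimension `(q - 1) / 2`, then `τ` is one of the two eigenspaces of a reflection
in `τ_μ`, where `μ` has order two. -/
theorem IsModel.equiv_tauEigen_of_finrank (hR : IsModel ε ψ R) (hε : ¬ IsSquare ε)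
    (h2 : (2 : F) ≠ 0) {T : Type*} [AddCommGroup T] [Module ℂ T]
    {τ : Representation ℂ (Ortho ε) T} (hτ : τ.IsIrreducible)
    (hdim : 2 * Module.finrank ℂ (ThetaSpace R τ) + 1 = Fintype.card F) {μ : SOrtho ε →* ℂˣ}
    (hμ1 : μ ≠ 1) (hμ : μ ^ 2 = 1) {r : Ortho ε} (hr : r ∉ SOrtho ε) :
    Nonempty (Representation.Equiv τ (subRep (tauEigen hε h2 hμ hr 1))) ∨
    Nonempty (Representation.Equiv τ (subRep (tauEigen hε h2 hμ hr (-1)))) := by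
  have := IsIrred.finiteDimensional hτ
  have h3 := three_le_card h2
  -- Otherwise `τ` is trivial or `sgn`, and the multiplicity space has dimension `q` or `0`.
  have hso : ¬ ∀ s ∈ SOrtho ε, τ s = LinearMap.id := by
    intro hso
    obtain ⟨hT, h4 | h4⟩ := trivial_or_isSgn hε h2 hτ hso
    · have h5 := hR.finrank_theta_of_trivial hε h2 hT h4
      omega
    · have h5 := hR.finrank_theta hε h2 τ
      have e1 : invariants τ = ⊥ := by
        rw [eq_bot_iff]
        intro v hv
        have h6 := (mem_invariants _ v).1 hv r
        rw [(h4.2 r).2 hr] at h6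
        have h7 : (2 : ℂ) • v = 0 := by
          rw [two_smul]
          nth_rewrite 1 [← h6]
          exact neg_add_cancel v
        exact (Submodule.mem_bot ℂ).2 ((smul_eq_zero.1 h7).resolve_left two_ne_zero)
      have e2 : invariants (resSO τ) = ⊤ := eq_top_iff.2 fun v _ =>
        (mem_invariants _ v).2 fun s => LinearMap.congr_fun (hso s s.2) v
      rw [e1, e2, finrank_top, finrank_bot, hT] at h5
      omega
  have hT : Module.finrank ℂ T = 1 := by
    have h4 := hR.two_mul_finrank_theta hε h2 ((invariants_eq_bot_or_top hτ).resolve_right hso)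
    have h5 : (Fintype.card F - 1) * Module.finrank ℂ T = (Fintype.card F - 1) * 1 := by omega
    exact Nat.eq_of_mul_eq_mul_left (by omega) h5
  let χ' : Ortho ε →* ℂ := (LinearMap.det : Module.End ℂ T →* ℂ).comp τ
  have hχ' : ∀ a v, τ a v = χ' a • v := by
    intro a v
    obtain ⟨v₀, hv₀⟩ := IsIrred.exists_ne hτ
    have hex := (finrank_eq_one_iff_of_nonzero' v₀ hv₀).1 hT
    obtain ⟨c, hc⟩ := hex (τ a v₀)
    have h4 : τ a = c • (1 : Module.End ℂ T) := LinearMap.ext fun w => by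
      obtain ⟨d, rfl⟩ := hex w
      rw [map_smul, ← hc, smul_comm]
      rfl
    have h5 : χ' a = c := by
      change LinearMap.det (τ a) = c
      rw [h4, LinearMap.det_smul, hT, map_one, pow_one, mul_one]
    rw [h5, h4]
    rfl
  let χ : SOrtho ε →* ℂˣ := (χ'.comp (SOrtho ε).subtype).toHomUnits
  have hχ : ∀ (s : SOrtho ε) v, τ s v = (χ s : ℂ) • v := fun s v => hχ' s v
  have hχ1 : χ ≠ 1 := by
    intro h4
    refine hso fun s hs => LinearMap.ext fun v => ?_
    have h5 := hχ ⟨s, hs⟩ v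
    rw [h4] at h5
    exact h5.trans (one_smul ℂ v)
  -- Conjugation by a reflection inverts rotations, while a one-dimensional character ignores
  -- conjugation.
  have hχ2 : χ ^ 2 = 1 := by
    ext s
    have h4 : χ' r * χ' s = χ' s⁻¹ * χ' r := by
      rw [← map_mul, refl_conj hε s.2 hr, map_mul]
    have h5 : χ' r ≠ 0 := by
      have h6 : χ' r * χ' r = 1 := by rw [← map_mul, mul_self_notMem hε hr, map_one]
      exact left_ne_zero_of_mul_eq_one h6
    have h6 : χ' s = χ' s⁻¹ := mul_left_cancel₀ h5 (h4.trans (mul_comm _ _))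
    change χ' s ^ 2 = 1
    rw [sq]
    nth_rewrite 2 [h6]
    rw [← map_mul, mul_inv_cancel, map_one]
  have hχμ := char_eq_of_sq_eq_one hε h2 hμ1 hμ hχ1 hχ2
  rw [hχμ] at hχ
  exact equiv_tauEigen hε h2 hμ hr hT hχ

/-- A unipotent-fixed vector would make so small a representation trivial, contrary to rank one. So
`σ` occurs in the oscillator representation and is some `Θ(τ)`, and its dimension identifies `τ`. -/
theorem IsModel.equiv_theta_of_hasTensorRank_one (hR : IsModel ε ψ R)
    (hd : IsSchrodingerDatum (betaForm ε) ψ) (hε : ¬ IsSquare ε) {μ : SOrtho ε →* ℂˣ}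
    (hμ1 : μ ≠ 1) (hμ : μ ^ 2 = 1) {r : Ortho ε} (hr : r ∉ SOrtho ε)
    {D : Type*} [AddCommGroup D] [Module ℂ D]
    {σ : Representation ℂ (SL2 F) D} (hσ : σ.IsIrreducible) (h : HasTensorRank 1 σ)
    (hdim : 2 * Module.finrank ℂ D + 1 = Fintype.card F) :
    Nonempty (Representation.Equiv σ (Theta R (subRep (tauEigen hε hd.two_ne hμ hr 1)))) ∨
    Nonempty (Representation.Equiv σ (Theta R (subRep (tauEigen hε hd.two_ne hμ hr (-1))))) := by
  have := IsIrred.finiteDimensional hσ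
  obtain ⟨f, hf⟩ := hR.exists_intertwining hd hε hσ hdim fun v hv => by
    by_contra hv0
    exact not_trivial_of_hasTensorRank_one hσ h
      (forall_eq_id_of_low_fixed hd.psi_ne (by omega) hv0 hv)
  obtain ⟨X, hX, ⟨e⟩⟩ := exists_equiv_theta (hR.commutantSpanned hd hε) hσ f hf
  have hdim' : 2 * Module.finrank ℂ (ThetaSpace R (subRep X)) + 1 = Fintype.card F := by
    rw [← hdim, e.toLinearEquiv.finrank_eq]
  rcases hR.equiv_tauEigen_of_finrank hε hd.two_ne hX hdim' hμ1 hμ hr with ⟨⟨e'⟩⟩ | ⟨⟨e'⟩⟩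
  · refine Or.inl ⟨e.trans ?_⟩
    exact thetaDomCongr R e'
  · refine Or.inr ⟨e.trans ?_⟩
    exact thetaDomCongr R e'

end Uniqueness

/-! ### Recognising the Steinberg representation -/

section Steinberg

variable {F : Type u} [Field F]

theorem vec_ne_zero : (![0, 1] : Fin 2 → F) ≠ 0 := fun h => one_ne_zero (congrFun h 1)

/-- The line spanned by the second basis vector. -/
def lineZero (F : Type u) [Field F] : Projectivization F (Fin 2 → F) :=
  Projectivization.mk F ![0, 1] vec_ne_zero

theorem smul_lineZero (g : SL2 F) : g • lineZero F = lineZero F ↔ g 0 1 = 0 := by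
  rw [lineZero, Projectivization.smul_mk, Projectivization.mk_eq_mk_iff']
  have h0 : (g • ![0, 1] : Fin 2 → F) = ![g 0 1, g 1 1] := by
    change g.1.mulVec ![0, 1] = _
    refine plane_ext ?_ ?_ <;> simp [Matrix.mulVec, dotProduct, Fin.sum_univ_two]
  rw [h0]
  constructor
  · rintro ⟨a, ha⟩
    have h1 := congrFun ha 0
    simpa using h1.symm
  · intro h1
    exact ⟨g 1 1, by rw [h1]; exact plane_ext (by simp) (by simp)⟩

/-- Lower triangular elements. -/
theorem eq_low_mul_dg {g : SL2 F} (hg : g 0 1 = 0) : ∃ t s, g = low t * dg s := by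
  have hd := sl2_det g
  rw [hg, zero_mul, sub_zero] at hd
  have h0 : g 0 0 ≠ 0 := left_ne_zero_of_mul_eq_one hd
  refine ⟨g 1 0 / g 0 0, Units.mk0 _ h0, sl2_ext ?_ ?_ ?_ ?_⟩ <;> rw [sl2_mul_apply] <;>
    simp [dg, hg]
  · field_simp
  · exact eq_inv_of_mul_eq_one_right hd

variable [Fintype F]

instance : Fintype (Projectivization F (Fin 2 → F)) := Fintype.ofFinite _

theorem card_lines : Fintype.card (Projectivization F (Fin 2 → F)) = Fintype.card F + 1 := by
  rw [← Nat.card_eq_fintype_card, Projectivization.card_of_finrank_two F (Fin 2 → F) (by simp),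
    Nat.card_eq_fintype_card]

theorem mem_steinbergSub (f : Projectivization F (Fin 2 → F) → ℂ) :
    f ∈ steinbergSub F ↔ ∑ x, f x = 0 := by
  rw [← finsum_eq_sum_of_fintype]
  rfl

theorem finrank_steinberg : Module.finrank ℂ (steinbergSub F).toSubmodule = Fintype.card F := by
  let S : (Projectivization F (Fin 2 → F) → ℂ) →ₗ[ℂ] ℂ :=
    ∑ x, LinearMap.proj (R := ℂ) (φ := fun _ => ℂ) x
  have hS : ∀ f, S f = ∑ x, f x := fun f => by
    simp only [S, LinearMap.sum_apply, LinearMap.proj_apply]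
  have h1 : (steinbergSub F).toSubmodule = LinearMap.ker S := by
    ext f
    rw [LinearMap.mem_ker, hS]
    exact mem_steinbergSub f
  have h2 := LinearMap.finrank_range_add_finrank_ker S
  have h3 : LinearMap.range S = ⊤ := by
    classical
    refine LinearMap.range_eq_top.2 fun c => ⟨Pi.single (lineZero F) c, ?_⟩
    rw [hS, Finset.sum_pi_single']
    simp
  rw [h3, finrank_top, Module.finrank_self, Module.finrank_fintype_fun_eq_card, card_lines,
    ← h1] at h2
  omega

variable {D : Type*} [AddCommGroup D] [Module ℂ D] {σ : Representation ℂ (SL2 F) D}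

/-- The map from functions on lines determined by a vector. -/
def lineMap (σ : Representation ℂ (SL2 F) D) (v : D) : IntertwiningMap (lineRep F) σ :=
  ⟨{ toFun := fun φ => ∑ g : SL2 F, φ (g • lineZero F) • σ g v
     map_add' := fun φ φ' => by
      rw [← Finset.sum_add_distrib]
      exact Finset.sum_congr rfl fun g _ => add_smul _ _ _
     map_smul' := fun c φ => by
      rw [RingHom.id_apply, Finset.smul_sum]
      exact Finset.sum_congr rfl fun g _ => mul_smul _ _ _ }, fun h => LinearMap.ext fun φ => by
    change ∑ g : SL2 F, φ (h⁻¹ • g • lineZero F) • σ g v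
      = σ h (∑ g : SL2 F, φ (g • lineZero F) • σ g v)
    rw [map_sum, ← Equiv.sum_comp (Equiv.mulLeft h)]
    refine Finset.sum_congr rfl fun g _ => ?_
    rw [map_smul, Equiv.coe_mulLeft, map_mul, ← mul_smul, inv_mul_cancel_left]
    rfl⟩

omit [Fintype F] in
theorem lower_fixed {v : D} (hlow : ∀ t, σ (low t) v = v) (hdg : ∀ s, σ (dg s) v = v) {g : SL2 F}
    (hg : g • lineZero F = lineZero F) : σ g v = v := by
  obtain ⟨t, s, rfl⟩ := eq_low_mul_dg ((smul_lineZero g).1 hg)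
  rw [map_mul, Module.End.mul_apply, hdg, hlow]

theorem lineMap_apply (v : D) (φ : Projectivization F (Fin 2 → F) → ℂ) :
    lineMap σ v φ = ∑ g : SL2 F, φ (g • lineZero F) • σ g v := rfl

/-- On the indicator of `lineZero` the map gives `v` times the order of the stabiliser, as the
stabiliser fixes `v`. -/
theorem lineMap_ne_zero {v : D} (hv0 : v ≠ 0) (hlow : ∀ t, σ (low t) v = v)
    (hdg : ∀ s, σ (dg s) v = v) : lineMap σ v ≠ 0 := by
  classical
  intro h0
  have h1 : lineMap σ v (Pi.single (lineZero F) 1) = 0 := by rw [h0]; rfl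
  have h3 : ∀ g : SL2 F, (Pi.single (lineZero F) 1 : _ → ℂ) (g • lineZero F) • σ g v
      = if g • lineZero F = lineZero F then v else 0 := by
    intro g
    rw [Pi.single_apply]
    split_ifs with hg
    · rw [one_smul, lower_fixed hlow hdg hg]
    · rw [zero_smul]
  rw [lineMap_apply, Finset.sum_congr rfl fun g _ => h3 g, ← Finset.sum_filter, Finset.sum_const,
    ← Nat.cast_smul_eq_nsmul ℂ] at h1
  rcases smul_eq_zero.1 h1 with h4 | h4
  · rw [Nat.cast_eq_zero, Finset.card_eq_zero] at h4
    have h5 : (1 : SL2 F) ∈ Finset.univ.filter fun g : SL2 F => g • lineZero F = lineZero F :=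
      Finset.mem_filter.2 ⟨Finset.mem_univ _, one_smul _ _⟩
    rw [h4] at h5
    exact absurd h5 (Finset.notMem_empty _)
  · exact hv0 h4

theorem sub_average_mem (φ : Projectivization F (Fin 2 → F) → ℂ) :
    φ - ((∑ x, φ x) / (Fintype.card F + 1)) • (fun _ => 1) ∈ steinbergSub F := by
  rw [mem_steinbergSub]
  simp only [Pi.sub_apply, Pi.smul_apply, Finset.sum_sub_distrib, smul_eq_mul, mul_one,
    Finset.sum_const, Finset.card_univ, card_lines, nsmul_eq_mul]
  push_cast
  rw [mul_div_cancel₀ _ (Nat.cast_add_one_ne_zero _), sub_self]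

/-- An irreducible representation of dimension `q` with a vector fixed by the lower triangular
elements is the Steinberg representation. -/
theorem equiv_steinberg (hσ : σ.IsIrreducible) (hdim : Module.finrank ℂ D = Fintype.card F)
    {v : D} (hv0 : v ≠ 0) (hlow : ∀ t, σ (low t) v = v) (hdg : ∀ s, σ (dg s) v = v) :
    Nonempty (Representation.Equiv σ (steinberg F)) := by
  have := IsIrred.finiteDimensional hσ
  have hne := lineMap_ne_zero hv0 hlow hdg
  have hsurj := IsIrred.surjective hσ _ hne
  let J : IntertwiningMap (steinberg F) σ :=
    ⟨(lineMap σ v).toLinearMap ∘ₗ (steinbergSub F).toSubmodule.subtype, fun g =>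
      LinearMap.ext fun φ => map_rep (lineMap σ v) g φ.1⟩
  have hJ : J ≠ 0 := by
    intro h0
    have h1 : ∀ φ ∈ steinbergSub F, lineMap σ v φ = 0 := fun φ hφ =>
      DFunLike.congr_fun h0 ⟨φ, hφ⟩
    -- If the map vanished on functions of sum zero, its image would be spanned by the image of the
    -- constants, against `q > 1`.
    have h2 : Module.finrank ℂ D ≤ 1 := by
      refine finrank_le_one (lineMap σ v fun _ => 1) fun w => ?_
      obtain ⟨φ, rfl⟩ := hsurj w
      refine ⟨(∑ x, φ x) / (Fintype.card F + 1), ?_⟩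
      have h3 := h1 _ (sub_average_mem φ)
      rw [map_sub, map_smul, sub_eq_zero] at h3
      exact h3.symm
    have h3 : 1 < Fintype.card F := Fintype.one_lt_card
    omega
  have hJs := IsIrred.surjective hσ J hJ
  have hfin : Module.finrank ℂ (steinbergSub F).toSubmodule = Module.finrank ℂ D := by
    rw [finrank_steinberg, hdim]
  have hJi : Function.Injective J.toLinearMap :=
    (LinearMap.injective_iff_surjective_of_finrank_eq_finrank hfin).2 hJs
  have hJb : Function.Bijective J := ⟨hJi, hJs⟩
  generalize J = J' at hJb
  exact ⟨(J'.ofBijective hJb).symm⟩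

end Steinberg

/-! ### The theta lift of the trivial representation -/

section ThetaTrivial

variable {F : Type u} [Field F] [Fintype F] [DecidableEq F] {ε : F} {ψ : AddChar F ℂ}
  {R : Representation ℂ (Ortho ε × SL2 F) ((Fin 2 → F) → ℂ)}

/-- The delta function at the origin is invariant under isometries, under multiplication by `ψ(-t N
/ 2)` and under dilations. It therefore defines a vector of `Θ(1)` fixed by the lower triangular
group. -/
theorem IsModel.theta_trivial_equiv_steinberg (hR : IsModel ε ψ R)
    (hd : IsSchrodingerDatum (betaForm ε) ψ) (hε : ¬ IsSquare ε) :
    Nonempty (Representation.Equiv (Theta R (Representation.trivial ℂ (Ortho ε) ℂ))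
      (steinberg F)) := by
  have hirr := hR.theta_isIrreducible hd hε trivial_isIrreducible (not_isSgn_trivial hd.two_ne)
  let δ : (Fin 2 → F) → ℂ := Pi.single 0 1
  have hδ : ∀ x, δ x = if x = 0 then 1 else 0 := fun x => Pi.single_apply _ _ _
  have hperm : ∀ a : Ortho ε, R (a, 1) δ = δ := by
    intro a
    rw [hR.perm]
    funext x
    rw [permOp_apply, hδ, hδ]
    have h1 : (a⁻¹ : Ortho ε).1 x = 0 ↔ x = 0 := (a⁻¹ : Ortho ε).1.map_eq_zero_iff
    simp only [h1]
  have hlow : ∀ t, R (1, low t) δ = δ := by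
    intro t
    rw [hR.apply_low hd]
    funext x
    change ψ (-(t / 2) * nrm ε x) * δ x = δ x
    by_cases hx : x = 0
    · rw [hx]
      simp [nrm]
    · rw [show δ x = 0 from Pi.single_eq_of_ne hx 1, mul_zero]
  have hdg : ∀ s, R (1, dg s) δ = δ := by
    intro s
    rw [hR.apply_dg hd hε]
    funext x
    rw [dilOp_apply, hδ, hδ]
    simp only [smul_eq_zero_iff_eq]
  let f : ThetaSpace R (Representation.trivial ℂ (Ortho ε) ℂ) :=
    ⟨LinearMap.toSpanSingleton ℂ _ δ, fun a => LinearMap.ext fun c => by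
      change c • δ = R (a, 1) (c • δ)
      rw [map_smul, hperm]⟩
  have hf : f ≠ 0 := by
    intro h0
    have h1 : (1 : ℂ) • δ = 0 := DFunLike.congr_fun h0 (1 : ℂ)
    have h2 := congrFun h1 0
    simp [δ] at h2
  refine equiv_steinberg hirr (hR.finrank_theta_of_trivial hε hd.two_ne (Module.finrank_self ℂ)
    fun _ => rfl) hf (fun t => ?_) fun s => ?_
  · refine IntertwiningMap.ext (LinearMap.ext fun c => ?_)
    change R (1, low t) (c • δ) = c • δ
    rw [map_smul, hlow]
  · refine IntertwiningMap.ext (LinearMap.ext fun c => ?_)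
    change R (1, dg s) (c • δ) = c • δ
    rw [map_smul, hdg]

end ThetaTrivial

/-! ### The two halves of the induced representation for the quadratic character -/

section Eigenspaces

variable {F : Type u} [Field F] {ε : F} {μ : SOrtho ε →* ℂˣ}

theorem isCompl_tauEigen (hε : ¬ IsSquare ε) (h2 : (2 : F) ≠ 0) (hμ : μ ^ 2 = 1) {r : Ortho ε}
    (hr : r ∉ SOrtho ε) : IsCompl (tauEigen hε h2 hμ hr 1) (tauEigen hε h2 hμ hr (-1)) := by
  have hsq : ∀ f, tauInd μ r (tauInd μ r f) = f := fun f => by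
    rw [← Module.End.mul_apply, ← map_mul, mul_self_notMem hε hr, map_one]
    rfl
  constructor
  · intro X h1 h3 f hf
    have e1 := (mem_tauEigen hε h2 hμ hr 1 f).1 (h1 hf)
    have e2 := (mem_tauEigen hε h2 hμ hr (-1) f).1 (h3 hf)
    have e3 : (2 : ℂ) • f = 0 := by
      rw [e1] at e2
      rw [one_smul] at e2
      rw [two_smul]
      nth_rewrite 1 [e2]
      exact (congrArg (· + f) (neg_one_smul ℂ f)).trans (neg_add_cancel f)
    exact (Submodule.mem_bot ℂ).2 ((smul_eq_zero.1 e3).resolve_left two_ne_zero)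
  · intro X h1 h3 f _
    have e1 : (1 / 2 : ℂ) • (f + tauInd μ r f) ∈ tauEigen hε h2 hμ hr 1 := by
      rw [mem_tauEigen, map_smul, map_add, hsq, one_smul, add_comm]
    have e2 : (1 / 2 : ℂ) • (f - tauInd μ r f) ∈ tauEigen hε h2 hμ hr (-1) := by
      rw [mem_tauEigen, map_smul, map_sub, hsq]
      module
    have e3 : f = (1 / 2 : ℂ) • (f + tauInd μ r f) + (1 / 2 : ℂ) • (f - tauInd μ r f) := by
      module
    rw [e3]
    exact X.toSubmodule.add_mem (h1 e1) (h3 e2)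

theorem tauEigen_isIrreducible (hε : ¬ IsSquare ε) (h2 : (2 : F) ≠ 0) (hμ : μ ^ 2 = 1)
    {r : Ortho ε} (hr : r ∉ SOrtho ε) {η : ℂ} (hη : η * η = 1) :
    Representation.IsIrreducible (V := (tauEigen hε h2 hμ hr η).toSubmodule)
      (subRep (tauEigen hε h2 hμ hr η)) := by
  apply isIrreducible_of_finrank_eq_one
  exact finrank_tauEigen hε h2 hμ hr hη

theorem not_so_trivial_tauEigen (hε : ¬ IsSquare ε) (h2 : (2 : F) ≠ 0) (hμ1 : μ ≠ 1)
    (hμ : μ ^ 2 = 1) {r : Ortho ε} (hr : r ∉ SOrtho ε) {η : ℂ} (hη : η * η = 1) :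
    ¬ ∀ s ∈ SOrtho ε, subRep (tauEigen hε h2 hμ hr η) s = LinearMap.id := by
  intro h
  have hfin := finrank_tauEigen hε h2 hμ hr hη
  have : Nontrivial (tauEigen hε h2 hμ hr η).toSubmodule :=
    Module.nontrivial_of_finrank_pos (R := ℂ) (by omega)
  obtain ⟨f, hf⟩ := exists_ne (0 : (tauEigen hε h2 hμ hr η).toSubmodule)
  refine hμ1 (MonoidHom.ext fun s => Units.ext ?_)
  have h1 : tauInd μ (s : Ortho ε) f.1 = f.1 :=
    congrArg Subtype.val (LinearMap.congr_fun (h s s.2) f)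
  rw [tauInd_so_of_sq hε h2 hμ] at h1
  exact smul_left_injective ℂ (fun h0 => hf (Subtype.ext h0)) (h1.trans (one_smul ℂ f.1).symm)

theorem isEmpty_equiv_tauEigen (hε : ¬ IsSquare ε) (h2 : (2 : F) ≠ 0) (hμ : μ ^ 2 = 1)
    {r : Ortho ε} (hr : r ∉ SOrtho ε) :
    IsEmpty (Representation.Equiv (subRep (tauEigen hε h2 hμ hr 1))
      (subRep (tauEigen hε h2 hμ hr (-1)))) := by
  refine ⟨fun e => ?_⟩
  obtain ⟨f, hf⟩ := IsIrred.exists_ne (tauEigen_isIrreducible hε h2 hμ hr (mul_one 1))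
  have h1 : subRep (tauEigen hε h2 hμ hr 1) r f = f := by
    apply Subtype.ext
    exact ((mem_tauEigen hε h2 hμ hr 1 f.1).1 f.2).trans (one_smul ℂ _)
  have h3 : subRep (tauEigen hε h2 hμ hr (-1)) r (e f) = (-1 : ℂ) • e f := by
    apply Subtype.ext
    exact (mem_tauEigen hε h2 hμ hr (-1) (e f).1).1 (e f).2
  have h4 : e (subRep (tauEigen hε h2 hμ hr 1) r f)
      = subRep (tauEigen hε h2 hμ hr (-1)) r (e f) :=
    e.toIntertwiningMap.isIntertwining _ _ r f
  rw [h1, h3] at h4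
  have h5 : (2 : ℂ) • e f = 0 := by
    rw [two_smul]
    nth_rewrite 1 [h4]
    exact (congrArg (· + e f) (neg_one_smul ℂ (e f))).trans (neg_add_cancel _)
  exact hf (e.toLinearEquiv.map_eq_zero_iff.1 ((smul_eq_zero.1 h5).resolve_left two_ne_zero))

end Eigenspaces

end EtaCorr

end
-- The correspondence for an arbitrary oscillator representation
open EtaCorr in
theorem proposition4 {F : Type*} [Field F] [Fintype F] [DecidableEq F]
    (hF : ringChar F ≠ 2) (ε : F) (hε : ¬ IsSquare ε) (ψ : AddChar F ℂ) (hψ : ψ ≠ 1) :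
    (∃ (π : Representation ℂ (Heis (tensorForm ε)) ((Fin 2 → F) → ℂ))
        (ω : Representation ℂ (isometryGroup (tensorForm ε)) ((Fin 2 → F) → ℂ)),
        IsOscillator (tensorForm ε) ψ π ω) ∧
    ∀ (E : Type*) [AddCommGroup E] [Module ℂ E]
      (π : Representation ℂ (Heis (tensorForm ε)) E)
      (ω : Representation ℂ (isometryGroup (tensorForm ε)) E),
      IsOscillator (tensorForm ε) ψ π ω →
      -- every irreducible `τ ≠ sgn` appears, and `Θ(τ)` is irreducible
      (∀ (T : Type*) [AddCommGroup T] [Module ℂ T] (τ : Representation ℂ (Ortho ε) T),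
        τ.IsIrreducible → ¬ IsSgn τ →
          (∃ f : Representation.IntertwiningMap τ (resFst (oscRes ε ω)), Function.Injective f) ∧
          (Theta (oscRes ε ω) τ).IsIrreducible) ∧
      -- the `Θ(τ)` are pairwise non-isomorphic
      (∀ (T T' : Type*) [AddCommGroup T] [Module ℂ T] [AddCommGroup T'] [Module ℂ T']
        (τ : Representation ℂ (Ortho ε) T) (τ' : Representation ℂ (Ortho ε) T'),
        τ.IsIrreducible → ¬ IsSgn τ → τ'.IsIrreducible → ¬ IsSgn τ' →
          Nonempty (Representation.Equiv (Theta (oscRes ε ω) τ) (Theta (oscRes ε ω) τ')) →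
          Nonempty (Representation.Equiv τ τ')) ∧
      -- on the `2`-spectrum the algebras generated by `O` and `G` are each other's commutant
      (Subalgebra.centralizer ℂ
          (groupAlg (resFst (rankSpectrum (oscRes ε ω) 2).toRepresentation) : Set _)
        = groupAlg (resSnd (rankSpectrum (oscRes ε ω) 2).toRepresentation) ∧
       Subalgebra.centralizer ℂ
          (groupAlg (resSnd (rankSpectrum (oscRes ε ω) 2).toRepresentation) : Set _)
        = groupAlg (resFst (rankSpectrum (oscRes ε ω) 2).toRepresentation)) ∧
      -- (1) `Θ(1)`
      (HasTensorRank 2 (Theta (oscRes ε ω) (Representation.trivial ℂ (Ortho ε) ℂ)) ∧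
        Module.finrank ℂ (ThetaSpace (oscRes ε ω) (Representation.trivial ℂ (Ortho ε) ℂ)) = Fintype.card F ∧
        Nonempty (Representation.Equiv
          (Theta (oscRes ε ω) (Representation.trivial ℂ (Ortho ε) ℂ)) (steinberg F))) ∧
      -- (2) `Θ(τ_μ)` for `μ ≠ μ⁻¹`
      (∀ μ : SOrtho ε →* ℂˣ, μ ≠ μ⁻¹ →
        (tauInd μ).IsIrreducible ∧ HasTensorRank 2 (Theta (oscRes ε ω) (tauInd μ)) ∧
        Module.finrank ℂ (ThetaSpace (oscRes ε ω) (tauInd μ))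
          = Fintype.card F - 1) ∧
      -- (3) `Θ(τ_{μ₂}^±)`, where `τ_{μ₂}^±` are the components of `τ_{μ₂}` on which a given
      -- reflection `r` acts by `±1`
      (∀ μ₂ : SOrtho ε →* ℂˣ, μ₂ ≠ 1 → μ₂ ^ 2 = 1 → ∀ r : Ortho ε, r ∉ SOrtho ε →
        ∃ P M : Subrepresentation (tauInd μ₂),
          (∀ f, f ∈ P ↔ tauInd μ₂ r f = f) ∧ (∀ f, f ∈ M ↔ tauInd μ₂ r f = -f) ∧
          IsCompl P M ∧ (subRep P).IsIrreducible ∧ (subRep M).IsIrreducible ∧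
          (HasTensorRank 1 (Theta (oscRes ε ω) (subRep P)) ∧
            Module.finrank ℂ (ThetaSpace (oscRes ε ω) (subRep P)) = (Fintype.card F - 1) / 2) ∧
          (HasTensorRank 1 (Theta (oscRes ε ω) (subRep M)) ∧
            Module.finrank ℂ (ThetaSpace (oscRes ε ω) (subRep M)) = (Fintype.card F - 1) / 2) ∧
          IsEmpty (Representation.Equiv (Theta (oscRes ε ω) (subRep P))
            (Theta (oscRes ε ω) (subRep M))) ∧
          (∀ (D : Type*) [AddCommGroup D] [Module ℂ D] (σ : Representation ℂ (SL2 F) D),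
            σ.IsIrreducible → HasTensorRank 1 σ →
            Module.finrank ℂ D = (Fintype.card F - 1) / 2 →
              Nonempty (Representation.Equiv σ (Theta (oscRes ε ω) (subRep P))) ∨
              Nonempty (Representation.Equiv σ (Theta (oscRes ε ω) (subRep M))))) := by
  have h2 : (2 : F) ≠ 0 := Ring.two_ne_zero hF
  have hd := isSchrodingerDatum_plane hε h2 hψ
  have h3 := three_le_card h2
  have hodd := card_odd h2
  refine ⟨exists_isOscillator hd, fun E _ _ π ω hω => ?_⟩
  -- All assertions are invariant under equivalence of representations of the product, so they are
  -- transported from the model along `e`.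
  obtain ⟨R, hR, ⟨e⟩⟩ := exists_isModel hF hε h2 hψ hω
  have hE : FiniteDimensional ℂ E := Module.Finite.equiv e.toLinearEquiv.symm
  have hcR := hR.commutantSpanned hd hε
  have hc : CommutantSpanned (oscRes ε ω) := CommutantSpanned.congr e.symm hcR
  refine ⟨fun T _ _ τ hτ hsgn => ?_, fun T T' _ _ _ _ τ τ' hτ hsgn hτ' hsgn' h => ?_,
    ⟨centralizer_groupAlg_fst hc _, centralizer_groupAlg_snd hc _⟩, ⟨?_, ?_, ?_⟩,
    fun μ hμ => ⟨tauInd_isIrreducible hε h2 hμ, ?_, ?_⟩, fun μ hμ1 hμ r hr => ?_⟩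
  · have hirr := IsIrred.congr (thetaCongr e τ).symm (hR.theta_isIrreducible hd hε hτ hsgn)
    obtain ⟨f, hf⟩ := IsIrred.exists_ne hirr
    exact ⟨⟨f, IsIrred.injective hτ f hf⟩, hirr⟩
  · have := IsIrred.nontrivial
      (IsIrred.congr (thetaCongr e τ).symm (hR.theta_isIrreducible hd hε hτ hsgn))
    obtain ⟨φ⟩ := h
    exact nonempty_equiv_of_theta hc hτ hτ' φ
  · exact HasTensorRank.congr (thetaCongr e _).symm (hR.hasTensorRank_trivial hd hε)
  · rw [(thetaCongr e _).toLinearEquiv.finrank_eq]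
    exact hR.finrank_theta_of_trivial hε h2 (Module.finrank_self ℂ) fun _ => rfl
  · obtain ⟨φ⟩ := hR.theta_trivial_equiv_steinberg hd hε
    exact ⟨(thetaCongr e _).trans φ⟩
  · exact HasTensorRank.congr (thetaCongr e _).symm (hR.hasTensorRank_tauInd hd hε hμ).1
  · rw [(thetaCongr e _).toLinearEquiv.finrank_eq]
    exact (hR.hasTensorRank_tauInd hd hε hμ).2
  · have key : ∀ η : ℂ, η * η = 1 →
        HasTensorRank 1 (Theta (oscRes ε ω) (subRep (tauEigen hε h2 hμ hr η))) ∧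
        Module.finrank ℂ (ThetaSpace (oscRes ε ω) (subRep (tauEigen hε h2 hμ hr η)))
          = (Fintype.card F - 1) / 2 := by
      intro η hη
      obtain ⟨h4, h5⟩ := hR.hasTensorRank_one hd hε
        (T := (tauEigen hε h2 hμ hr η).toSubmodule) (τ := subRep (tauEigen hε h2 hμ hr η))
        (finrank_tauEigen hε h2 hμ hr hη)
        (not_so_trivial_tauEigen hε h2 hμ1 hμ hr hη)
      refine ⟨HasTensorRank.congr (thetaCongr e _).symm h5, ?_⟩
      rw [(thetaCongr e _).toLinearEquiv.finrank_eq]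
      omega
    have hη : (-1 : ℂ) * -1 = 1 := by norm_num
    have hP := tauEigen_isIrreducible hε h2 hμ hr (mul_one 1)
    have hM := tauEigen_isIrreducible hε h2 hμ hr hη
    refine ⟨tauEigen hε h2 hμ hr 1, tauEigen hε h2 hμ hr (-1), fun f => ?_, fun f => ?_,
      isCompl_tauEigen hε h2 hμ hr, hP, hM, key 1 (mul_one 1), key (-1) hη, ⟨fun φ => ?_⟩,
      fun D _ _ σ hσ hrank hdim => ?_⟩
    · rw [mem_tauEigen, one_smul]
    · rw [mem_tauEigen, show (-1 : ℂ) • f = -f from neg_one_smul ℂ f]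
    · have : Nontrivial (ThetaSpace (oscRes ε ω) (subRep (tauEigen hε h2 hμ hr 1))) :=
        Module.nontrivial_of_finrank_pos (R := ℂ) (by rw [(key 1 (mul_one 1)).2]; omega)
      obtain ⟨e'⟩ := nonempty_equiv_of_theta hc hP hM φ
      exact (isEmpty_equiv_tauEigen hε h2 hμ hr).false e'
    · rcases hR.equiv_theta_of_hasTensorRank_one hd hε hμ1 hμ hr hσ hrank (by omega)
        with ⟨⟨e'⟩⟩ | ⟨⟨e'⟩⟩
      · exact Or.inl ⟨e'.trans (thetaCongr e _).symm⟩
      · exact Or.inr ⟨e'.trans (thetaCongr e _).symm⟩
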